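/- Let $\eta^1,\eta^2,\eta^3$ be the left-invariant coframe of $\mathbb S^3$ with $d\eta^1=-2\eta^2\wedge\eta^3$ (and cyclic permutations). A $U(2)$-invariant metric is $$g=C\Big(\tfrac1{4F}dz^2+F(\eta^1)^2+(\eta^2)^2+(\eta^3)^2\Big),\qquad F=F(z)>0,\ C=C(z)>0\ \text{smooth},$$ on $I\times\mathbb S^3$, $I\subseteq\mathbb R$ open; $s$ is its scalar curvature. For $t\in\mathbb R$ it is called $B^t$-flat if $-4\,Bach+2t\big(\nabla^2s-(\triangle s)g-s\,\mathring{Ric}\big)=0$, where $Bach_{ij}=\nabla^p\nabla^qW_{pijq}+\frac12W_{pijq}Ric^{pq}$ (the Euler–Lagrange equation of $\int|W|^2+t\int s^2$); it is CSC if $s$ is constant. Primes denote $d/dz$. Put $\mathcal L^\pm=(\mp\frac12\frac d{dz}+1)(\mp\frac d{dz}+1)$, $$\mathcal B(F,F)=\big(-\tfrac12F''+\tfrac32F'+F-1\big)\big(\mathcal L^+(F)-1\big)+F'\big(\mathcal L^+(F)\big)',$$ $$\mathcal F_1=24\big(F(C^{1/2})'\big)'+4C^{1/2}\big(F''+\tfrac12F-2\big)+sC^{3/2},$$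 $$\mathcal F_2=\tfrac83\big(\mathcal L^+(\mathcal L^-(F))-1\big)+t\,s\,C^{3/2}\big((C^{-1/2})''-\tfrac14C^{-1/2}\big)+\tfrac t2\tfrac CFF's'+tC's',$$ $$\mathcal T=16\,\mathcal B(F,F)-18tFC's'-6tCF's'-\tfrac34tsC^{-1}\big(C^2(-16+4F+Cs)+12F(C')^2+8CC'F'\big).$$ The reduced system, for three unknown smooth functions $F,C,s$ of $z$ with $F\ne0$ and $C>0$, is $$(CFs')'=0,\qquad\mathcal F_1=0,\qquad\mathcal F_2=0 .\tag{R}$$ 1. For every $t\in\mathbb R$, (R) is critically determined: at each point where $F\neq0$, $C>0$, it is equivalent to prescribing the highest derivatives $(F'''',C'',s'')$ as a smooth function of the eight quantities $(F,F',F'',F''',C,C',s,s')$; any values of these eight quantities at a point $z_0$ with $F\ne0$, $C>0$ are the initial conditions of a solution near $z_0$, and two solutions on an interval containing $z_0$ with the same initial conditions coincide. 2. For every $t\in\mathbb R$, $\mathcal T$ is constant along each solution of (R) on an interval. 3. Let $t\in\mathbb R$, $t\neq0$. For $F>0$, $(F,C,s)$ solves (R) and $\mathcal T=0$ if and only if the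 metric of $F,C$ is $B^t$-flat and $s$ is its scalar curvature. The initial conditions at any $z_0$ of the local solutions of (R) with $\mathcal T=0$ form a nonempty $7$-dimensional embedded smooth submanifold of $\mathbb R^8$, and so do those of the $B^t$-flat metrics. 4. Let $t\ne0$. Homotheties act on the metrics by $(F,C)\mapsto(F(\cdot+a),e^bC(\cdot+a))$, $a,b\in\mathbb R$; call a metric self-homothetic if $F$ is constant and $C=C_0e^{\mu z}$. Identify the metrics defined near $z_0$ with their initial conditions at $z_0$. Up to homothety the $B^t$-flat metrics form a $5$-parameter family, and the CSC $B^t$-flat metrics form a $4$-parameter family. This means, with $k=5$ and $k=4$ respectively: the class is nonempty; its metrics that are not self-homothetic are dense in it; and each such metric belongs to a family $g_u$ of metrics of the class, $u\in V\subseteq\mathbb R^k$ open, with smoothly immersed initial conditions, such that for some $\varepsilon>0$ the map sending $(u,a,b)\in V\times(-\varepsilon,\varepsilon)^2$ to the metric $g_u$ translated by $a$ and multiplied by $e^b$ is a homeomorphism onto an open subset of the class. 5. Let $t\ne0$. There is a CSC $B^t$-flat metric, on some $I\times\mathbb S^3$ with $I$ an open interval, such that no metric $K\big(\tfrac1{4F}dz^2+F(\eta^1)^2+(\eta^2)^2+(\eta^3)^2\big)$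 with the same $F$ and smooth $K=K(z)>0$ on $I$ is extremal Kähler for one of the complex structures $J^\pm$, $J^\pm\partial_z=\pm\frac1{2F}e_1$, $J^\pm e_2=e_3$, where $e_i$ is the frame dual to $\eta^i$ (extremal Kähler: $J$ is parallel and $J\nabla s$ is Killing). -/

import Mathlib

open Set
open scoped ContDiff

noncomputable section

namespace U2

/-! ## The metric `g = C (dz² / (4F) + F (η¹)² + (η²)² + (η³)²)` on `I × S³`

Everything is expressed in the frame `E₀ = ∂/∂z, E₁ = e₁, E₂ = e₂, E₃ = e₃`, where `e₁, e₂, e₃` is the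
left-invariant frame of `S³ = SU(2)` dual to `η¹, η², η³` with
`dη¹ = -2 η² ∧ η³` and its cyclic permutations.  The metric is invariant under the left action, so
the components of all tensors derived from it are functions of `z` alone. -/

/-- The diagonal entries of the metric in the frame `E₀, E₁, E₂, E₃`. -/
def gDiag (F C : ℝ → ℝ) (a : Fin 4) (z : ℝ) : ℝ :=
  ![C z / (4 * F z), C z * F z, C z, C z] a

/-- The metric components `g(E_a, E_b)`. -/
def g (F C : ℝ → ℝ) (a b : Fin 4) (z : ℝ) : ℝ :=
  if a = b then gDiag F C a z else 0

/-- The components of the inverse metric. -/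
def gInv (F C : ℝ → ℝ) (a b : Fin 4) (z : ℝ) : ℝ :=
  if a = b then (gDiag F C a z)⁻¹ else 0

/-- The derivative `E_a f` of a function `f = f(z)`. -/
def D (a : Fin 4) (f : ℝ → ℝ) (z : ℝ) : ℝ :=
  if a = 0 then deriv f z else 0

/-- The structure constants of the frame, `[E_a, E_b] = ∑ k, bracket a b k • E_k`:
`[e₁, e₂] = 2 e₃`, `[e₂, e₃] = 2 e₁`, `[e₃, e₁] = 2 e₂`, and `E₀` commutes with all the others. -/
def bracket (a b k : Fin 4) : ℝ :=
  if (a = 1 ∧ b = 2 ∧ k = 3) ∨ (a = 2 ∧ b = 3 ∧ k = 1) ∨ (a = 3 ∧ b = 1 ∧ k = 2) then 2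
  else if (a = 2 ∧ b = 1 ∧ k = 3) ∨ (a = 3 ∧ b = 2 ∧ k = 1) ∨ (a = 1 ∧ b = 3 ∧ k = 2) then -2
  else 0

/-- `g(∇_{E_a} E_b, E_c)` for the Levi-Civita connection, by the Koszul formula. -/
def connLower (F C : ℝ → ℝ) (a b c : Fin 4) (z : ℝ) : ℝ :=
  (D a (g F C b c) z + D b (g F C a c) z - D c (g F C a b) z
    + ∑ l, (bracket a b l * g F C l c z - bracket a c l * g F C l b z
      - bracket b c l * g F C l a z)) / 2

/-- The connection coefficients, `∇_{E_a} E_b = ∑ k, conn a b k • E_k`. -/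
def conn (F C : ℝ → ℝ) (a b k : Fin 4) (z : ℝ) : ℝ :=
  ∑ c, connLower F C a b c z * gInv F C c k z

/-- The curvature components, `R(E_a, E_b) E_c = ∑ k, curvUp a b c k • E_k`, where
`R(X, Y) = ∇_X ∇_Y - ∇_Y ∇_X - ∇_{[X, Y]}`. -/
def curvUp (F C : ℝ → ℝ) (a b c k : Fin 4) (z : ℝ) : ℝ :=
  D a (conn F C b c k) z - D b (conn F C a c k) z
    + ∑ m, (conn F C b c m z * conn F C a m k z - conn F C a c m z * conn F C b m k z
      - bracket a b m * conn F C m c k z)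

/-- The Riemann tensor `Rm_{abcd} = g(R(E_a, E_b) E_c, E_d)`; sectional curvatures are
`Rm_{abba}` in an orthonormal frame. -/
def riem (F C : ℝ → ℝ) (a b c d : Fin 4) (z : ℝ) : ℝ :=
  ∑ k, curvUp F C a b c k z * g F C k d z

/-- The Ricci tensor. -/
def ric (F C : ℝ → ℝ) (i j : Fin 4) (z : ℝ) : ℝ :=
  ∑ p, ∑ q, gInv F C p q z * riem F C p i j q z

/-- The scalar curvature. -/
def scal (F C : ℝ → ℝ) (z : ℝ) : ℝ :=
  ∑ i, ∑ j, gInv F C i j z * ric F C i j z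

/-- The Weyl tensor (in dimension four). -/
def weyl (F C : ℝ → ℝ) (a b c d : Fin 4) (z : ℝ) : ℝ :=
  riem F C a b c d z
    - (g F C a d z * ric F C b c z + g F C b c z * ric F C a d z
        - g F C a c z * ric F C b d z - g F C b d z * ric F C a c z) / 2
    + scal F C z / 6 * (g F C a d z * g F C b c z - g F C a c z * g F C b d z)

/-- Covariant derivative of a covector field, `(∇_{E_a} θ)(E_b)`. -/
def covDeriv1 (F C : ℝ → ℝ) (θ : Fin 4 → ℝ → ℝ) (a b : Fin 4) (z : ℝ) : ℝ :=
  D a (θ b) z - ∑ m, conn F C a b m z * θ m z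

/-- Covariant derivative of a `(0,2)`-tensor, `(∇_{E_a} T)(E_b, E_c)`. -/
def covDeriv2 (F C : ℝ → ℝ) (T : Fin 4 → Fin 4 → ℝ → ℝ) (a b c : Fin 4) (z : ℝ) : ℝ :=
  D a (T b c) z - ∑ m, (conn F C a b m z * T m c z + conn F C a c m z * T b m z)

/-- Covariant derivative of a `(0,3)`-tensor, `(∇_{E_a} T)(E_b, E_c, E_d)`. -/
def covDeriv3 (F C : ℝ → ℝ) (T : Fin 4 → Fin 4 → Fin 4 → ℝ → ℝ) (a b c d : Fin 4) (z : ℝ) : ℝ :=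
  D a (T b c d) z - ∑ m, (conn F C a b m z * T m c d z + conn F C a c m z * T b m d z
    + conn F C a d m z * T b c m z)

/-- Covariant derivative of a `(0,4)`-tensor, `(∇_{E_a} T)(E_b, E_c, E_d, E_e)`. -/
def covDeriv4 (F C : ℝ → ℝ) (T : Fin 4 → Fin 4 → Fin 4 → Fin 4 → ℝ → ℝ)
    (a b c d e : Fin 4) (z : ℝ) : ℝ :=
  D a (T b c d e) z - ∑ m, (conn F C a b m z * T m c d e z + conn F C a c m z * T b m d e z
    + conn F C a d m z * T b c m e z + conn F C a e m z * T b c d m z)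

/-- The divergence `∇^q W_{bcdq}` of the Weyl tensor. -/
def divWeyl (F C : ℝ → ℝ) (b c d : Fin 4) (z : ℝ) : ℝ :=
  ∑ p, ∑ q, gInv F C p q z * covDeriv4 F C (weyl F C) p b c d q z

/-- The Bach tensor `Bach_{ij} = ∇^p ∇^q W_{pijq} + ½ W_{pijq} Ric^{pq}`. -/
def bach (F C : ℝ → ℝ) (i j : Fin 4) (z : ℝ) : ℝ :=
  ∑ p, ∑ q, gInv F C p q z * covDeriv3 F C (divWeyl F C) q p i j z
    + (∑ p, ∑ q, ∑ k, ∑ l, gInv F C p k z * gInv F C q l z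
        * weyl F C p i j q z * ric F C k l z) / 2

/-- The Hessian `∇² f` of a function `f = f(z)`. -/
def hess (F C : ℝ → ℝ) (f : ℝ → ℝ) (i j : Fin 4) (z : ℝ) : ℝ :=
  covDeriv1 F C (fun b => D b f) i j z

/-- The Laplacian `△ f` of a function `f = f(z)`. -/
def lap (F C : ℝ → ℝ) (f : ℝ → ℝ) (z : ℝ) : ℝ :=
  ∑ i, ∑ j, gInv F C i j z * hess F C f i j z

/-- The trace-free Ricci tensor. -/
def ricTF (F C : ℝ → ℝ) (i j : Fin 4) (z : ℝ) : ℝ :=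
  ric F C i j z - scal F C z / 4 * g F C i j z

/-- The Euler-Lagrange tensor `-4 Bach + 2 t (∇² s - (△ s) g - s Ric₀)` of
`∫ |W|² + t ∫ s²`. -/
def btTensor (t : ℝ) (F C : ℝ → ℝ) (i j : Fin 4) (z : ℝ) : ℝ :=
  -4 * bach F C i j z + t * (2 * (hess F C (scal F C) i j z
    - lap F C (scal F C) z * g F C i j z - scal F C z * ricTF F C i j z))

/-- `F`, `C` define a smooth Riemannian metric `C (dz² / (4F) + F (η¹)² + (η²)² + (η³)²)` on
`I × S³`, `I` open. -/
def IsMetricOn (F C : ℝ → ℝ) (I : Set ℝ) : Prop :=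
  IsOpen I ∧ ContDiffOn ℝ ∞ F I ∧ ContDiffOn ℝ ∞ C I ∧ ∀ z ∈ I, 0 < F z ∧ 0 < C z

/-- The metric of `F`, `C` is `B^t`-flat on `I × S³`. -/
def IsBtFlat (t : ℝ) (F C : ℝ → ℝ) (I : Set ℝ) : Prop :=
  IsMetricOn F C I ∧ ∀ z ∈ I, ∀ i j, btTensor t F C i j z = 0

/-- The metric of `F`, `C` has constant scalar curvature and is `B^t`-flat on `I × S³`. -/
def IsCSCBtFlat (t : ℝ) (F C : ℝ → ℝ) (I : Set ℝ) : Prop :=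
  IsBtFlat t F C I ∧ ∃ c, ∀ z ∈ I, scal F C z = c

/-! ## Extremal Kähler metrics -/

/-- The complex structures `J^±` (`ε = 1` and `ε = -1`), `J E_a = ∑ b, cxStr ε F a b • E_b`:
`J ∂_z = ε/(2F) e₁`, `J e₁ = -2εF ∂_z`, `J e₂ = e₃`, `J e₃ = -e₂`. -/
def cxStr (ε : ℝ) (F : ℝ → ℝ) (a b : Fin 4) (z : ℝ) : ℝ :=
  !![0, ε / (2 * F z), 0, 0; -2 * ε * F z, 0, 0, 0; 0, 0, 0, 1; 0, 0, -1, 0] a b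

/-- The fundamental form `ω^±(E_a, E_b) = g(J^± E_a, E_b)`. -/
def kForm (ε : ℝ) (F C : ℝ → ℝ) (a b : Fin 4) (z : ℝ) : ℝ :=
  ∑ c, cxStr ε F a c z * g F C c b z

/-- The covector field dual to the vector field `J^± ∇s`, with `s` the scalar curvature. -/
def jGradScal (ε : ℝ) (F C : ℝ → ℝ) (b : Fin 4) (z : ℝ) : ℝ :=
  ∑ a, ∑ c, gInv F C a c z * D c (scal F C) z * kForm ε F C a b z

/-- The metric of `F`, `C` is extremal Kähler for `J^ε`: the form `ω^ε` is parallel and the vector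
field `J^ε ∇s` is Killing. -/
def IsExtremalKahler (ε : ℝ) (F C : ℝ → ℝ) (I : Set ℝ) : Prop :=
  IsMetricOn F C I ∧
    (∀ z ∈ I, ∀ a b c, covDeriv2 F C (kForm ε F C) a b c z = 0) ∧
    ∀ z ∈ I, ∀ a b, covDeriv1 F C (jGradScal ε F C) a b z
      + covDeriv1 F C (jGradScal ε F C) b a z = 0

/-- The metric of `F`, `C` is conformal to an extremal Kähler metric: some `K (dz² / (4F) + ...)`
with another conformal factor `K = K(z) > 0` is extremal Kähler for `J^+` or `J^-`. -/
def IsConformallyExtremal (F : ℝ → ℝ) (I : Set ℝ) : Prop :=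
  ∃ K : ℝ → ℝ, IsExtremalKahler 1 F K I ∨ IsExtremalKahler (-1) F K I

/-! ## The reduced system -/

/-- `L^+ F = (-½ d/dz + 1)(-d/dz + 1) F`. -/
def Lplus (F : ℝ → ℝ) : ℝ → ℝ :=
  (fun G z => -(1 / 2) * deriv G z + G z) (fun z => -deriv F z + F z)

/-- `L^- F = (½ d/dz + 1)(d/dz + 1) F`. -/
def Lminus (F : ℝ → ℝ) : ℝ → ℝ :=
  (fun G z => 1 / 2 * deriv G z + G z) (fun z => deriv F z + F z)

/-- The third-order operator
`B(F, F) = (-½ F'' + 3/2 F' + F - 1)(L^+ F - 1) + F' (L^+ F)'`. -/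
def opB (F : ℝ → ℝ) (z : ℝ) : ℝ :=
  (-(1 / 2) * deriv (deriv F) z + 3 / 2 * deriv F z + F z - 1) * (Lplus F z - 1)
    + deriv F z * deriv (Lplus F) z

/-- `(C F s')'`. -/
def opE (F C s : ℝ → ℝ) (z : ℝ) : ℝ :=
  deriv (fun x => C x * F x * deriv s x) z

/-- `24 (F (C^{1/2})')' + 4 C^{1/2} (F'' + F/2 - 2) + s C^{3/2}`. -/
def opF1 (F C s : ℝ → ℝ) (z : ℝ) : ℝ :=
  24 * deriv (fun x => F x * deriv (fun y => √(C y)) x) z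
    + 4 * √(C z) * (deriv (deriv F) z + 1 / 2 * F z - 2) + s z * √(C z) ^ 3

/-- `8/3 (L^+ L^- F - 1) + t s C^{3/2} ((C^{-1/2})'' - C^{-1/2}/4)
+ (t/2) (C/F) F' s' + t C' s'`. -/
def opF2 (t : ℝ) (F C s : ℝ → ℝ) (z : ℝ) : ℝ :=
  8 / 3 * (Lplus (Lminus F) z - 1)
    + t * s z * √(C z) ^ 3 * (deriv (deriv fun y => (√(C y))⁻¹) z - 1 / 4 * (√(C z))⁻¹)
    + t / 2 * (C z / F z) * deriv F z * deriv s z + t * deriv C z * deriv s z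

/-- The conserved quantity `16 B(F, F) - 18 t F C' s' - 6 t C F' s'
- (3/4) t s C⁻¹ (C² (-16 + 4F + C s) + 12 F C'² + 8 C C' F')`. -/
def opT (t : ℝ) (F C s : ℝ → ℝ) (z : ℝ) : ℝ :=
  16 * opB F z - 18 * t * F z * deriv C z * deriv s z - 6 * t * C z * deriv F z * deriv s z
    - 3 / 4 * t * s z * (C z)⁻¹ * (C z ^ 2 * (-16 + 4 * F z + C z * s z)
      + 12 * F z * deriv C z ^ 2 + 8 * C z * deriv C z * deriv F z)

/-- `(F, C, s)` is a smooth solution on the open set `I` of the reduced system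
`(C F s')' = 0`, `F₁(F, C) = 0`, `F₂(F, C) = 0`, with `F ≠ 0` and `C > 0`
(so that `C^{1/2}` makes sense and `C ≠ 0`). -/
def SolvesReduced (t : ℝ) (F C s : ℝ → ℝ) (I : Set ℝ) : Prop :=
  IsOpen I ∧ ContDiffOn ℝ ∞ F I ∧ ContDiffOn ℝ ∞ C I ∧ ContDiffOn ℝ ∞ s I ∧
    (∀ z ∈ I, F z ≠ 0 ∧ 0 < C z) ∧
    ∀ z ∈ I, opE F C s z = 0 ∧ opF1 F C s z = 0 ∧ opF2 t F C s z = 0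

/-! ## Initial data and parameter counts -/

/-- The eight initial conditions `F, F', F'', F''', C, C', s, s'` at `z`. -/
def cauchyData (F C s : ℝ → ℝ) (z : ℝ) : Fin 8 → ℝ :=
  ![F z, deriv F z, deriv (deriv F) z, deriv (deriv (deriv F)) z, C z, deriv C z, s z, deriv s z]

/-- The admissible initial conditions: `F ≠ 0` and `C > 0`. -/
def admissible : Set (Fin 8 → ℝ) := {p | p 0 ≠ 0 ∧ 0 < p 4}

/-- The initial conditions at `z` of a metric, `s` being its scalar curvature. -/
def metricData (F C : ℝ → ℝ) (z : ℝ) : Fin 8 → ℝ := cauchyData F C (scal F C) z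

/-- The initial conditions at `z₀` of the local solutions of the reduced system with `T = 0`. -/
def reducedDataSet (t z₀ : ℝ) : Set (Fin 8 → ℝ) :=
  {p | ∃ ε > 0, ∃ F C s : ℝ → ℝ, SolvesReduced t F C s (Ioo (z₀ - ε) (z₀ + ε)) ∧
    (∀ z ∈ Ioo (z₀ - ε) (z₀ + ε), opT t F C s z = 0) ∧ cauchyData F C s z₀ = p}

/-- The initial conditions at `z₀` of the metrics of a class `P` which are defined near `z₀`. -/
def dataSet (P : (ℝ → ℝ) → (ℝ → ℝ) → Set ℝ → Prop) (z₀ : ℝ) : Set (Fin 8 → ℝ) :=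
  {p | ∃ ε > 0, ∃ F C : ℝ → ℝ, P F C (Ioo (z₀ - ε) (z₀ + ε)) ∧ metricData F C z₀ = p}

/-- The metrics on which translations in `z` act by homotheties: `F` is constant and
`C = C₀ e^{μ z}`. -/
def SelfHomothetic (F C : ℝ → ℝ) (I : Set ℝ) : Prop :=
  ∃ c C₀ μ : ℝ, ∀ z ∈ I, F z = c ∧ C z = C₀ * Real.exp (μ * z)

/-- The initial conditions at `z₀` of the metrics of a class `P` which are defined near `z₀` and
are not self-homothetic. -/
def regularDataSet (P : (ℝ → ℝ) → (ℝ → ℝ) → Set ℝ → Prop) (z₀ : ℝ) : Set (Fin 8 → ℝ) :=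
  {p | ∃ ε > 0, ∃ F C : ℝ → ℝ, P F C (Ioo (z₀ - ε) (z₀ + ε)) ∧ metricData F C z₀ = p ∧
    ¬ SelfHomothetic F C (Ioo (z₀ - ε) (z₀ + ε))}

/-- `S` is an embedded smooth submanifold of `ℝ⁸` of dimension `d` and codimension `e`. -/
def IsSubmanifold (d e : ℕ) (S : Set (Fin 8 → ℝ)) : Prop :=
  ∀ p ∈ S, ∃ φ : OpenPartialHomeomorph (Fin 8 → ℝ) ((Fin d → ℝ) × (Fin e → ℝ)),
    p ∈ φ.source ∧ ContDiffOn ℝ ∞ φ φ.source ∧ ContDiffOn ℝ ∞ φ.symm φ.target ∧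
      ∀ q ∈ φ.source, q ∈ S ↔ (φ q).2 = 0

/-- The initial conditions at `z₀` of the metric obtained from that of `F`, `C` by the homothety
consisting of the translation by `a` in `z` and multiplication by `e^b`. -/
def homothetyData (F C : ℝ → ℝ) (z₀ a b : ℝ) : Fin 8 → ℝ :=
  metricData (fun z => F (z + a)) (fun z => Real.exp b * C (z + a)) z₀

/-- Up to homothety, the metrics of the class `P` form a `k`-parameter family: the metrics near any
metric of the class that is not self-homothetic are, up to small homotheties, parametrized without
repetition by an open subset of `ℝᵏ`.  In detail, near `z₀` there is a family of metrics `g_u`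
in the class, with parameters `u` in an open set `V ⊆ ℝᵏ`, whose initial conditions are
immersed smoothly, which contains the given metric, and such that `(u, a, b) ↦` (the metric `g_u`
translated by `a` and multiplied by `e^b`) is a homeomorphism from `V × (-ε, ε) × (-ε, ε)` onto a
neighbourhood of the given metric in the class, metrics being identified with their initial
conditions at `z₀`. Moreover, the class is not empty and the metrics that are not self-homothetic
are dense in it. -/
def IsFamilyUpToHomothety (k : ℕ) (P : (ℝ → ℝ) → (ℝ → ℝ) → Set ℝ → Prop) (z₀ : ℝ) : Prop :=
  (dataSet P z₀).Nonempty ∧ dataSet P z₀ ⊆ closure (regularDataSet P z₀) ∧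
  ∀ p ∈ regularDataSet P z₀, ∃ ε > 0, ∃ V : Set (Fin k → ℝ), IsOpen V ∧
    ∃ F C : (Fin k → ℝ) → ℝ → ℝ,
      (∀ u ∈ V, P (F u) (C u) (Ioo (z₀ - ε) (z₀ + ε))) ∧
      (∃ u ∈ V, metricData (F u) (C u) z₀ = p) ∧
      ContDiffOn ℝ ∞ (fun u => metricData (F u) (C u) z₀) V ∧
      (∀ u ∈ V, Function.Injective (fderiv ℝ (fun u => metricData (F u) (C u) z₀) u)) ∧
      Topology.IsEmbedding ((V ×ˢ Ioo (-ε) ε ×ˢ Ioo (-ε) ε).domRestrict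
        fun x : (Fin k → ℝ) × ℝ × ℝ => homothetyData (F x.1) (C x.1) z₀ x.2.1 x.2.2) ∧
      ∃ U : Set (Fin 8 → ℝ), IsOpen U ∧
        (fun x : (Fin k → ℝ) × ℝ × ℝ => homothetyData (F x.1) (C x.1) z₀ x.2.1 x.2.2) ''
          (V ×ˢ Ioo (-ε) ε ×ˢ Ioo (-ε) ε) = U ∩ dataSet P z₀

end U2

end

noncomputable section

namespace U2

/-! ## Connection coefficients -/

/-! The invariant frame is graded by the Klein four-group: `[E_a, E_b]` is a multiple of `E_{a+b}`,
the metric is diagonal, and `E₀`, the only direction in which functions vary, has degree 0. Hence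
tensor components of nonzero total degree vanish, and the others are explicit functions of `C`, of
`h = C'/C` and of the derivatives of `F` and `h`. This turns connection, curvature, Weyl and Bach
tensors into finite case checks (`conn_eq`, `curvUp_eq`, `weyl_eq`, `bach_eq`).

The outcome is `btV_eq`: the Euler-Lagrange tensor is diagonal, its `∂_z ∂_z` entry is a multiple of
`T`, its trace is a multiple of `t (C F s')'`, and the one remaining equation is then the third
reduced equation. The second reduced equation says that `s` is the scalar curvature (`F1V_eq_scal`).
For `t ≠ 0` this gives the equivalence of the reduced system with `T = 0` and `B^t`-flatness.
Geometrically `T` is constant because the Euler-Lagrange tensor is divergence free; the proof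
verifies instead that the derivative of `T` along the system vanishes identically (`dTV_field`),
which also covers negative `F`.

The reduced system is triangular in its highest derivatives, so its solutions are the integral
curves of a smooth vector field, `field`, on an open subset of `ℝ⁸`, and metrics are identified with
points there. The `B^t`-flat ones are the zeros of `T` with `F, C > 0`; constant scalar curvature
adds the equation `K = C F s' = 0`, where `K` is conserved too. For `t ≠ 0`, `T` is regular on its
zero set (`exists_dTV_ne_zero`), which gives dimension 7. On `T = K = 0` the pair `(T, K)` is
regular away from self-homothetic metrics (`surjective_fderiv_TKQ`).

Translation in `z` is the flow of `field`; multiplication by `e^b` acts by a scaling `scl` which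
commutes with it and preserves `T` and `K`. The two generators are independent unless the metric is
self-homothetic. A slice transversal to both, together with the inverse function theorem, gives the
parameter counts `8 - 1 - 2 = 5` and `8 - 2 - 2 = 4` (`exists_family`). Density holds because at `F'
= 0` neither `T` nor `K` restricts `F'''`.

Finally, a metric conformal to an extremal Kähler one satisfies the linear equation `L⁺ L⁻ F = 1`,
which suitable initial conditions of constant scalar curvature violate. -/

/-- Addition in `ℤ/2 × ℤ/2`, the elements being numbered `0, 1, 2, 3`.  The frame is graded by this
group, and the components of all invariant tensors respect the grading. -/
def px (a b : Fin 4) : Fin 4 := !![0, 1, 2, 3; 1, 0, 3, 2; 2, 3, 0, 1; 3, 2, 1, 0] a b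

lemma px_comm (a b : Fin 4) : px a b = px b a := by revert a b; decide

lemma px_assoc (a b c : Fin 4) : px (px a b) c = px a (px b c) := by revert a b c; decide

lemma px_px_self (a b : Fin 4) : px a (px a b) = b := by revert a b; decide

/-- The structure constant `[E_a, E_b] = brV a b • E_{px a b}`. -/
def brV (a b : Fin 4) : ℝ := !![0, 0, 0, 0; 0, 0, 2, -2; 0, -2, 0, 2; 0, 2, -2, 0] a b

lemma bracket_eq (a b k : Fin 4) : bracket a b k = if k = px a b then brV a b else 0 := by
  fin_cases a <;> fin_cases b <;> fin_cases k <;> simp [bracket, px, brV]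

/-- Connection coefficients, `∇_{E_a} E_b = connV a b • E_{px a b}`, in terms of `F`, `F'` and
`h = C'/C`. -/
def connV (f f₁ h : ℝ) (a b : Fin 4) : ℝ :=
  !![(h - f₁ / f) / 2, (h + f₁ / f) / 2, h / 2, h / 2;
    (h + f₁ / f) / 2, -2 * f * (f₁ + f * h), 2 - f, f - 2;
    h / 2, -f, -2 * f * h, 1;
    h / 2, f, -1, -2 * f * h] a b

/-- The derivatives of the connection coefficients. -/
def dconnV (f f₁ f₂ h h₁ : ℝ) (a b : Fin 4) : ℝ :=
  !![(h₁ - (f₂ * f - f₁ * f₁) / f ^ 2) / 2, (h₁ + (f₂ * f - f₁ * f₁) / f ^ 2) / 2, h₁ / 2, h₁ / 2;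
    (h₁ + (f₂ * f - f₁ * f₁) / f ^ 2) / 2,
      -2 * (f₁ * (f₁ + f * h) + f * (f₂ + f₁ * h + f * h₁)), -f₁, f₁;
    h₁ / 2, -f₁, -2 * (f₁ * h + f * h₁), 0;
    h₁ / 2, f₁, 0, -2 * (f₁ * h + f * h₁)] a b

lemma hasDerivAt_connV {f f₁ h : ℝ → ℝ} {f₂ h₁ z : ℝ} (hf : HasDerivAt f (f₁ z) z)
    (hf₁ : HasDerivAt f₁ f₂ z) (hh : HasDerivAt h h₁ z) (h0 : f z ≠ 0) (a b : Fin 4) :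
    HasDerivAt (fun x => connV (f x) (f₁ x) (h x) a b) (dconnV (f z) (f₁ z) f₂ (h z) h₁ a b) z := by
  have e1 := (hh.sub (hf₁.div hf h0)).div_const 2
  have e2 := (hh.add (hf₁.div hf h0)).div_const 2
  have e3 := hh.div_const 2
  have e4 := ((hf.const_mul (-2)).mul (hf₁.add (hf.mul hh)))
  have e5 := (hf.const_mul (-2)).mul hh
  have e6 := hf.const_sub 2
  have e7 := hf.sub_const 2
  fin_cases a <;> fin_cases b <;> simp only [connV, dconnV, Fin.zero_eta, Fin.mk_one, Fin.isValue,
    Fin.reduceFinMk, Matrix.of_apply, Matrix.cons_val, Matrix.cons_val_zero, Matrix.cons_val_one]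
  · exact e1
  · exact e2
  · exact e3
  · exact e3
  · exact e2
  · exact e4.congr_deriv (by simp; ring)
  · exact e6
  · exact e7
  · exact e3
  · exact hf.neg
  · exact e5.congr_deriv (by ring)
  · exact hasDerivAt_const _ _
  · exact e3
  · exact hf
  · exact hasDerivAt_const _ _
  · exact e5.congr_deriv (by ring)

lemma hasDerivAt_of_contDiffOn {f : ℝ → ℝ} {I : Set ℝ} (hI : IsOpen I) (hf : ContDiffOn ℝ ∞ f I)
    {z : ℝ} (hz : z ∈ I) : HasDerivAt f (deriv f z) z :=
  ((hf.contDiffAt (hI.mem_nhds hz)).differentiableAt (by simp)).hasDerivAt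

lemma contDiffOn_deriv {f : ℝ → ℝ} {I : Set ℝ} (hI : IsOpen I) (hf : ContDiffOn ℝ ∞ f I) :
    ContDiffOn ℝ ∞ (deriv f) I :=
  hf.deriv_of_isOpen hI (by simp)

lemma deriv_congr_of_eqOn {f f' : ℝ → ℝ} {I : Set ℝ} (hI : IsOpen I) (h : ∀ z ∈ I, f z = f' z)
    {z : ℝ} (hz : z ∈ I) : deriv f z = deriv f' z :=
  (Filter.eventuallyEq_of_mem (hI.mem_nhds hz) h).deriv_eq

/-- The logarithmic derivative `C'/C` of the conformal factor. -/
def hlog (C : ℝ → ℝ) (z : ℝ) : ℝ := deriv C z / C z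

/-- The logarithmic derivatives of the diagonal entries of the metric. -/
def gLog (f f₁ h : ℝ) (a : Fin 4) : ℝ := ![h - f₁ / f, h + f₁ / f, h, h] a

section metric

variable {F C : ℝ → ℝ} {I : Set ℝ}

lemma gDiag_pos (hm : IsMetricOn F C I) {z : ℝ} (hz : z ∈ I) (a : Fin 4) : 0 < gDiag F C a z := by
  obtain ⟨hF, hC⟩ := hm.2.2.2 z hz
  fin_cases a <;> simp [gDiag] <;> positivity

lemma hasDerivAt_gDiag (hm : IsMetricOn F C I) {z : ℝ} (hz : z ∈ I) (a : Fin 4) :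
    HasDerivAt (gDiag F C a) (gDiag F C a z * gLog (F z) (deriv F z) (hlog C z) a) z := by
  have hF := hasDerivAt_of_contDiffOn hm.1 hm.2.1 hz
  have hC := hasDerivAt_of_contDiffOn hm.1 hm.2.2.1 hz
  obtain ⟨hF0, hC0⟩ := hm.2.2.2 z hz
  have e0 := hC.div (hF.const_mul 4) (by positivity)
  have e1 := hC.mul hF
  fin_cases a
  · exact e0.congr_deriv (by simp [gDiag, gLog, hlog]; field_simp)
  · exact e1.congr_deriv (by simp [gDiag, gLog, hlog]; field_simp)
  · exact hC.congr_deriv (by simp [gDiag, gLog, hlog]; field_simp)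
  · exact hC.congr_deriv (by simp [gDiag, gLog, hlog]; field_simp)

lemma D_g (hm : IsMetricOn F C I) {z : ℝ} (hz : z ∈ I) (a b c : Fin 4) :
    D a (g F C b c) z = if a = 0 ∧ b = c then
      gDiag F C b z * gLog (F z) (deriv F z) (hlog C z) b else 0 := by
  by_cases hbc : b = c
  · subst hbc
    have : g F C b b = gDiag F C b := by ext; simp [g]
    simp [D, this, (hasDerivAt_gDiag hm hz b).deriv]
  · have : g F C b c = fun _ => 0 := by ext; simp [g, hbc]
    simp [D, this, hbc]

lemma sum_mul_g (T : Fin 4 → ℝ) (k : Fin 4) (z : ℝ) :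
    ∑ l, T l * g F C l k z = T k * gDiag F C k z := by
  simp [g]

lemma sum_mul_gInv (T : Fin 4 → ℝ) (k : Fin 4) (z : ℝ) :
    ∑ l, T l * gInv F C l k z = T k * (gDiag F C k z)⁻¹ := by
  simp [gInv]

/-- In the Koszul formula the derivative terms need the differentiating index to be 0 and the other
two equal, and the bracket terms need total degree zero; so only `k = a + b` survives. -/
lemma conn_eq (hm : IsMetricOn F C I) {z : ℝ} (hz : z ∈ I) (a b k : Fin 4) :
    conn F C a b k z = if k = px a b then connV (F z) (deriv F z) (hlog C z) a b else 0 := by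
  have h0 := (gDiag_pos hm hz k).ne'
  obtain ⟨hF0, hC0⟩ := hm.2.2.2 z hz
  rw [conn, sum_mul_gInv, connLower, D_g hm hz, D_g hm hz, D_g hm hz]
  simp only [Finset.sum_sub_distrib, sum_mul_g]
  rw [← div_eq_mul_inv, div_eq_iff h0]
  fin_cases a <;> fin_cases b <;> fin_cases k <;>
    simp [bracket_eq, px, brV, connV, gLog, gDiag] <;> field_simp <;> ring

end metric

/-! ## Curvature -/

lemma px_left_eq_iff (a b c : Fin 4) : px (px a b) c = px b c ↔ a = 0 := by revert a b c; decide

/-- Curvature components, `R(E_a, E_b) E_c = curvV a b c • E_{a + b + c}`. -/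
def curvV (f f₁ f₂ h h₁ : ℝ) (a b c : Fin 4) : ℝ :=
  (if a = 0 then dconnV f f₁ f₂ h h₁ b c else 0) - (if b = 0 then dconnV f f₁ f₂ h h₁ a c else 0)
    + (connV f f₁ h b c * connV f f₁ h a (px b c) - connV f f₁ h a c * connV f f₁ h b (px a c)
      - brV a b * connV f f₁ h (px a b) c)

/-- The diagonal entries of the Ricci tensor. -/
def ricV (f f₁ f₂ h h₁ : ℝ) (i : Fin 4) : ℝ :=
  ![-(3 / 2) * h₁ - h * f₁ / f - f₂ / (2 * f),
    f * (2 * f - 2 * f * h₁ - 2 * f₂ - 4 * f₁ * h - 2 * f * h ^ 2),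
    4 - 2 * f - 2 * f * h₁ - 2 * f₁ * h - 2 * f * h ^ 2,
    4 - 2 * f - 2 * f * h₁ - 2 * f₁ * h - 2 * f * h ^ 2] i

/-- `C` times the scalar curvature. -/
def scalV (f f₁ f₂ h h₁ : ℝ) : ℝ :=
  8 - 2 * f - 4 * f₂ - 12 * f₁ * h - 12 * f * h₁ - 6 * f * h ^ 2

lemma sum_curvV (f f₁ f₂ h h₁ : ℝ) (hf : f ≠ 0) (i : Fin 4) :
    ∑ p, curvV f f₁ f₂ h h₁ p i i = ricV f f₁ f₂ h h₁ i := by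
  fin_cases i <;> simp [Fin.sum_univ_four, curvV, ricV, connV, dconnV, px, brV] <;>
    field_simp <;> ring

/-- `W(E_a, E_b, E_b, E_a) = C kapV a b`, with `P = F'' + 2 F - 2`. -/
def kapV (f P : ℝ) (a b : Fin 4) : ℝ :=
  !![0, -P / 6, P / (12 * f), P / (12 * f); -P / 6, 0, f * P / 3, f * P / 3;
    P / (12 * f), f * P / 3, 0, -2 * P / 3; P / (12 * f), f * P / 3, -2 * P / 3, 0] a b

/-- The derivatives of `kapV`. -/
def dkapV (f f₁ P P₁ : ℝ) (a b : Fin 4) : ℝ :=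
  !![0, -P₁ / 6, (P₁ * f - P * f₁) / (12 * f ^ 2), (P₁ * f - P * f₁) / (12 * f ^ 2);
    -P₁ / 6, 0, (f₁ * P + f * P₁) / 3, (f₁ * P + f * P₁) / 3;
    (P₁ * f - P * f₁) / (12 * f ^ 2), (f₁ * P + f * P₁) / 3, 0, -2 * P₁ / 3;
    (P₁ * f - P * f₁) / (12 * f ^ 2), (f₁ * P + f * P₁) / 3, -2 * P₁ / 3, 0] a b

/-- The coefficients of `C F'` in the Weyl tensor. -/
def chiV (a : Fin 4) : Matrix (Fin 4) (Fin 4) ℝ :=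
  ![!![0, 0, 0, 0; 0, 0, -1, 1; 0, -1 / 2, 0, 1 / 2; 0, 1 / 2, -1 / 2, 0],
    !![0, 0, 1, -1; 0, 0, 0, 0; 1 / 2, 0, 0, -1 / 2; -1 / 2, 0, 1 / 2, 0],
    !![0, 1 / 2, 0, -1 / 2; -1 / 2, 0, 0, 1 / 2; 0, 0, 0, 0; -1, 1, 0, 0],
    !![0, -1 / 2, 1 / 2, 0; 1 / 2, 0, -1 / 2, 0; 1, -1, 0, 0; 0, 0, 0, 0]] a

/-- The pattern of the components `W(E_a, E_b, E_b, E_a)` and `W(E_a, E_b, E_a, E_b)`. -/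
def sgV (a b c : Fin 4) : ℝ := (if c = b then 1 else 0) - (if c = a then 1 else 0)

/-- The components of the Weyl tensor are `W(E_a, E_b, E_c, E_{a + b + c}) = C weylV a b c`. -/
def weylV (f f₁ P : ℝ) (a b c : Fin 4) : ℝ := kapV f P a b * sgV a b c + f₁ * chiV a b c

/-- The derivatives of `weylV`. -/
def dweylV (f f₁ f₂ P P₁ : ℝ) (a b c : Fin 4) : ℝ :=
  dkapV f f₁ P P₁ a b * sgV a b c + f₂ * chiV a b c

lemma hasDerivAt_kapV {f P : ℝ → ℝ} {f₁ P₁ z : ℝ} (hf : HasDerivAt f f₁ z)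
    (hP : HasDerivAt P P₁ z) (h0 : f z ≠ 0) (a b : Fin 4) :
    HasDerivAt (fun x => kapV (f x) (P x) a b) (dkapV (f z) f₁ (P z) P₁ a b) z := by
  have e1 := hP.neg.div_const 6
  have e2 := (hP.div (hf.const_mul 12) (by positivity)).congr_deriv
    (show _ = (P₁ * f z - P z * f₁) / (12 * f z ^ 2) by field_simp)
  have e3 := (hf.mul hP).div_const 3
  have e4 := (hP.const_mul (-2)).div_const 3
  have e5 := hasDerivAt_const z (0 : ℝ)
  fin_cases a <;> fin_cases b <;> simp only [kapV, dkapV, Fin.zero_eta, Fin.mk_one, Fin.isValue,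
    Fin.reduceFinMk, Matrix.of_apply, Matrix.cons_val, Matrix.cons_val_zero, Matrix.cons_val_one] <;>
    first | exact e1 | exact e2 | exact e3 | exact e4 | exact e5

lemma hasDerivAt_weylV {f f₁ P : ℝ → ℝ} {f₂ P₁ z : ℝ} (hf : HasDerivAt f (f₁ z) z)
    (hf₁ : HasDerivAt f₁ f₂ z) (hP : HasDerivAt P P₁ z) (h0 : f z ≠ 0) (a b c : Fin 4) :
    HasDerivAt (fun x => weylV (f x) (f₁ x) (P x) a b c)
      (dweylV (f z) (f₁ z) f₂ (P z) P₁ a b c) z :=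
  ((hasDerivAt_kapV hf hP h0 a b).mul_const _).add (hf₁.mul_const _)

/-- The terms in `h` and `h₁` cancel, as conformal invariance of the Weyl tensor demands; only `F`,
`F'` and `F'' + 2F - 2` remain. -/
lemma curvV_eq_weylV (f f₁ f₂ h h₁ c : ℝ) (hf : f ≠ 0) (hc : c ≠ 0) (i j k : Fin 4) :
    let G : Fin 4 → ℝ := ![c / (4 * f), c * f, c, c]
    let R := ricV f f₁ f₂ h h₁
    let l := px (px i j) k
    curvV f f₁ f₂ h h₁ i j k * G l
      - ((if i = l then G i else 0) * (if j = k then R j else 0)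
        + (if j = k then G j else 0) * (if i = l then R i else 0)
        - (if i = k then G i else 0) * (if j = l then R j else 0)
        - (if j = l then G j else 0) * (if i = k then R i else 0)) / 2
      + scalV f f₁ f₂ h h₁ / c / 6 * ((if i = l then G i else 0) * (if j = k then G j else 0)
        - (if i = k then G i else 0) * (if j = l then G j else 0))
      = c * weylV f f₁ (f₂ + 2 * f - 2) i j k := by
  fin_cases i <;> fin_cases j <;> fin_cases k <;>
    simp [curvV, connV, dconnV, px, brV, weylV, kapV, sgV, chiV, ricV, scalV] <;>
    field_simp <;> ring

section metric

variable {F C : ℝ → ℝ} {I : Set ℝ}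

lemma contDiffOn_hlog (hm : IsMetricOn F C I) : ContDiffOn ℝ ∞ (hlog C) I :=
  (contDiffOn_deriv hm.1 hm.2.2.1).div hm.2.2.1 fun z hz => (hm.2.2.2 z hz).2.ne'

lemma D_conn (hm : IsMetricOn F C I) {z : ℝ} (hz : z ∈ I) (a b c k : Fin 4) :
    D a (conn F C b c k) z = if k = px b c then (if a = 0 then dconnV (F z) (deriv F z)
      (deriv (deriv F) z) (hlog C z) (deriv (hlog C) z) b c else 0) else 0 := by
  by_cases ha : a = 0
  · have := deriv_congr_of_eqOn hm.1 (fun x hx => conn_eq hm hx b c k) hz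
    by_cases hk : k = px b c
    · have e := hasDerivAt_connV (hasDerivAt_of_contDiffOn hm.1 hm.2.1 hz)
        (hasDerivAt_of_contDiffOn hm.1 (contDiffOn_deriv hm.1 hm.2.1) hz)
        (hasDerivAt_of_contDiffOn hm.1 (contDiffOn_hlog hm) hz) (hm.2.2.2 z hz).1.ne' b c
      simp only [hk, if_true] at this
      simp [D, ha, hk, this, e.deriv]
    · simp only [hk, if_false] at this
      simp [D, hk, this]
  · simp [D, ha]

/-- All terms have degree `a + b + c`: the derivative terms have degree `b + c` or `a + c`, but they
occur only when the differentiating direction is `E₀`, of degree 0. -/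
lemma curvUp_eq (hm : IsMetricOn F C I) {z : ℝ} (hz : z ∈ I) (a b c k : Fin 4) :
    curvUp F C a b c k z = if k = px (px a b) c then curvV (F z) (deriv F z)
      (deriv (deriv F) z) (hlog C z) (deriv (hlog C) z) a b c else 0 := by
  have h1 : px a (px b c) = px (px a b) c := (px_assoc a b c).symm
  have h2 : px b (px a c) = px (px a b) c := by rw [px_comm a b, px_assoc]
  simp only [curvUp, D_conn hm hz, conn_eq hm hz, bracket_eq, Finset.sum_sub_distrib, ite_mul,
    zero_mul, Finset.sum_ite_eq', Finset.mem_univ, if_true]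
  have e : ∀ (x : Fin 4) (u v : ℝ), (∑ m, if m = x then u * (if k = px m c then v else 0) else 0)
      = if k = px x c then u * v else 0 := by
    intro x u v; simp
  by_cases hk : k = px (px a b) c
  · have h3 : k = px b c ↔ a = 0 := by rw [hk, px_left_eq_iff]
    have h4 : k = px a c ↔ b = 0 := by rw [hk, px_comm a b, px_left_eq_iff]
    simp only [h1, h2, hk, if_true, curvV]
    rw [← hk]
    simp only [h3, h4]
    split_ifs <;> simp
  · have h3 : k = px b c → a ≠ 0 := by exact fun h h' => hk (h.trans ((px_left_eq_iff a b c).2 h').symm)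
    have h4 : k = px a c → b ≠ 0 := by exact fun h h' => hk (h.trans
      (((px_comm a b) ▸ px_left_eq_iff b a c).2 h').symm)
    simp only [h1, h2, hk, if_false]
    split_ifs <;> simp_all

lemma riem_eq (hm : IsMetricOn F C I) {z : ℝ} (hz : z ∈ I) (a b c d : Fin 4) :
    riem F C a b c d z = if d = px (px a b) c then curvV (F z) (deriv F z)
      (deriv (deriv F) z) (hlog C z) (deriv (hlog C) z) a b c * gDiag F C d z else 0 := by
  rw [riem, sum_mul_g, curvUp_eq hm hz]
  split_ifs <;> simp

lemma ric_eq (hm : IsMetricOn F C I) {z : ℝ} (hz : z ∈ I) (i j : Fin 4) :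
    ric F C i j z = if i = j then ricV (F z) (deriv F z)
      (deriv (deriv F) z) (hlog C z) (deriv (hlog C) z) i else 0 := by
  have h1 : ∀ p : Fin 4, p = px (px p i) j ↔ i = j := by revert i j; decide
  simp only [ric, gInv, ite_mul, zero_mul, Finset.sum_ite_eq, Finset.mem_univ, if_true,
    riem_eq hm hz, h1]
  by_cases hij : i = j
  · subst hij
    simp only [if_true]
    rw [← sum_curvV _ _ _ _ _ (hm.2.2.2 z hz).1.ne']
    refine Finset.sum_congr rfl fun p _ => ?_
    have := (gDiag_pos hm hz p).ne'
    field_simp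
  · simp [hij]

lemma scal_eq (hm : IsMetricOn F C I) {z : ℝ} (hz : z ∈ I) :
    scal F C z = scalV (F z) (deriv F z)
      (deriv (deriv F) z) (hlog C z) (deriv (hlog C) z) / C z := by
  obtain ⟨hF, hC⟩ := hm.2.2.2 z hz
  simp only [scal, gInv, ite_mul, zero_mul, Finset.sum_ite_eq, Finset.mem_univ, if_true,
    ric_eq hm hz]
  simp [Fin.sum_univ_four, gDiag, ricV, scalV]
  field_simp
  ring

/-- The component of the second derivative of `F` in the Weyl tensor. -/
def Pw (F : ℝ → ℝ) (z : ℝ) : ℝ := deriv (deriv F) z + 2 * F z - 2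

lemma weyl_eq (hm : IsMetricOn F C I) {z : ℝ} (hz : z ∈ I) (a b c d : Fin 4) :
    weyl F C a b c d z = if d = px (px a b) c then
      C z * weylV (F z) (deriv F z) (Pw F z) a b c else 0 := by
  obtain ⟨hF, hC⟩ := hm.2.2.2 z hz
  simp only [weyl, riem_eq hm hz, ric_eq hm hz, g, scal_eq hm hz]
  by_cases hd : d = px (px a b) c
  · subst hd
    rw [if_pos rfl, if_pos rfl, Pw, ← curvV_eq_weylV _ _ _ _ _ _ hF.ne' hC.ne']
    rfl
  -- In the metric and Ricci terms the indices coincide in pairs, which forces total degree zero;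
  -- off that degree these terms vanish along with the Riemann term.
  · have h1 : ¬ (a = d ∧ b = c) := by
      rintro ⟨rfl, rfl⟩; exact hd (by clear hd; revert a b; decide)
    have h2 : ¬ (a = c ∧ b = d) := by
      rintro ⟨rfl, rfl⟩; exact hd (by clear hd; revert a b; decide)
    rw [if_neg hd, if_neg hd]
    have e1 : ∀ u v : ℝ, (if a = d then u else 0) * (if b = c then v else 0) = 0 := by
      intro u v; by_cases h : a = d <;> by_cases h' : b = c <;> simp_all
    have e2 : ∀ u v : ℝ, (if a = c then u else 0) * (if b = d then v else 0) = 0 := by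
      intro u v; by_cases h : a = c <;> by_cases h' : b = d <;> simp_all
    have e3 : ∀ u v : ℝ, (if b = c then v else 0) * (if a = d then u else 0) = 0 := by
      intro u v; rw [mul_comm, e1]
    have e4 : ∀ u v : ℝ, (if b = d then v else 0) * (if a = c then u else 0) = 0 := by
      intro u v; rw [mul_comm, e2]
    simp only [e1, e2, e3, e4]
    simp

end metric

/-! ## The Bach tensor and the Euler-Lagrange tensor -/

/-- The degree conditions of the separate terms of `∇_p W(b, c, d, p)`; all of them amount to `d = b
+ c`. -/
lemma px_degree {p b c d : Fin 4} : p = px (px b c) d → p = 0 → d = px b c := by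
  revert p b c d; decide

lemma px_degree_iff (p d : Fin 4) : p = px d d ↔ p = 0 := by revert p d; decide

lemma px_degree₁ (p b c d : Fin 4) : p = px (px (px p b) c) d ↔ d = px b c := by
  revert p b c d; decide

lemma px_degree₂ (p b c d : Fin 4) : p = px (px b (px p c)) d ↔ d = px b c := by
  revert p b c d; decide

lemma px_degree₃ (p b c d : Fin 4) : p = px (px b c) (px p d) ↔ d = px b c := by
  revert p b c d; decide

lemma px_degree₄ (p b c d : Fin 4) : px p p = px (px b c) d ↔ d = px b c := by
  revert p b c d; decide

/-- The divergence of the Weyl tensor, `(∇^q W)(E_b, E_c, E_{b + c}, E_q) = divV b c`. -/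
def divV (f A B : ℝ) (b c : Fin 4) : ℝ :=
  !![0, -(2 / 3) * (f * A), A / 3, A / 3; 2 / 3 * (f * A), 0, f * B, -(f * B);
    -A / 3, -(f * B), 0, -2 * (f * B); -A / 3, f * B, 2 * (f * B), 0] b c

lemma hasDerivAt_divV {f A B : ℝ → ℝ} {f₁ A₁ B₁ z : ℝ} (hf : HasDerivAt f f₁ z)
    (hA : HasDerivAt A A₁ z) (hB : HasDerivAt B B₁ z) (b c : Fin 4) :
    HasDerivAt (fun x => divV (f x) (A x) (B x) b c)
      (!![0, -(2 / 3) * (f₁ * A z + f z * A₁), A₁ / 3, A₁ / 3;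
        2 / 3 * (f₁ * A z + f z * A₁), 0, f₁ * B z + f z * B₁, -(f₁ * B z + f z * B₁);
        -A₁ / 3, -(f₁ * B z + f z * B₁), 0, -2 * (f₁ * B z + f z * B₁);
        -A₁ / 3, f₁ * B z + f z * B₁, 2 * (f₁ * B z + f z * B₁), 0] b c) z := by
  have e1 := (hf.mul hA).const_mul (-(2 / 3))
  have e2 := (hf.mul hA).const_mul (2 / 3)
  have e3 := hA.div_const 3
  have e4 := hA.neg.div_const 3
  have e5 := hf.mul hB
  have e6 := (hf.mul hB).neg
  have e7 := (hf.mul hB).const_mul (-2)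
  have e8 := (hf.mul hB).const_mul 2
  have e9 := hasDerivAt_const z (0 : ℝ)
  fin_cases b <;> fin_cases c <;> simp only [divV, Fin.zero_eta, Fin.mk_one, Fin.isValue,
    Fin.reduceFinMk, Matrix.of_apply, Matrix.cons_val, Matrix.cons_val_zero, Matrix.cons_val_one] <;>
    first
      | exact e1
      | exact e2
      | exact e3
      | exact e4
      | exact e5
      | exact e6
      | exact e7
      | exact e8
      | exact e9

/-- The covariant derivative `(∇_{E_p} W)(E_b, E_c, E_d, E_p) / C` for `d = b + c`. -/
def covWeylV (f f₁ f₂ f₃ h : ℝ) (p b c d : Fin 4) : ℝ :=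
  (if p = 0 then h * weylV f f₁ (f₂ + 2 * f - 2) b c d
      + dweylV f f₁ f₂ (f₂ + 2 * f - 2) (f₃ + 2 * f₁) b c d else 0)
    - (connV f f₁ h p b * weylV f f₁ (f₂ + 2 * f - 2) (px p b) c d
      + connV f f₁ h p c * weylV f f₁ (f₂ + 2 * f - 2) b (px p c) d
      + connV f f₁ h p d * weylV f f₁ (f₂ + 2 * f - 2) b c (px p d)
      + connV f f₁ h p p * weylV f f₁ (f₂ + 2 * f - 2) b c d)

/-- The conformal factor enters the divergence only through a contraction of the Weyl tensor with `d
log C`, so both coefficients of `divV` are affine in `h`. -/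
lemma sum_covWeylV (f f₁ f₂ f₃ h c : ℝ) (hf : f ≠ 0) (hc : c ≠ 0) (i j : Fin 4) :
    ∑ p, ((![c / (4 * f), c * f, c, c] : Fin 4 → ℝ) p)⁻¹
        * (c * covWeylV f f₁ f₂ f₃ h p i j (px i j))
      = divV f (f₃ - 5 / 2 * f₁ + h * (f₂ + 2 * f - 2) / 2) (-f₂ + 2 * f - 2 - f₁ * h) i j := by
  fin_cases i <;> fin_cases j <;>
    simp [Fin.sum_univ_four, covWeylV, divV, connV, px, weylV, dweylV, kapV, dkapV, sgV, chiV] <;>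
    field_simp <;> first | ring1 | simp

/-- The coefficient of the `∂_z`-part of the divergence of the Weyl tensor. -/
def Aw (F C : ℝ → ℝ) (z : ℝ) : ℝ :=
  deriv (deriv (deriv F)) z - 5 / 2 * deriv F z + hlog C z * Pw F z / 2

/-- The coefficient of the other part of the divergence of the Weyl tensor. -/
def Bw (F C : ℝ → ℝ) (z : ℝ) : ℝ :=
  -deriv (deriv F) z + 2 * F z - 2 - deriv F z * hlog C z

/-- The trace `G p⁻¹ (∇_{E_p} ∇^q W)(E_p, E_i, E_i, E_q)` of the second derivatives of the Weyl
tensor, together with the Weyl-Ricci term. -/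
def bachV (c f f₁ f₂ f₃ f₄ h h₁ : ℝ) (i : Fin 4) : ℝ :=
  let G : Fin 4 → ℝ := ![c / (4 * f), c * f, c, c]
  let P := f₂ + 2 * f - 2
  let A := f₃ - 5 / 2 * f₁ + h * P / 2
  let B := -f₂ + 2 * f - 2 - f₁ * h
  let A₁ := f₄ - 5 / 2 * f₂ + (h₁ * P + h * (f₃ + 2 * f₁)) / 2
  (∑ p, (G p)⁻¹ * ((if p = 0 then
        (![0, -(2 / 3) * (f₁ * A + f * A₁), A₁ / 3, A₁ / 3] : Fin 4 → ℝ) i else 0)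
      - (connV f f₁ h p p * divV f A B 0 i + connV f f₁ h p i * divV f A B p (px p i)
        + connV f f₁ h p i * divV f A B p i)))
    + (∑ p, (G p)⁻¹ * (G p)⁻¹ * (c * weylV f f₁ P p i i) * ricV f f₁ f₂ h h₁ p) / 2

section metric

variable {F C : ℝ → ℝ} {I : Set ℝ}

lemma hasDerivAt_jets (hm : IsMetricOn F C I) {z : ℝ} (hz : z ∈ I) :
    HasDerivAt F (deriv F z) z ∧ HasDerivAt (deriv F) (deriv (deriv F) z) z ∧
    HasDerivAt (deriv (deriv F)) (deriv (deriv (deriv F)) z) z ∧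
    HasDerivAt (deriv (deriv (deriv F))) (deriv (deriv (deriv (deriv F))) z) z ∧
    HasDerivAt (hlog C) (deriv (hlog C) z) z := by
  have h1 := contDiffOn_deriv hm.1 hm.2.1
  have h2 := contDiffOn_deriv hm.1 h1
  have h3 := contDiffOn_deriv hm.1 h2
  exact ⟨hasDerivAt_of_contDiffOn hm.1 hm.2.1 hz, hasDerivAt_of_contDiffOn hm.1 h1 hz,
    hasDerivAt_of_contDiffOn hm.1 h2 hz, hasDerivAt_of_contDiffOn hm.1 h3 hz,
    hasDerivAt_of_contDiffOn hm.1 (contDiffOn_hlog hm) hz⟩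

lemma hasDerivAt_Pw (hm : IsMetricOn F C I) {z : ℝ} (hz : z ∈ I) :
    HasDerivAt (Pw F) (deriv (deriv (deriv F)) z + 2 * deriv F z) z := by
  obtain ⟨h0, -, h2, -, -⟩ := hasDerivAt_jets hm hz
  exact (h2.add (h0.const_mul 2)).sub_const 2

lemma D_weyl (hm : IsMetricOn F C I) {z : ℝ} (hz : z ∈ I) (a b c d e : Fin 4) :
    D a (weyl F C b c d e) z = if e = px (px b c) d then (if a = 0 then
      C z * (hlog C z * weylV (F z) (deriv F z) (Pw F z) b c d + dweylV (F z) (deriv F z)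
        (deriv (deriv F) z) (Pw F z) (deriv (deriv (deriv F)) z + 2 * deriv F z) b c d)
      else 0) else 0 := by
  by_cases ha : a = 0
  · have := deriv_congr_of_eqOn hm.1 (fun x hx => weyl_eq hm hx b c d e) hz
    by_cases he : e = px (px b c) d
    · obtain ⟨h0, h1, h2, -, -⟩ := hasDerivAt_jets hm hz
      have hC := hasDerivAt_of_contDiffOn hm.1 hm.2.2.1 hz
      have e' := (hC.mul (hasDerivAt_weylV h0 h1 (hasDerivAt_Pw hm hz)
        (hm.2.2.2 z hz).1.ne' b c d)).deriv
      have hC0 := (hm.2.2.2 z hz).2.ne'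
      simp only [he, if_true] at this
      simp only [D, ha, he, this, if_true]
      refine e'.trans ?_
      simp only [hlog]
      field_simp
    · simp only [he, if_false] at this
      simp [D, he, this]
  · simp [D, ha]

lemma covDeriv4_weyl (hm : IsMetricOn F C I) {z : ℝ} (hz : z ∈ I) (p b c d : Fin 4) :
    covDeriv4 F C (weyl F C) p b c d p z = if d = px b c then
      C z * covWeylV (F z) (deriv F z) (deriv (deriv F) z) (deriv (deriv (deriv F)) z) (hlog C z)
        p b c d else 0 := by
  rw [covDeriv4]
  simp only [D_weyl hm hz, conn_eq hm hz, ite_mul, zero_mul, Finset.sum_add_distrib,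
    Finset.sum_ite_eq', Finset.mem_univ, if_true, weyl_eq hm hz,
    px_degree₁, px_degree₂, px_degree₃, px_degree₄]
  by_cases hd : d = px b c
  · subst hd
    simp only [if_true, covWeylV, Pw, px_degree_iff]
    split_ifs <;> ring
  · simp only [hd, if_false]
    split_ifs with h h' <;> simp
    exact absurd (px_degree h h') hd

lemma divWeyl_eq (hm : IsMetricOn F C I) {z : ℝ} (hz : z ∈ I) (b c d : Fin 4) :
    divWeyl F C b c d z = if d = px b c then divV (F z) (Aw F C z) (Bw F C z) b c else 0 := by
  obtain ⟨hF, hC⟩ := hm.2.2.2 z hz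
  simp only [divWeyl, gInv, ite_mul, zero_mul, Finset.sum_ite_eq, Finset.mem_univ, if_true,
    covDeriv4_weyl hm hz]
  by_cases hd : d = px b c
  · subst hd
    simp only [if_true]
    exact sum_covWeylV _ _ _ _ _ _ hF.ne' hC.ne' b c
  · simp [hd]

lemma D_divWeyl (hm : IsMetricOn F C I) {z : ℝ} (hz : z ∈ I) (p i j : Fin 4) :
    D p (divWeyl F C p i j) z = if i = j then (if p = 0 then
      (![0, -(2 / 3) * (deriv F z * Aw F C z + F z * deriv (Aw F C) z), deriv (Aw F C) z / 3,
        deriv (Aw F C) z / 3] : Fin 4 → ℝ) i else 0) else 0 := by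
  by_cases hp : p = 0
  · subst hp
    have k : j = px 0 i ↔ i = j := by revert i j; decide
    have := deriv_congr_of_eqOn hm.1 (fun x hx => divWeyl_eq hm hx 0 i j) hz
    simp only [k] at this
    by_cases hij : i = j
    · obtain ⟨h0, h1, h2, h3, h4⟩ := hasDerivAt_jets hm hz
      have hA : DifferentiableAt ℝ (Aw F C) z :=
        ((h3.sub (h1.const_mul (5 / 2))).add
          ((h4.mul (hasDerivAt_Pw hm hz)).div_const 2)).differentiableAt
      have hB : DifferentiableAt ℝ (Bw F C) z :=
        (((h2.neg.add (h0.const_mul 2)).sub_const 2).sub (h1.mul h4)).differentiableAt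
      have e := (hasDerivAt_divV h0 hA.hasDerivAt hB.hasDerivAt 0 i).deriv
      simp only [hij, if_true] at this e
      simp only [D, hij, if_true, this, e]
      fin_cases j <;> simp
    · simp only [hij, if_false] at this
      simp [D, this, hij]
  · simp [D, hp]

lemma deriv_Aw (hm : IsMetricOn F C I) {z : ℝ} (hz : z ∈ I) :
    deriv (Aw F C) z = deriv (deriv (deriv (deriv F))) z - 5 / 2 * deriv (deriv F) z
      + (deriv (hlog C) z * Pw F z
        + hlog C z * (deriv (deriv (deriv F)) z + 2 * deriv F z)) / 2 := by
  obtain ⟨-, h1, -, h3, h4⟩ := hasDerivAt_jets hm hz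
  exact ((h3.sub (h1.const_mul (5 / 2))).add
    ((h4.mul (hasDerivAt_Pw hm hz)).div_const 2)).deriv

lemma covDeriv3_divWeyl (hm : IsMetricOn F C I) {z : ℝ} (hz : z ∈ I) (p i j : Fin 4) :
    covDeriv3 F C (divWeyl F C) p p i j z = if i = j then (if p = 0 then
        (![0, -(2 / 3) * (deriv F z * Aw F C z + F z * deriv (Aw F C) z), deriv (Aw F C) z / 3,
          deriv (Aw F C) z / 3] : Fin 4 → ℝ) i else 0)
      - (connV (F z) (deriv F z) (hlog C z) p p * divV (F z) (Aw F C z) (Bw F C z) 0 i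
        + connV (F z) (deriv F z) (hlog C z) p i * divV (F z) (Aw F C z) (Bw F C z) p (px p i)
        + connV (F z) (deriv F z) (hlog C z) p i * divV (F z) (Aw F C z) (Bw F C z) p i)
      else 0 := by
  have k0 : px p p = 0 := by revert p; decide
  have k1 : j = px 0 i ↔ i = j := by revert i j; decide
  have k2 : j = px p (px p i) ↔ i = j := by rw [px_px_self, eq_comm]
  have k3 : px p j = px p i ↔ i = j := by revert p i j; decide
  simp only [covDeriv3, D_divWeyl hm hz, conn_eq hm hz, ite_mul, zero_mul, Finset.sum_add_distrib,
    Finset.sum_ite_eq', Finset.mem_univ, if_true, k0]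
  simp only [divWeyl_eq hm hz, k1, k2, k3]
  by_cases hij : i = j
  · subst hij; simp only [if_true]
  · simp [hij]

lemma bach_eq (hm : IsMetricOn F C I) {z : ℝ} (hz : z ∈ I) (i j : Fin 4) :
    bach F C i j z = if i = j then bachV (C z) (F z) (deriv F z) (deriv (deriv F) z)
      (deriv (deriv (deriv F)) z) (deriv (deriv (deriv (deriv F))) z) (hlog C z)
      (deriv (hlog C) z) i else 0 := by
  have e1 : ∀ (p q : Fin 4) (x : ℝ), ∑ k, ∑ l, gInv F C p k z * gInv F C q l z * x * ric F C k l z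
      = (gDiag F C p z)⁻¹ * (gDiag F C q z)⁻¹ * x * ric F C p q z := by
    intro p q x
    simp [gInv]
  have e2 : ∀ p : Fin 4, p = px (px p i) j ↔ i = j := by revert i j; decide
  rw [bach]
  simp only [e1]
  simp only [ric_eq hm hz, mul_ite, mul_zero, Finset.sum_ite_eq, Finset.mem_univ, if_true]
  simp only [gInv, ite_mul, zero_mul, Finset.sum_ite_eq, Finset.mem_univ, if_true,
    covDeriv3_divWeyl hm hz, weyl_eq hm hz, e2]
  by_cases hij : i = j
  · subst hij
    simp only [if_true, deriv_Aw hm hz, bachV]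
    rfl
  · simp [hij]

/-- The Hessian of a function of `z`. -/
lemma hess_eq (hm : IsMetricOn F C I) {z : ℝ} (hz : z ∈ I) (s : ℝ → ℝ) (i j : Fin 4) :
    hess F C s i j z = if i = j then (if i = 0 then deriv (deriv s) z else 0)
      - connV (F z) (deriv F z) (hlog C z) i i * deriv s z else 0 := by
  have k : (0 : Fin 4) = px i j ↔ i = j := by revert i j; decide
  have e : D i (fun x => D j s x) z = if i = j then (if i = 0 then deriv (deriv s) z else 0)
      else 0 := by
    by_cases hi : i = 0 <;> by_cases hj : j = 0
    · simp [D, hi, hj]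
    · simp [D, hi, hj, Ne.symm hj]
    · simp [D, hi, hj]
    · simp [D, hi]
  simp only [hess, covDeriv1, conn_eq hm hz]
  have e' : (D i (D j s) z) = D i (fun x => D j s x) z := rfl
  rw [e', e]
  simp only [D, ite_mul, zero_mul, mul_ite, mul_zero, Finset.sum_ite_eq', Finset.mem_univ,
    if_true, k]
  by_cases hij : i = j
  · subst hij; simp
  · simp [hij]

lemma lap_eq (hm : IsMetricOn F C I) {z : ℝ} (hz : z ∈ I) (s : ℝ → ℝ) :
    lap F C s z = 4 / C z * (F z * deriv (deriv s) z
      + (deriv F z + F z * hlog C z) * deriv s z) := by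
  obtain ⟨hF, hC⟩ := hm.2.2.2 z hz
  simp only [lap, gInv, ite_mul, zero_mul, Finset.sum_ite_eq, Finset.mem_univ, if_true,
    hess_eq hm hz]
  simp [Fin.sum_univ_four, gDiag, connV]
  field_simp
  ring

end metric

/-! ## The reduced system in terms of the jets of the unknowns -/

/-- The conserved quantity as a function of the initial conditions. -/
def TV (t : ℝ) (p : Fin 8 → ℝ) : ℝ :=
  16 * ((p 0 - 1) ^ 2 - (p 2 / 2 - 3 / 2 * p 1) ^ 2 + p 1 * (p 3 / 2 - 3 / 2 * p 2 + p 1))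
    - 18 * t * p 0 * p 5 * p 7 - 6 * t * p 4 * p 1 * p 7
    - 3 / 4 * t * p 6 * (p 4)⁻¹ * (p 4 ^ 2 * (-16 + 4 * p 0 + p 4 * p 6)
      + 12 * p 0 * p 5 ^ 2 + 8 * p 4 * p 5 * p 1)

/-- `(C F s')'` as a function of the initial conditions and `s''`. -/
def EV (p : Fin 8 → ℝ) (s₂ : ℝ) : ℝ := (p 5 * p 0 + p 4 * p 1) * p 7 + p 4 * p 0 * s₂

/-- `C^{1/2}` times the second equation, as a function of the initial conditions and `C''`. -/
def F1V (p : Fin 8 → ℝ) (c₂ : ℝ) : ℝ :=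
  12 * p 0 * (c₂ - p 5 ^ 2 / (2 * p 4)) + 12 * p 1 * p 5 + 4 * p 4 * (p 2 + p 0 / 2 - 2)
    + p 6 * p 4 ^ 2

/-- The third equation as a function of the initial conditions, `F''''` and `C''`. -/
def F2V (t : ℝ) (p : Fin 8 → ℝ) (f₄ c₂ : ℝ) : ℝ :=
  8 / 3 * (f₄ / 4 - 5 / 4 * p 2 + p 0 - 1)
    + t * p 6 * (-(c₂ / 2) + 3 / 4 * (p 5 ^ 2 / p 4) - p 4 / 4)
    + t / 2 * (p 4 / p 0) * p 1 * p 7 + t * p 5 * p 7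

/-- The Euler-Lagrange tensor in terms of the conserved quantity and the reduced equations. -/
def btV (t : ℝ) (p : Fin 8 → ℝ) (f₄ c₂ s₂ : ℝ) (i : Fin 4) : ℝ :=
  ![2 / 3 * TV t p, 2 / 3 * TV t p + 16 * p 0 * F2V t p f₄ c₂ - 8 * t * EV p s₂,
    -(2 / 3) * TV t p - 8 * p 0 * F2V t p f₄ c₂ - 8 * t * EV p s₂,
    -(2 / 3) * TV t p - 8 * p 0 * F2V t p f₄ c₂ - 8 * t * EV p s₂] i

set_option maxHeartbeats 1000000 in
-- The central computation. The 0-entry contains no `F''''` and is the constraint `T`; the four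
-- values of `btV` add up to `-24 t` times `EV`, which reflects that the trace of the tensor is `-6
-- t △s`. The derivatives `s₁`, `s₂` may be treated as free variables, while `s` itself must be the
-- scalar curvature.
lemma btV_eq (t c f f₁ f₂ f₃ f₄ h h₁ s₁ s₂ : ℝ) (hf : f ≠ 0) (hc : c ≠ 0) (i : Fin 4) :
    let G : Fin 4 → ℝ := ![c / (4 * f), c * f, c, c]
    let s := scalV f f₁ f₂ h h₁ / c;
    -4 * bachV c f f₁ f₂ f₃ f₄ h h₁ i + t * (2 * ((if i = 0 then s₂ else 0) - connV f f₁ h i i * s₁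
        - 4 / c * (f * s₂ + (f₁ + f * h) * s₁) * G i
        - s * (ricV f f₁ f₂ h h₁ i - s / 4 * G i)))
      = G i / c ^ 2 * btV t ![f, f₁, f₂, f₃, c, h * c, s, s₁] f₄ (c * (h₁ + h ^ 2)) s₂ i := by
  fin_cases i <;>
    simp [Fin.sum_univ_four, bachV, divV, connV, px, weylV, kapV, sgV, chiV, ricV, scalV, btV,
      TV, F2V, EV] <;>
    field_simp <;> ring

section metric

variable {F C : ℝ → ℝ} {I : Set ℝ}

lemma deriv_hlog (hm : IsMetricOn F C I) {z : ℝ} (hz : z ∈ I) :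
    deriv (deriv C) z = C z * (deriv (hlog C) z + hlog C z ^ 2) := by
  have hC := hasDerivAt_of_contDiffOn hm.1 hm.2.2.1 hz
  have hC1 := hasDerivAt_of_contDiffOn hm.1 (contDiffOn_deriv hm.1 hm.2.2.1) hz
  have h0 := (hm.2.2.2 z hz).2.ne'
  have e : deriv (hlog C) z = _ := (hC1.div hC h0).deriv
  rw [e, hlog]
  field_simp
  ring

lemma btTensor_eq (t : ℝ) (hm : IsMetricOn F C I) {z : ℝ} (hz : z ∈ I) (i j : Fin 4) :
    btTensor t F C i j z = if i = j then gDiag F C i z / C z ^ 2 * btV t (metricData F C z)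
      (deriv (deriv (deriv (deriv F))) z) (deriv (deriv C) z) (deriv (deriv (scal F C)) z) i
      else 0 := by
  obtain ⟨hF, hC⟩ := hm.2.2.2 z hz
  simp only [btTensor, ricTF, g, bach_eq hm hz, hess_eq hm hz, lap_eq hm hz, ric_eq hm hz]
  by_cases hij : i = j
  · subst hij
    have e : hlog C z * C z = deriv C z := by rw [hlog]; field_simp
    simp only [if_true]
    rw [metricData, cauchyData, deriv_hlog hm hz, ← e, scal_eq hm hz]
    exact btV_eq t _ _ _ _ _ _ _ _ _ _ hF.ne' hC.ne' i
  · simp [hij]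

end metric

/-! ## The reduced system as an ordinary differential equation -/

lemma contDiffAt_deriv {f : ℝ → ℝ} {z : ℝ} (h : ContDiffAt ℝ ∞ f z) :
    ContDiffAt ℝ ∞ (deriv f) z := by
  simpa [derivWithin_univ] using h.derivWithin (m := ∞) (by simp)

lemma eventually_hasDerivAt {f : ℝ → ℝ} {z : ℝ} (h : ContDiffAt ℝ ∞ f z) :
    ∀ᶠ x in nhds z, HasDerivAt f (deriv f x) x := by
  have h1 : ContDiffAt ℝ 1 f z := h.of_le (by simp)
  filter_upwards [h1.eventually (by simp)] with x hx
  exact (hx.differentiableAt (by simp)).hasDerivAt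

lemma hasDerivAt_of_contDiffAt {f : ℝ → ℝ} {z : ℝ} (h : ContDiffAt ℝ ∞ f z) :
    HasDerivAt f (deriv f z) z :=
  (eventually_hasDerivAt h).self_of_nhds

/-- Needed in a neighbourhood, not just at the point, because `opB` differentiates `Lplus F`. -/
lemma Lplus_eventuallyEq {F : ℝ → ℝ} {z : ℝ} (h : ContDiffAt ℝ ∞ F z) :
    Lplus F =ᶠ[nhds z] fun x => 1 / 2 * deriv (deriv F) x - 3 / 2 * deriv F x + F x := by
  filter_upwards [eventually_hasDerivAt h, eventually_hasDerivAt (contDiffAt_deriv h)] with x h0 h1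
  have e := (h1.neg.add h0).deriv
  have e' : deriv (fun y => -deriv F y + F y) x = _ := e
  simp only [Lplus, e']
  ring

lemma Lminus_eventuallyEq {F : ℝ → ℝ} {z : ℝ} (h : ContDiffAt ℝ ∞ F z) :
    Lminus F =ᶠ[nhds z] fun x => 1 / 2 * deriv (deriv F) x + 3 / 2 * deriv F x + F x := by
  filter_upwards [eventually_hasDerivAt h, eventually_hasDerivAt (contDiffAt_deriv h)] with x h0 h1
  have e := (h1.add h0).deriv
  have e' : deriv (fun y => deriv F y + F y) x = _ := e
  simp only [Lminus, e']
  ring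

lemma Lplus_congr {F G : ℝ → ℝ} {z : ℝ} (h : F =ᶠ[nhds z] G) : Lplus F z = Lplus G z := by
  have e : (fun x => -deriv F x + F x) =ᶠ[nhds z] fun x => -deriv G x + G x := by
    filter_upwards [h, h.deriv] with x h0 h1
    rw [h0, h1]
  simp only [Lplus, e.deriv_eq, e.self_of_nhds]

/-- The product factors as `(1 - ¼ d²/dz²)(1 - d²/dz²)`, which is why the odd derivatives drop out.
-/
lemma Lplus_Lminus {F : ℝ → ℝ} {z : ℝ} (h : ContDiffAt ℝ ∞ F z) :
    Lplus (Lminus F) z = 1 / 4 * deriv (deriv (deriv (deriv F))) z - 5 / 4 * deriv (deriv F) z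
      + F z := by
  have h1 := contDiffAt_deriv h
  have h2 := contDiffAt_deriv h1
  have h3 := contDiffAt_deriv h2
  have hG : ContDiffAt ℝ ∞ (fun x => 1 / 2 * deriv (deriv F) x + 3 / 2 * deriv F x + F x) z := by
    fun_prop
  rw [Lplus_congr (Lminus_eventuallyEq h), (Lplus_eventuallyEq hG).self_of_nhds]
  have e : deriv (fun x => 1 / 2 * deriv (deriv F) x + 3 / 2 * deriv F x + F x) =ᶠ[nhds z]
      fun x => 1 / 2 * deriv (deriv (deriv F)) x + 3 / 2 * deriv (deriv F) x + deriv F x := by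
    filter_upwards [eventually_hasDerivAt h, eventually_hasDerivAt h1, eventually_hasDerivAt h2]
      with x d0 d1 d2
    exact (((d2.const_mul (1 / 2)).add (d1.const_mul (3 / 2))).add d0).deriv
  have e' : deriv (fun x => 1 / 2 * deriv (deriv (deriv F)) x + 3 / 2 * deriv (deriv F) x
      + deriv F x) z = _ :=
    ((((hasDerivAt_of_contDiffAt h3).const_mul (1 / 2)).add
      ((hasDerivAt_of_contDiffAt h2).const_mul (3 / 2))).add (hasDerivAt_of_contDiffAt h1)).deriv
  beta_reduce
  rw [e.deriv_eq, e', e.self_of_nhds]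
  ring

section jets

variable {F C s : ℝ → ℝ} {z : ℝ}

lemma opE_eq (hF : ContDiffAt ℝ ∞ F z) (hC : ContDiffAt ℝ ∞ C z) (hs : ContDiffAt ℝ ∞ s z) :
    opE F C s z = EV (cauchyData F C s z) (deriv (deriv s) z) := by
  have e := (((hasDerivAt_of_contDiffAt hC).mul (hasDerivAt_of_contDiffAt hF)).mul
    (hasDerivAt_of_contDiffAt (contDiffAt_deriv hs))).deriv
  exact e

lemma eventually_hasDerivAt_sqrt (hC : ContDiffAt ℝ ∞ C z) (h0 : 0 < C z) :
    ∀ᶠ x in nhds z, HasDerivAt (fun y => √(C y)) (deriv C x / (2 * √(C x))) x := by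
  filter_upwards [eventually_hasDerivAt hC, hC.continuousAt.eventually (lt_mem_nhds h0)] with x hx hx0
  exact hx.sqrt hx0.ne'

/-- The factor `√C` clears the half-integer powers of `C`, leaving an expression rational in the
initial conditions and affine in `C''`. -/
lemma opF1_eq (hF : ContDiffAt ℝ ∞ F z) (hC : ContDiffAt ℝ ∞ C z) (h0 : 0 < C z) :
    √(C z) * opF1 F C s z = F1V (cauchyData F C s z) (deriv (deriv C) z) := by
  have hr := eventually_hasDerivAt_sqrt hC h0
  have e : (fun x => F x * deriv (fun y => √(C y)) x) =ᶠ[nhds z]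
      fun x => F x * (deriv C x / (2 * √(C x))) := by
    filter_upwards [hr] with x hx
    rw [hx.deriv]
  have r0 : 0 < √(C z) := Real.sqrt_pos.2 h0
  have e' := ((hasDerivAt_of_contDiffAt hF).mul ((hasDerivAt_of_contDiffAt
    (contDiffAt_deriv hC)).div (hr.self_of_nhds.const_mul 2) (by positivity))).deriv
  have e'' : deriv (fun x => F x * (deriv C x / (2 * √(C x)))) z = _ := e'
  rw [opF1, e.deriv_eq, e'']
  simp only [F1V, cauchyData, Matrix.cons_val, Pi.div_apply]
  -- With `r = √C` as variable and `C = r²`, the claim is an identity of rational functions.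
  have hs : √(C z) ^ 2 = C z := Real.sq_sqrt h0.le
  generalize √(C z) = r at *
  rw [← hs]
  field_simp
  ring

lemma opF2_eq (t : ℝ) (hF : ContDiffAt ℝ ∞ F z) (hC : ContDiffAt ℝ ∞ C z) (h0 : 0 < C z) :
    opF2 t F C s z = F2V t (cauchyData F C s z) (deriv (deriv (deriv (deriv F))) z)
      (deriv (deriv C) z) := by
  have hr := eventually_hasDerivAt_sqrt hC h0
  have e : deriv (fun y => (√(C y))⁻¹) =ᶠ[nhds z]
      fun x => -(deriv C x / (2 * √(C x))) / √(C x) ^ 2 := by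
    filter_upwards [hr, hC.continuousAt.eventually (lt_mem_nhds h0)] with x hx hx0
    exact (hx.inv (Real.sqrt_pos.2 hx0).ne').deriv
  have r0 : 0 < √(C z) := Real.sqrt_pos.2 h0
  have e' := ((((hasDerivAt_of_contDiffAt (contDiffAt_deriv hC)).div
    (hr.self_of_nhds.const_mul 2) (by positivity)).neg).div (hr.self_of_nhds.pow 2)
    (pow_ne_zero 2 r0.ne')).deriv
  have e'' : deriv (fun x => -(deriv C x / (2 * √(C x))) / √(C x) ^ 2) z = _ := e'
  rw [opF2, e.deriv_eq, e'', Lplus_Lminus hF]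
  simp only [F2V, cauchyData, Matrix.cons_val, Pi.div_apply, Pi.neg_apply, Pi.pow_apply]
  have hs : √(C z) ^ 2 = C z := Real.sq_sqrt h0.le
  generalize √(C z) = r at *
  rw [← hs]
  field_simp
  ring

lemma opT_eq (t : ℝ) (hF : ContDiffAt ℝ ∞ F z) :
    opT t F C s z = TV t (cauchyData F C s z) := by
  have h1 := contDiffAt_deriv hF
  have h2 := contDiffAt_deriv h1
  have e := Lplus_eventuallyEq hF
  have e' : deriv (fun x => 1 / 2 * deriv (deriv F) x - 3 / 2 * deriv F x + F x) z = _ :=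
    ((((hasDerivAt_of_contDiffAt h2).const_mul (1 / 2)).sub
      ((hasDerivAt_of_contDiffAt h1).const_mul (3 / 2))).add (hasDerivAt_of_contDiffAt hF)).deriv
  rw [opT, opB, e.deriv_eq, e', e.self_of_nhds]
  simp only [TV, cauchyData, Matrix.cons_val]
  ring

end jets

/-! ### Solving for the highest derivatives -/

/-- The solution for `C''` of the second reduced equation. -/
def c2V (p : Fin 8 → ℝ) : ℝ :=
  p 5 ^ 2 / (2 * p 4)
    - (12 * p 1 * p 5 + 4 * p 4 * (p 2 + p 0 / 2 - 2) + p 6 * p 4 ^ 2) / (12 * p 0)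

/-- The solution for `F''''` of the third reduced equation. -/
def f4V (t : ℝ) (p : Fin 8 → ℝ) : ℝ :=
  5 * p 2 - 4 * p 0 + 4 - 3 / 2 * (t * p 6 * (-(c2V p / 2) + 3 / 4 * (p 5 ^ 2 / p 4) - p 4 / 4)
    + t / 2 * (p 4 / p 0) * p 1 * p 7 + t * p 5 * p 7)

/-- The solution for `s''` of the first reduced equation. -/
def s2V (p : Fin 8 → ℝ) : ℝ := -((p 5 * p 0 + p 4 * p 1) * p 7) / (p 4 * p 0)

lemma EV_eq_zero_iff {p : Fin 8 → ℝ} (hp : p ∈ admissible) (x : ℝ) :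
    EV p x = 0 ↔ x = s2V p := by
  obtain ⟨h0, h4⟩ := hp
  have h4 := h4.ne'
  rw [s2V, eq_div_iff (mul_ne_zero h4 h0), EV]
  constructor <;> intro h <;> linarith

lemma F1V_eq_zero_iff {p : Fin 8 → ℝ} (hp : p ∈ admissible) (x : ℝ) :
    F1V p x = 0 ↔ x = c2V p := by
  obtain ⟨h0, h4⟩ := hp
  have h4 := h4.ne'
  have e : F1V p x = 12 * p 0 * (x - c2V p) := by rw [F1V, c2V]; field_simp; ring
  rw [e, mul_eq_zero, sub_eq_zero]
  simp [h0]

lemma F2V_eq_zero_iff (t : ℝ) (p : Fin 8 → ℝ) (x : ℝ) :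
    F2V t p x (c2V p) = 0 ↔ x = f4V t p := by
  rw [F2V, f4V]
  constructor <;> intro h <;> linarith

/-- The system is triangular: `s''` has coefficient `C F` in the first equation, `C''` has
coefficient `12 F` in `√C` times the second, and once `C''` is known `F''''` has coefficient `2/3`
in the third. -/
lemma reduced_iff (t : ℝ) {F C s : ℝ → ℝ} {z : ℝ} (hF : ContDiffAt ℝ ∞ F z)
    (hC : ContDiffAt ℝ ∞ C z) (hs : ContDiffAt ℝ ∞ s z) (hF0 : F z ≠ 0) (hC0 : 0 < C z) :
    (opE F C s z = 0 ∧ opF1 F C s z = 0 ∧ opF2 t F C s z = 0) ↔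
      deriv (deriv (deriv (deriv F))) z = f4V t (cauchyData F C s z) ∧
      deriv (deriv C) z = c2V (cauchyData F C s z) ∧
      deriv (deriv s) z = s2V (cauchyData F C s z) := by
  have hp : cauchyData F C s z ∈ admissible := ⟨hF0, hC0⟩
  have r0 : √(C z) ≠ 0 := (Real.sqrt_pos.2 hC0).ne'
  rw [opE_eq hF hC hs, EV_eq_zero_iff hp, opF2_eq t hF hC hC0,
    ← (mul_eq_zero_iff_left r0 : √(C z) * opF1 F C s z = 0 ↔ _), opF1_eq hF hC hC0,
    F1V_eq_zero_iff hp]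
  constructor
  · rintro ⟨h1, h2, h3⟩
    rw [h2, F2V_eq_zero_iff] at h3
    exact ⟨h3, h2, h1⟩
  · rintro ⟨h1, h2, h3⟩
    refine ⟨h3, h2, ?_⟩
    rw [h2, F2V_eq_zero_iff, h1]

lemma isOpen_admissible : IsOpen admissible :=
  (isOpen_ne_fun (continuous_apply 0) continuous_const).inter
    (isOpen_lt continuous_const (continuous_apply 4))

lemma contDiffOn_c2V : ContDiffOn ℝ ∞ c2V admissible := by
  intro p hp
  have h4 := hp.2.ne'
  have h0 := hp.1
  unfold c2V
  exact ContDiffAt.contDiffWithinAt (by fun_prop (disch := simp [h0, h4]))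

lemma contDiffOn_f4V (t : ℝ) : ContDiffOn ℝ ∞ (f4V t) admissible := by
  intro p hp
  have h4 := hp.2.ne'
  have h0 := hp.1
  have := contDiffOn_c2V.contDiffAt (isOpen_admissible.mem_nhds hp)
  unfold f4V
  exact ContDiffAt.contDiffWithinAt (by fun_prop (disch := simp [h0, h4]))

lemma contDiffOn_s2V : ContDiffOn ℝ ∞ s2V admissible := by
  intro p hp
  have h4 := hp.2.ne'
  have h0 := hp.1
  unfold s2V
  exact ContDiffAt.contDiffWithinAt (by fun_prop (disch := simp [h0, h4]))

/-! ### Integral curves: regularity, existence, uniqueness -/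

/-- The vector field on the space of initial conditions whose integral curves are the solutions of
the reduced system. -/
def field (t : ℝ) (p : Fin 8 → ℝ) : Fin 8 → ℝ :=
  ![p 1, p 2, p 3, f4V t p, p 5, c2V p, p 7, s2V p]

lemma contDiffOn_field (t : ℝ) : ContDiffOn ℝ ∞ (field t) admissible := by
  have e : ∀ i : Fin 8, ContDiffOn ℝ ∞ (fun p : Fin 8 → ℝ => p i) admissible :=
    fun i => (contDiff_apply ℝ ℝ i).contDiffOn
  refine contDiffOn_pi.2 fun i => ?_
  fin_cases i
  exacts [e 1, e 2, e 3, contDiffOn_f4V t, e 5, contDiffOn_c2V, e 7, contDiffOn_s2V]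

lemma hasDerivAt_cauchyData {t : ℝ} {F C s : ℝ → ℝ} {I : Set ℝ} (h : SolvesReduced t F C s I)
    {z : ℝ} (hz : z ∈ I) :
    HasDerivAt (cauchyData F C s) (field t (cauchyData F C s z)) z := by
  obtain ⟨hI, hF, hC, hs, h0, he⟩ := h
  have hn := hI.mem_nhds hz
  have hF := hF.contDiffAt hn
  have hC := hC.contDiffAt hn
  have hs := hs.contDiffAt hn
  obtain ⟨e4, e2, es⟩ := (reduced_iff t hF hC hs (h0 z hz).1 (h0 z hz).2).1 (he z hz)
  have d0 := hasDerivAt_of_contDiffAt hF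
  have d1 := hasDerivAt_of_contDiffAt (contDiffAt_deriv hF)
  have d2 := hasDerivAt_of_contDiffAt (contDiffAt_deriv (contDiffAt_deriv hF))
  have d3 := hasDerivAt_of_contDiffAt (contDiffAt_deriv (contDiffAt_deriv (contDiffAt_deriv hF)))
  have d4 := hasDerivAt_of_contDiffAt hC
  have d5 := hasDerivAt_of_contDiffAt (contDiffAt_deriv hC)
  have d6 := hasDerivAt_of_contDiffAt hs
  have d7 := hasDerivAt_of_contDiffAt (contDiffAt_deriv hs)
  rw [e4] at d3
  rw [e2] at d5
  rw [es] at d7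
  rw [hasDerivAt_pi]
  intro i
  fin_cases i
  exacts [d0, d1, d2, d3, d4, d5, d6, d7]

lemma cauchyData_mem {t : ℝ} {F C s : ℝ → ℝ} {I : Set ℝ} (h : SolvesReduced t F C s I)
    {z : ℝ} (hz : z ∈ I) : cauchyData F C s z ∈ admissible :=
  h.2.2.2.2.1 z hz

lemma contDiffAt_integralCurve {t : ℝ} {y : ℝ → Fin 8 → ℝ} {I : Set ℝ} (hI : IsOpen I)
    (hy : ∀ z ∈ I, y z ∈ admissible ∧ HasDerivAt y (field t (y z)) z) {z : ℝ} (hz : z ∈ I) :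
    ContDiffAt ℝ ∞ y z := by
  -- The regularity theorem for integral curves concerns compact intervals, so one around `z` is
  -- placed inside `I`.
  obtain ⟨ε, hε, hsub⟩ := Metric.isOpen_iff.1 hI z hz
  have hsub' : Icc (z - ε / 2) (z + ε / 2) ⊆ I := by
    intro x hx
    refine hsub ?_
    rw [Real.ball_eq_Ioo]
    constructor <;> [linarith [hx.1]; linarith [hx.2]]
  have := ODE.contDiffOn_enat_Icc_of_hasDerivWithinAt (f := fun _ => field t) (n := ⊤)
    (u := admissible) (tmin := z - ε / 2) (tmax := z + ε / 2) (α := y)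
    ((contDiffOn_field t).comp contDiff_snd.contDiffOn fun x hx => hx.2)
    (fun x hx => (hy x (hsub' hx)).2.hasDerivWithinAt) fun x hx => (hy x (hsub' hx)).1
  exact this.contDiffAt (Icc_mem_nhds (by linarith) (by linarith))

/-- An integral curve of the vector field is a solution of the reduced system. -/
lemma solves_of_integralCurve {t : ℝ} {y : ℝ → Fin 8 → ℝ} {I : Set ℝ} (hI : IsOpen I)
    (hy : ∀ z ∈ I, y z ∈ admissible ∧ HasDerivAt y (field t (y z)) z) :
    SolvesReduced t (fun z => y z 0) (fun z => y z 4) (fun z => y z 6) I ∧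
      ∀ z ∈ I, cauchyData (fun z => y z 0) (fun z => y z 4) (fun z => y z 6) z = y z := by
  have hs : ∀ z ∈ I, ∀ i, ContDiffAt ℝ ∞ (fun x => y x i) z := fun z hz i =>
    contDiffAt_pi.1 (contDiffAt_integralCurve hI hy hz) i
  have hd : ∀ i, ∀ z ∈ I, deriv (fun x => y x i) z = field t (y z) i := fun i z hz =>
    (hasDerivAt_pi.1 (hy z hz).2 i).deriv
  have d1 : ∀ z ∈ I, deriv (fun x => y x 0) z = y z 1 := hd 0
  have d2 : ∀ z ∈ I, deriv (deriv fun x => y x 0) z = y z 2 := fun z hz =>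
    (deriv_congr_of_eqOn hI d1 hz).trans (hd 1 z hz)
  have d3 : ∀ z ∈ I, deriv (deriv (deriv fun x => y x 0)) z = y z 3 := fun z hz =>
    (deriv_congr_of_eqOn hI d2 hz).trans (hd 2 z hz)
  have d5 : ∀ z ∈ I, deriv (fun x => y x 4) z = y z 5 := hd 4
  have d7 : ∀ z ∈ I, deriv (fun x => y x 6) z = y z 7 := hd 6
  have hc : ∀ z ∈ I, cauchyData (fun z => y z 0) (fun z => y z 4) (fun z => y z 6) z = y z := by
    intro z hz
    rw [cauchyData, d1 z hz, d2 z hz, d3 z hz, d5 z hz, d7 z hz]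
    ext i
    fin_cases i <;> rfl
  refine ⟨⟨hI, fun z hz => (hs z hz 0).contDiffWithinAt, fun z hz => (hs z hz 4).contDiffWithinAt,
    fun z hz => (hs z hz 6).contDiffWithinAt, fun z hz => (hy z hz).1, fun z hz => ?_⟩, hc⟩
  rw [reduced_iff t (hs z hz 0) (hs z hz 4) (hs z hz 6) (hy z hz).1.1 (hy z hz).1.2, hc z hz]
  exact ⟨(deriv_congr_of_eqOn hI d3 hz).trans (hd 3 z hz),
    (deriv_congr_of_eqOn hI d5 hz).trans (hd 5 z hz),
    (deriv_congr_of_eqOn hI d7 hz).trans (hd 7 z hz)⟩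

/-- The open set `U` is `admissible` for general solutions and `positiveData` for metrics; by
continuity a short piece of the curve stays in it. -/
lemma exists_integralCurve (t z₀ : ℝ) {p : Fin 8 → ℝ} {U : Set (Fin 8 → ℝ)} (hU : IsOpen U)
    (hUa : U ⊆ admissible) (hp : p ∈ U) :
    ∃ ε > 0, ∃ y : ℝ → Fin 8 → ℝ, y z₀ = p ∧
      ∀ z ∈ Ioo (z₀ - ε) (z₀ + ε), y z ∈ U ∧ HasDerivAt y (field t (y z)) z := by
  have h1 : ContDiffAt ℝ 1 (field t) p :=
    ((contDiffOn_field t).contDiffAt (isOpen_admissible.mem_nhds (hUa hp))).of_le (by simp)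
  obtain ⟨y, hy0, ε, hε, hy⟩ :=
    h1.exists_forall_mem_closedBall_exists_eq_forall_mem_Ioo_hasDerivAt₀ z₀
  have hc : ContinuousAt y z₀ := (hy z₀ ⟨by linarith, by linarith⟩).continuousAt
  have : ∀ᶠ z in nhds z₀, y z ∈ U := hc.eventually_mem (hU.mem_nhds (hy0 ▸ hp))
  obtain ⟨δ, hδ, hb⟩ := Metric.eventually_nhds_iff_ball.1 this
  rw [Real.ball_eq_Ioo] at hb
  refine ⟨min ε δ, lt_min hε hδ, y, hy0, fun z hz => ⟨hb z ?_, hy z ?_⟩⟩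
  · constructor <;> [linarith [hz.1, min_le_right ε δ]; linarith [hz.2, min_le_right ε δ]]
  · constructor <;> [linarith [hz.1, min_le_left ε δ]; linarith [hz.2, min_le_left ε δ]]

/-- The set where the curves agree is open by local uniqueness (`field` is locally Lipschitz), the
set where they differ is open by continuity, and `I` is connected. -/
lemma integralCurve_unique {t : ℝ} {y y' : ℝ → Fin 8 → ℝ} {I : Set ℝ} (hI : IsOpen I)
    (hc : IsPreconnected I)
    (hy : ∀ z ∈ I, y z ∈ admissible ∧ HasDerivAt y (field t (y z)) z)
    (hy' : ∀ z ∈ I, y' z ∈ admissible ∧ HasDerivAt y' (field t (y' z)) z) {z₀ : ℝ} (h0 : z₀ ∈ I)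
    (heq : y z₀ = y' z₀) : EqOn y y' I := by
  have loc : ∀ z ∈ I, y z = y' z → ∀ᶠ x in nhds z, y x = y' x := by
    intro z hz he
    have h1 : ContDiffAt ℝ 1 (field t) (y z) :=
      ((contDiffOn_field t).contDiffAt (isOpen_admissible.mem_nhds (hy z hz).1)).of_le (by simp)
    obtain ⟨K, s, hs, hl⟩ := h1.exists_lipschitzOnWith
    refine ODE_solution_unique_of_eventually (v := fun _ => field t) (s := fun _ => s) (K := K)
      (Filter.Eventually.of_forall fun _ => hl) ?_ ?_ he
    · filter_upwards [hI.mem_nhds hz, (hy z hz).2.continuousAt.eventually_mem hs] with x hx hxs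
      exact ⟨(hy x hx).2, hxs⟩
    · filter_upwards [hI.mem_nhds hz, (hy' z hz).2.continuousAt.eventually_mem (he ▸ hs)]
        with x hx hxs
      exact ⟨(hy' x hx).2, hxs⟩
  have hcl : ∀ z ∈ I, y z ≠ y' z → ∀ᶠ x in nhds z, y x ≠ y' x := by
    intro z hz hne
    have := ((hy z hz).2.sub (hy' z hz).2).continuousAt.eventually_ne (sub_ne_zero.2 hne)
    filter_upwards [this] with x hx
    exact sub_ne_zero.1 hx
  intro w hw
  by_contra hne
  have hsub : I ⊆ interior {x | y x = y' x} ∪ interior {x | y x ≠ y' x} := by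
    intro x hx
    by_cases h : y x = y' x
    · exact Or.inl (mem_interior_iff_mem_nhds.2 (loc x hx h))
    · exact Or.inr (mem_interior_iff_mem_nhds.2 (hcl x hx h))
  obtain ⟨x, -, hx1, hx2⟩ := hc _ _ isOpen_interior isOpen_interior hsub
    ⟨z₀, h0, mem_interior_iff_mem_nhds.2 (loc z₀ h0 heq)⟩
    ⟨w, hw, mem_interior_iff_mem_nhds.2 (hcl w hw hne)⟩
  have h1 : y x = y' x := interior_subset (s := {x | y x = y' x}) hx1
  have h2 : y x ≠ y' x := interior_subset (s := {x | y x ≠ y' x}) hx2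
  exact h2 h1

lemma solves_unique {t : ℝ} {I : Set ℝ} {z₀ : ℝ} {F C s F' C' s' : ℝ → ℝ} (hc : IsPreconnected I)
    (h0 : z₀ ∈ I) (h : SolvesReduced t F C s I) (h' : SolvesReduced t F' C' s' I)
    (he : cauchyData F C s z₀ = cauchyData F' C' s' z₀) :
    EqOn (cauchyData F C s) (cauchyData F' C' s') I :=
  integralCurve_unique h.1 hc (fun _ hz => ⟨cauchyData_mem h hz, hasDerivAt_cauchyData h hz⟩)
    (fun _ hz => ⟨cauchyData_mem h' hz, hasDerivAt_cauchyData h' hz⟩) h0 he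

/-! ## The conserved quantity -/

/-- The differential of the conserved quantity. -/
def dTV (t : ℝ) (p v : Fin 8 → ℝ) : ℝ :=
  16 * (2 * (p 0 - 1) * v 0 - 2 * (p 2 / 2 - 3 / 2 * p 1) * (v 2 / 2 - 3 / 2 * v 1)
      + (v 1 * (p 3 / 2 - 3 / 2 * p 2 + p 1) + p 1 * (v 3 / 2 - 3 / 2 * v 2 + v 1)))
    - 18 * t * (v 0 * p 5 * p 7 + p 0 * v 5 * p 7 + p 0 * p 5 * v 7)
    - 6 * t * (v 4 * p 1 * p 7 + p 4 * v 1 * p 7 + p 4 * p 1 * v 7)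
    - 3 / 4 * t * ((v 6 / p 4 - p 6 * v 4 / p 4 ^ 2) * (p 4 ^ 2 * (-16 + 4 * p 0 + p 4 * p 6)
        + 12 * p 0 * p 5 ^ 2 + 8 * p 4 * p 5 * p 1)
      + p 6 / p 4 * (2 * p 4 * v 4 * (-16 + 4 * p 0 + p 4 * p 6)
        + p 4 ^ 2 * (4 * v 0 + v 4 * p 6 + p 4 * v 6) + 12 * v 0 * p 5 ^ 2
        + 24 * p 0 * p 5 * v 5 + 8 * (v 4 * p 5 * p 1 + p 4 * v 5 * p 1 + p 4 * p 5 * v 1)))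

lemma hasDerivAt_TV_comp (t : ℝ) {y : ℝ → Fin 8 → ℝ} {v : Fin 8 → ℝ} {z : ℝ}
    (hy : HasDerivAt y v z) (h4 : y z 4 ≠ 0) :
    HasDerivAt (fun x => TV t (y x)) (dTV t (y z) v) z := by
  have d := hasDerivAt_pi.1 hy
  have e1 := (((d 0).sub_const 1).pow 2).sub ((((d 2).div_const 2).sub
    ((d 1).const_mul (3 / 2))).pow 2)
  have e2 := (d 1).mul ((((d 3).div_const 2).sub ((d 2).const_mul (3 / 2))).add (d 1))
  have e3 := (((d 0).const_mul (18 * t)).mul (d 5)).mul (d 7)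
  have e4 := (((d 4).const_mul (6 * t)).mul (d 1)).mul (d 7)
  have e5 := ((((d 4).pow 2).mul ((((d 0).const_mul 4).const_add (-16)).add
    ((d 4).mul (d 6)))).add (((d 0).const_mul 12).mul ((d 5).pow 2))).add
      ((((d 4).const_mul 8).mul (d 5)).mul (d 1))
  have e6 := ((((d 6).const_mul (3 / 4 * t)).mul ((d 4).inv h4)).mul e5)
  refine (((((e1.add e2).const_mul 16).sub e3).sub e4).sub e6).congr_deriv ?_
  simp only [dTV, Pi.mul_apply, Pi.add_apply, Pi.sub_apply, Pi.pow_apply, Pi.inv_apply]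
  field_simp
  ring

lemma contDiffAt_TV (t : ℝ) {p : Fin 8 → ℝ} (h4 : p 4 ≠ 0) : ContDiffAt ℝ ∞ (TV t) p := by
  unfold TV
  fun_prop (disch := simp [h4])

/-- Both sides are the derivative of `TV` along the line `x ↦ p + x • v`. -/
lemma fderiv_TV (t : ℝ) {p : Fin 8 → ℝ} (h4 : p 4 ≠ 0) (v : Fin 8 → ℝ) :
    fderiv ℝ (TV t) p v = dTV t p v := by
  have h1 : HasDerivAt (fun x : ℝ => p + x • v) v 0 := by
    simpa using ((hasDerivAt_id (0 : ℝ)).smul_const v).const_add p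
  have h2 := hasDerivAt_TV_comp t h1 (by simpa using h4)
  have h3 : HasFDerivAt (TV t) (fderiv ℝ (TV t) p) (p + (0 : ℝ) • v) := by
    simpa using ((contDiffAt_TV t h4).differentiableAt (by simp)).hasFDerivAt
  have h4 := h3.comp_hasDerivAt (0 : ℝ) h1
  simpa using h4.unique h2

/-- This is the conservation of `T`: after the highest derivatives are substituted, all terms cancel
identically, with no constraint on the initial conditions. -/
lemma dTV_field (t : ℝ) {p : Fin 8 → ℝ} (hp : p ∈ admissible) : dTV t p (field t p) = 0 := by
  obtain ⟨h0, h4⟩ := hp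
  have h4 := h4.ne'
  simp only [dTV, field, f4V, c2V, s2V, Matrix.cons_val]
  field_simp
  ring

/-- The quantity `C F s'`. -/
def KV (p : Fin 8 → ℝ) : ℝ := p 4 * p 0 * p 7

lemma eq_of_hasDerivAt_zero {f : ℝ → ℝ} {I : Set ℝ} (hI : IsOpen I) (hc : IsPreconnected I)
    (h : ∀ z ∈ I, HasDerivAt f 0 z) {z w : ℝ} (hz : z ∈ I) (hw : w ∈ I) : f z = f w :=
  hI.is_const_of_deriv_eq_zero hc (fun x hx => (h x hx).differentiableAt.differentiableWithinAt)
    (fun x hx => (h x hx).deriv) hz hw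

lemma TV_const {t : ℝ} {y : ℝ → Fin 8 → ℝ} {I : Set ℝ} (hI : IsOpen I)
    (hc : IsPreconnected I) (hy : ∀ z ∈ I, y z ∈ admissible ∧ HasDerivAt y (field t (y z)) z)
    {z w : ℝ} (hz : z ∈ I) (hw : w ∈ I) : TV t (y z) = TV t (y w) :=
  eq_of_hasDerivAt_zero hI hc (fun x hx => by
    simpa only [dTV_field t (hy x hx).1] using
      hasDerivAt_TV_comp t (hy x hx).2 (hy x hx).1.2.ne') hz hw

lemma KV_const {t : ℝ} {y : ℝ → Fin 8 → ℝ} {I : Set ℝ} (hI : IsOpen I)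
    (hc : IsPreconnected I) (hy : ∀ z ∈ I, y z ∈ admissible ∧ HasDerivAt y (field t (y z)) z)
    {z w : ℝ} (hz : z ∈ I) (hw : w ∈ I) : KV (y z) = KV (y w) :=
  eq_of_hasDerivAt_zero (f := fun x => KV (y x)) hI hc (fun x hx => by
    have d := hasDerivAt_pi.1 (hy x hx).2
    obtain ⟨h0, h4⟩ := (hy x hx).1
    have h4 := h4.ne'
    refine (((d 4).mul (d 0)).mul (d 7)).congr_deriv ?_
    simp [field, s2V]
    field_simp
    ring) hz hw

/-- The initial conditions with positive `F` and `C`. -/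
def positiveData : Set (Fin 8 → ℝ) := {p | 0 < p 0 ∧ 0 < p 4}

lemma positiveData_subset : positiveData ⊆ admissible := fun _ hp => ⟨hp.1.ne', hp.2⟩

lemma isOpen_positiveData : IsOpen positiveData :=
  (isOpen_lt continuous_const (continuous_apply 0)).inter
    (isOpen_lt continuous_const (continuous_apply 4))

/-! ## The reduced system and `B^t`-flat metrics -/

section equivalence

variable {t : ℝ} {F C s : ℝ → ℝ} {I : Set ℝ}

/-- The second reduced equation is the formula for the scalar curvature under a conformal change, so
it holds exactly when `s` is the scalar curvature. -/
lemma F1V_eq_scal (hm : IsMetricOn F C I) {z : ℝ} (hz : z ∈ I) :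
    F1V (cauchyData F C s z) (deriv (deriv C) z) = C z ^ 2 * (s z - scal F C z) := by
  have h0 := (hm.2.2.2 z hz).2.ne'
  have e : deriv C z = hlog C z * C z := by rw [hlog]; field_simp
  rw [deriv_hlog hm hz, scal_eq hm hz]
  simp only [F1V, cauchyData, Matrix.cons_val, e, scalV]
  field_simp
  ring

lemma cauchyData_congr {s' : ℝ → ℝ} (hI : IsOpen I) (h : EqOn s s' I) {z : ℝ} (hz : z ∈ I) :
    cauchyData F C s z = cauchyData F C s' z ∧ deriv (deriv s) z = deriv (deriv s') z := by
  have h1 : ∀ x ∈ I, deriv s x = deriv s' x := fun x hx => deriv_congr_of_eqOn hI h hx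
  exact ⟨by rw [cauchyData, cauchyData, h hz, h1 z hz], deriv_congr_of_eqOn hI h1 hz⟩

lemma contDiffOn_scal (hm : IsMetricOn F C I) : ContDiffOn ℝ ∞ (scal F C) I := by
  have h1 := contDiffOn_deriv hm.1 hm.2.1
  have h2 := contDiffOn_deriv hm.1 h1
  have h3 := contDiffOn_hlog hm
  have h4 := contDiffOn_deriv hm.1 h3
  have h0 := hm.2.1
  refine ContDiffOn.congr ?_ fun z hz => scal_eq hm hz
  refine ContDiffOn.div ?_ hm.2.2.1 fun z hz => (hm.2.2.2 z hz).2.ne'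
  unfold scalV
  fun_prop

lemma isBtFlat_of_solves (h : SolvesReduced t F C s I) (hF : ∀ z ∈ I, 0 < F z)
    (hT : ∀ z ∈ I, TV t (cauchyData F C s z) = 0) :
    IsBtFlat t F C I ∧ EqOn s (scal F C) I := by
  obtain ⟨hI, hFs, hCs, hss, h0, he⟩ := h
  have hm : IsMetricOn F C I := ⟨hI, hFs, hCs, fun z hz => ⟨hF z hz, (h0 z hz).2⟩⟩
  have hs : EqOn s (scal F C) I := by
    intro z hz
    have hn := hI.mem_nhds hz
    have e := F1V_eq_scal (s := s) hm hz
    rw [← opF1_eq (hFs.contDiffAt hn) (hCs.contDiffAt hn) (h0 z hz).2, (he z hz).2.1, mul_zero,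
      eq_comm, mul_eq_zero_iff_left (pow_ne_zero 2 (h0 z hz).2.ne')] at e
    exact sub_eq_zero.1 e
  refine ⟨⟨hm, fun z hz i j => ?_⟩, hs⟩
  have hn := hI.mem_nhds hz
  obtain ⟨e1, e2⟩ := cauchyData_congr (F := F) (C := C) hI hs hz
  obtain ⟨e3, -, e4⟩ := he z hz
  rw [opE_eq (hFs.contDiffAt hn) (hCs.contDiffAt hn) (hss.contDiffAt hn)] at e3
  rw [opF2_eq t (hFs.contDiffAt hn) (hCs.contDiffAt hn) (h0 z hz).2] at e4
  rw [btTensor_eq t hm hz, metricData, ← e1, ← e2]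
  split_ifs
  · fin_cases i <;> simp [btV, e3, e4, hT z hz]
  · rfl

/-- The entries of `btV` at 0, 1, 2 are independent linear combinations of `T`, `t E` and `F F₂`, so
all three vanish. The condition `t ≠ 0` is what allows `E = 0` to be deduced from `t E = 0`. -/
lemma solves_of_isBtFlat (ht : t ≠ 0) (h : IsBtFlat t F C I) (hs : EqOn s (scal F C) I) :
    SolvesReduced t F C s I ∧ ∀ z ∈ I, TV t (cauchyData F C s z) = 0 := by
  obtain ⟨hm, hb⟩ := h
  have hss : ContDiffOn ℝ ∞ s I := (contDiffOn_scal hm).congr hs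
  have key : ∀ z ∈ I, TV t (cauchyData F C s z) = 0 ∧
      EV (cauchyData F C s z) (deriv (deriv s) z) = 0 ∧ F2V t (cauchyData F C s z)
        (deriv (deriv (deriv (deriv F))) z) (deriv (deriv C) z) = 0 := by
    intro z hz
    obtain ⟨e1, e2⟩ := cauchyData_congr (F := F) (C := C) hm.1 hs hz
    have hF := (hm.2.2.2 z hz).1
    have hC := (hm.2.2.2 z hz).2
    have b : ∀ i, btV t (cauchyData F C s z) (deriv (deriv (deriv (deriv F))) z)
        (deriv (deriv C) z) (deriv (deriv s) z) i = 0 := by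
      intro i
      have := hb z hz i i
      rw [btTensor_eq t hm hz, if_pos rfl, metricData, ← e1, ← e2] at this
      have hg := gDiag_pos hm hz i
      exact (mul_eq_zero_iff_left (by positivity)).1 this
    have b0 := b 0
    have b1 := b 1
    have b2 := b 2
    simp only [btV, Matrix.cons_val] at b0 b1 b2
    have hT : TV t (cauchyData F C s z) = 0 := by linarith
    rw [hT] at b1 b2
    have hE : t * EV (cauchyData F C s z) (deriv (deriv s) z) = 0 := by linarith
    have hF2 : cauchyData F C s z 0 * F2V t (cauchyData F C s z)
        (deriv (deriv (deriv (deriv F))) z) (deriv (deriv C) z) = 0 := by linarith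
    exact ⟨hT, (mul_eq_zero_iff_left ht).1 hE, (mul_eq_zero_iff_left hF.ne').1 hF2⟩
  refine ⟨⟨hm.1, hm.2.1, hm.2.2.1, hss, fun z hz => ⟨(hm.2.2.2 z hz).1.ne', (hm.2.2.2 z hz).2⟩,
    fun z hz => ?_⟩, fun z hz => (key z hz).1⟩
  have hn := hm.1.mem_nhds hz
  have hC := (hm.2.2.2 z hz).2
  obtain ⟨-, hE, hF2⟩ := key z hz
  refine ⟨by rwa [opE_eq (hm.2.1.contDiffAt hn) (hm.2.2.1.contDiffAt hn) (hss.contDiffAt hn)],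
    ?_, by rwa [opF2_eq t (hm.2.1.contDiffAt hn) (hm.2.2.1.contDiffAt hn) hC]⟩
  rw [← mul_eq_zero_iff_left (Real.sqrt_pos.2 hC).ne', opF1_eq (hm.2.1.contDiffAt hn)
    (hm.2.2.1.contDiffAt hn) hC, F1V_eq_scal hm hz, hs hz, sub_self, mul_zero]

theorem solvesReduced_iff_isBtFlat (ht : t ≠ 0) (hF : ∀ z ∈ I, 0 < F z) :
    (SolvesReduced t F C s I ∧ ∀ z ∈ I, opT t F C s z = 0) ↔
      (IsBtFlat t F C I ∧ EqOn s (scal F C) I) := by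
  constructor
  · rintro ⟨h, hT⟩
    refine isBtFlat_of_solves h hF fun z hz => ?_
    rw [← opT_eq t (h.2.1.contDiffAt (h.1.mem_nhds hz)), hT z hz]
  · rintro ⟨h, hs⟩
    obtain ⟨h1, h2⟩ := solves_of_isBtFlat ht h hs
    refine ⟨h1, fun z hz => ?_⟩
    rw [opT_eq t (h1.2.1.contDiffAt (h1.1.mem_nhds hz)), h2 z hz]

/-- The curve of initial conditions of a `B^t`-flat metric. -/
lemma isBtFlat_curve (ht : t ≠ 0) (h : IsBtFlat t F C I) {z : ℝ} (hz : z ∈ I) :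
    metricData F C z ∈ positiveData ∧ TV t (metricData F C z) = 0 ∧
      HasDerivAt (metricData F C) (field t (metricData F C z)) z := by
  obtain ⟨h1, h2⟩ := solves_of_isBtFlat ht h (eqOn_refl (scal F C) I)
  exact ⟨h.1.2.2.2 z hz, h2 z hz, hasDerivAt_cauchyData h1 hz⟩

/-- An integral curve in the zero set of the conserved quantity defines a `B^t`-flat metric. -/
lemma isBtFlat_of_integralCurve {y : ℝ → Fin 8 → ℝ} (hI : IsOpen I)
    (hy : ∀ z ∈ I, y z ∈ positiveData ∧ HasDerivAt y (field t (y z)) z)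
    (hT : ∀ z ∈ I, TV t (y z) = 0) :
    IsBtFlat t (fun z => y z 0) (fun z => y z 4) I ∧
      ∀ z ∈ I, metricData (fun z => y z 0) (fun z => y z 4) z = y z := by
  obtain ⟨h1, h2⟩ := solves_of_integralCurve hI
    fun z hz => ⟨positiveData_subset (hy z hz).1, (hy z hz).2⟩
  obtain ⟨h3, h4⟩ := isBtFlat_of_solves h1 (fun z hz => (hy z hz).1.1)
    fun z hz => by rw [h2 z hz, hT z hz]
  refine ⟨h3, fun z hz => ?_⟩
  rw [metricData, ← (cauchyData_congr hI h4 hz).1, h2 z hz]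

end equivalence

/-! ## The sets of initial conditions -/

/-- Conservation of `T` propagates its vanishing from `z₀` to the whole interval, so a single
equation on the initial conditions is enough. -/
lemma reducedDataSet_eq (t z₀ : ℝ) : reducedDataSet t z₀ = {p ∈ admissible | TV t p = 0} := by
  ext p
  constructor
  · rintro ⟨ε, hε, F, C, s, h, hT, rfl⟩
    have hz : z₀ ∈ Ioo (z₀ - ε) (z₀ + ε) := by constructor <;> linarith
    refine ⟨cauchyData_mem h hz, ?_⟩
    rw [← opT_eq t (h.2.1.contDiffAt (h.1.mem_nhds hz)), hT z₀ hz]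
  · rintro ⟨hp, hT⟩
    obtain ⟨ε, hε, y, rfl, hy⟩ := exists_integralCurve t z₀ isOpen_admissible subset_rfl hp
    have hz : z₀ ∈ Ioo (z₀ - ε) (z₀ + ε) := by constructor <;> linarith
    obtain ⟨h1, h2⟩ := solves_of_integralCurve isOpen_Ioo hy
    refine ⟨ε, hε, _, _, _, h1, fun z hz' => ?_, h2 z₀ hz⟩
    rw [opT_eq t (h1.2.1.contDiffAt (h1.1.mem_nhds hz')), h2 z hz',
      TV_const isOpen_Ioo isPreconnected_Ioo hy hz' hz, hT]

lemma exists_positive_curve (t z₀ : ℝ) {p : Fin 8 → ℝ} (hp : p ∈ positiveData) :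
    ∃ ε > 0, ∃ y : ℝ → Fin 8 → ℝ, y z₀ = p ∧
      ∀ z ∈ Ioo (z₀ - ε) (z₀ + ε), y z ∈ positiveData ∧ HasDerivAt y (field t (y z)) z :=
  exists_integralCurve t z₀ isOpen_positiveData positiveData_subset hp

lemma dataSet_isBtFlat {t : ℝ} (ht : t ≠ 0) (z₀ : ℝ) :
    dataSet (IsBtFlat t) z₀ = {p ∈ positiveData | TV t p = 0} := by
  ext p
  constructor
  · rintro ⟨ε, hε, F, C, h, rfl⟩
    obtain ⟨h1, h2, -⟩ := isBtFlat_curve ht h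
      (show z₀ ∈ Ioo (z₀ - ε) (z₀ + ε) by constructor <;> linarith)
    exact ⟨h1, h2⟩
  · rintro ⟨hp, hT⟩
    obtain ⟨ε, hε, y, rfl, hy⟩ := exists_positive_curve t z₀ hp
    have hz : z₀ ∈ Ioo (z₀ - ε) (z₀ + ε) := by constructor <;> linarith
    obtain ⟨h1, h2⟩ := isBtFlat_of_integralCurve isOpen_Ioo hy fun z hz' => by
      rw [TV_const isOpen_Ioo isPreconnected_Ioo
        (fun x hx => ⟨positiveData_subset (hy x hx).1, (hy x hx).2⟩) hz' hz, hT]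
    exact ⟨ε, hε, _, _, h1, h2 z₀ hz⟩

lemma isCSCBtFlat_curve {t : ℝ} {F C : ℝ → ℝ} {I : Set ℝ} (h : IsCSCBtFlat t F C I) {z : ℝ}
    (hz : z ∈ I) : metricData F C z 7 = 0 := by
  obtain ⟨c, hc⟩ := h.2
  exact (deriv_congr_of_eqOn (f' := fun _ => c) h.1.1.1 hc hz).trans (deriv_const z c)

lemma isCSCBtFlat_of_integralCurve {t : ℝ} {y : ℝ → Fin 8 → ℝ} {I : Set ℝ} (hI : IsOpen I)
    (hc : IsPreconnected I)
    (hy : ∀ z ∈ I, y z ∈ positiveData ∧ HasDerivAt y (field t (y z)) z)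
    (hT : ∀ z ∈ I, TV t (y z) = 0) (hK : ∀ z ∈ I, KV (y z) = 0) :
    IsCSCBtFlat t (fun z => y z 0) (fun z => y z 4) I ∧
      ∀ z ∈ I, metricData (fun z => y z 0) (fun z => y z 4) z = y z := by
  obtain ⟨h1, h2⟩ := isBtFlat_of_integralCurve hI hy hT
  refine ⟨⟨h1, ?_⟩, h2⟩
  rcases I.eq_empty_or_nonempty with rfl | ⟨w, hw⟩
  · exact ⟨0, by simp⟩
  refine ⟨y w 6, fun z hz => ?_⟩
  have e : scal (fun z => y z 0) (fun z => y z 4) z = y z 6 := congrFun (h2 z hz) 6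
  rw [e]
  refine eq_of_hasDerivAt_zero (f := fun z => y z 6) hI hc (fun x hx => ?_) hz hw
  have d := hasDerivAt_pi.1 (hy x hx).2 6
  have h7 : y x 7 = 0 :=
    (mul_eq_zero_iff_left (mul_pos (hy x hx).1.2 (hy x hx).1.1).ne').1 (hK x hx)
  exact d.congr_deriv h7

/-- Since `C F s'` is conserved and `C F > 0`, the vanishing of `s'` at `z₀` makes `s` constant. -/
lemma dataSet_isCSCBtFlat {t : ℝ} (ht : t ≠ 0) (z₀ : ℝ) :
    dataSet (IsCSCBtFlat t) z₀ = {p ∈ positiveData | TV t p = 0 ∧ KV p = 0} := by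
  ext p
  constructor
  · rintro ⟨ε, hε, F, C, h, rfl⟩
    have hz : z₀ ∈ Ioo (z₀ - ε) (z₀ + ε) := by constructor <;> linarith
    obtain ⟨h1, h2, -⟩ := isBtFlat_curve ht h.1 hz
    exact ⟨h1, h2, by rw [KV, isCSCBtFlat_curve h hz, mul_zero]⟩
  · rintro ⟨hp, hT, hK⟩
    obtain ⟨ε, hε, y, rfl, hy⟩ := exists_positive_curve t z₀ hp
    have hz : z₀ ∈ Ioo (z₀ - ε) (z₀ + ε) := by constructor <;> linarith
    have hy' : ∀ x ∈ Ioo (z₀ - ε) (z₀ + ε), y x ∈ admissible ∧ HasDerivAt y (field t (y x)) x :=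
      fun x hx => ⟨positiveData_subset (hy x hx).1, (hy x hx).2⟩
    obtain ⟨h1, h2⟩ := isCSCBtFlat_of_integralCurve isOpen_Ioo isPreconnected_Ioo hy
      (fun z hz' => by rw [TV_const isOpen_Ioo isPreconnected_Ioo hy' hz' hz, hT])
      (fun z hz' => by rw [KV_const isOpen_Ioo isPreconnected_Ioo hy' hz' hz, hK])
    exact ⟨ε, hε, _, _, h1, h2 z₀ hz⟩

/-! ## Charts adapted to a submersion, and flows -/

section analysis

open Module

variable {E : Type*} [NormedAddCommGroup E] [NormedSpace ℝ E]

/-- A linear map from `ℝᵏ` whose range is complementary to two independent vectors. -/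
lemma exists_transversal [FiniteDimensional ℝ E] {k : ℕ} (hk : finrank ℝ E = k + 2) (x y : E)
    (hxy : ∀ a b : ℝ, a • x + b • y = 0 → a = 0 ∧ b = 0) :
    ∃ ι : (Fin k → ℝ) →L[ℝ] E, ∀ u (a b : ℝ), ι u + a • x + b • y = 0 → u = 0 ∧ a = 0 ∧ b = 0 := by
  have hl : LinearIndependent ℝ ![x, y] := LinearIndependent.pair_iff.2 hxy
  obtain ⟨K, hK⟩ := Submodule.exists_isCompl (Submodule.span ℝ (range ![x, y]))
  have h2 : finrank ℝ (Submodule.span ℝ (range ![x, y])) = 2 := by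
    rw [finrank_span_eq_card hl]; simp
  have h3 : finrank ℝ K = k := by
    have := Submodule.finrank_add_eq_of_isCompl hK
    omega
  have e : (Fin k → ℝ) ≃ₗ[ℝ] K := LinearEquiv.ofFinrankEq _ _ (by simp [h3])
  refine ⟨LinearMap.toContinuousLinearMap (K.subtype ∘ₗ e.toLinearMap), fun u a b h => ?_⟩
  have h' : ((e u : K) : E) + (a • x + b • y) = 0 := by
    rw [← add_assoc]; exact h
  have hmem : a • x + b • y ∈ Submodule.span ℝ (range ![x, y]) := by
    refine add_mem (Submodule.smul_mem _ _ ?_) (Submodule.smul_mem _ _ ?_)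
    · exact Submodule.subset_span ⟨0, rfl⟩
    · exact Submodule.subset_span ⟨1, rfl⟩
  have hneg : ((e u : K) : E) = -(a • x + b • y) := eq_neg_of_add_eq_zero_left h'
  have h0 : ((e u : K) : E) = 0 :=
    Submodule.disjoint_def.1 hK.disjoint.symm _ (e u).2 (hneg ▸ neg_mem hmem)
  have hu : e u = 0 := Subtype.ext h0
  rw [h0, zero_add] at h'
  exact ⟨by simpa using hu, hxy a b h'⟩

lemma exists_continuousLinearEquiv_of_injective {G : Type*} [NormedAddCommGroup G]
    [NormedSpace ℝ G] [FiniteDimensional ℝ E] [FiniteDimensional ℝ G]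
    (hd : finrank ℝ E = finrank ℝ G) (M : E →L[ℝ] G) (hM : Function.Injective M) :
    ∃ e : E ≃L[ℝ] G, (e : E →L[ℝ] G) = M :=
  ⟨(LinearEquiv.ofInjectiveOfFinrankEq (M : E →ₗ[ℝ] G) hM hd).toContinuousLinearEquiv, by
    ext x; rfl⟩

/-- Near a point where a smooth map `Q` is a submersion there is a smooth chart whose second
component is `Q`. -/
theorem exists_chart [FiniteDimensional ℝ E] {d e : ℕ} (hde : finrank ℝ E = d + e)
    {Q : E → Fin e → ℝ} {U : Set E} (hU : IsOpen U) (hQ : ContDiffOn ℝ ∞ Q U) {p : E}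
    (hp : p ∈ U) (hs : Function.Surjective (fderiv ℝ Q p)) :
    ∃ φ : OpenPartialHomeomorph E ((Fin d → ℝ) × (Fin e → ℝ)), p ∈ φ.source ∧ φ.source ⊆ U ∧
      ContDiffOn ℝ ∞ φ φ.source ∧ ContDiffOn ℝ ∞ φ.symm φ.target ∧
      ∀ q ∈ φ.source, (φ q).2 = Q q := by
  have : CompleteSpace E := FiniteDimensional.complete ℝ E
  set N := LinearMap.ker (fderiv ℝ Q p : E →ₗ[ℝ] Fin e → ℝ) with hN
  have hker : finrank ℝ N = d := by
    have h1 := LinearMap.finrank_range_add_finrank_ker (fderiv ℝ Q p : E →ₗ[ℝ] Fin e → ℝ)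
    rw [LinearMap.range_eq_top.2 hs, finrank_top, hde] at h1
    simp only [finrank_fintype_fun_eq_card, Fintype.card_fin] at h1
    change e + finrank ℝ N = d + e at h1
    omega
  -- A projection onto the kernel of `dQ` supplies the missing `d` coordinates: combined with `dQ`
  -- it is injective between spaces of equal dimension.
  obtain ⟨π, hπ⟩ := N.subtype.exists_leftInverse_of_injective (by simp)
  have κ : N ≃ₗ[ℝ] (Fin d → ℝ) := LinearEquiv.ofFinrankEq _ _ (by simp [hker])
  set A : E →L[ℝ] (Fin d → ℝ) := LinearMap.toContinuousLinearMap (κ.toLinearMap ∘ₗ π) with hA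
  have hinj : Function.Injective (A.prod (fderiv ℝ Q p)) := by
    rw [injective_iff_map_eq_zero]
    intro v hv
    have h1 : κ (π v) = 0 := congrArg Prod.fst hv
    have h2 : v ∈ N := congrArg Prod.snd hv
    have h3 : π v = ⟨v, h2⟩ := LinearMap.congr_fun hπ ⟨v, h2⟩
    rw [h3] at h1
    simpa using h1
  have hfin : finrank ℝ E = finrank ℝ ((Fin d → ℝ) × (Fin e → ℝ)) := by simp [hde]
  obtain ⟨M, hM⟩ := exists_continuousLinearEquiv_of_injective hfin _ hinj
  set f : E → (Fin d → ℝ) × (Fin e → ℝ) := fun q => (A q, Q q) with hf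
  have hfs : ContDiffOn ℝ ∞ f U := A.contDiff.contDiffOn.prodMk hQ
  have hfp : HasFDerivAt f (M : E →L[ℝ] _) p := by
    rw [hM]
    exact A.hasFDerivAt.prodMk
      ((hQ.contDiffAt (hU.mem_nhds hp)).differentiableAt (by simp)).hasFDerivAt
  set R := (hfs.contDiffAt (hU.mem_nhds hp)).toOpenPartialHomeomorph f hfp (by simp) with hR
  -- The inverse function theorem gives smoothness of the inverse only at the image of `p`.
  -- Restricting to the open set where the derivative stays invertible makes the inverse smooth on
  -- the whole target.
  set G : Set E := U ∩ fderiv ℝ f ⁻¹' range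
    ((↑) : (E ≃L[ℝ] (Fin d → ℝ) × (Fin e → ℝ)) → E →L[ℝ] (Fin d → ℝ) × (Fin e → ℝ)) with hG
  have hGo : IsOpen G :=
    (hfs.continuousOn_fderiv_of_isOpen hU (by simp)).isOpen_inter_preimage hU
      ContinuousLinearEquiv.isOpen
  have hpG : p ∈ G := ⟨hp, by rw [mem_preimage, hfp.fderiv]; exact mem_range_self M⟩
  refine ⟨R.restrOpen G hGo, ?_, ?_, ?_, ?_, ?_⟩
  · rw [OpenPartialHomeomorph.restrOpen_source]
    exact ⟨ContDiffAt.mem_toOpenPartialHomeomorph_source _ hfp _, hpG⟩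
  · rw [OpenPartialHomeomorph.restrOpen_source]
    exact fun q hq => hq.2.1
  · rw [OpenPartialHomeomorph.restrOpen_source]
    exact hfs.mono fun q hq => hq.2.1
  · intro x hx
    have hx' := (R.restrOpen G hGo).map_target hx
    rw [OpenPartialHomeomorph.restrOpen_source] at hx'
    obtain ⟨hq1, hq2, M', hM'⟩ := hx'
    have hq2' := hfs.contDiffAt (hU.mem_nhds hq2)
    refine (OpenPartialHomeomorph.contDiffAt_symm (f₀' := M') (R.restrOpen G hGo) hx ?_
      hq2').contDiffWithinAt
    have := (hq2'.differentiableAt (by simp)).hasFDerivAt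
    rw [hM']
    exact this
  · intro q hq
    rfl

open Metric in
/-- A `C¹` vector field has a local flow, which is strictly differentiable at the base point. -/
theorem exists_flow [CompleteSpace E] {f : E → E} {p : E} (hf : ContDiffAt ℝ 1 f p) :
    ∃ α : E × ℝ → E, HasStrictFDerivAt α (ContinuousLinearMap.fst ℝ E ℝ
        + (ContinuousLinearMap.snd ℝ E ℝ).smulRight (f p)) (p, 0) ∧
      ∃ r > 0, ∃ ε > 0, ∀ x ∈ ball p r, α (x, 0) = x ∧
        ∀ s ∈ Ioo (-ε) ε, HasDerivAt (fun s => α (x, s)) (f (α (x, s))) s := by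
  -- Picard-Lindelöf in the form that also gives Lipschitz dependence on the initial point, with a
  -- constant `L'` uniform in time.
  obtain ⟨ε, hε, a, r, L, K', hr, hpl⟩ := IsPicardLindelof.of_contDiffAt_one hf
  obtain ⟨α, hα, L', hL'⟩ :=
    (hpl 0).exists_forall_mem_closedBall_eq_hasDerivWithinAt_lipschitzOnWith
  simp only [zero_sub, zero_add] at hα hL'
  have hr' : (0 : ℝ) < r := hr
  have hd : ∀ x ∈ ball p r, ∀ s ∈ Ioo (-ε) ε, HasDerivAt (α x) (f (α x s)) s := fun x hx s hs =>
    ((hα x (ball_subset_closedBall hx)).2 s (Ioo_subset_Icc_self hs)).hasDerivAt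
      (Icc_mem_nhds hs.1 hs.2)
  have h0 : ∀ x ∈ ball p r, α x 0 = x := fun x hx => (hα x (ball_subset_closedBall hx)).1
  have hpr : p ∈ ball p r := mem_ball_self hr'
  -- Joint continuity at `(p, 0)`: Lipschitz dependence in space plus continuity in time of the one
  -- curve through `p`.
  have hcont : Filter.Tendsto (Function.uncurry α) (nhds (p, 0)) (nhds p) := by
    have hb : ∀ᶠ q : E × ℝ in nhds (p, 0), ‖α q.1 q.2 - p‖ ≤ L' * ‖q.1 - p‖ + ‖α p q.2 - p‖ := by
      have : ball p r ×ˢ Ioo (-ε) ε ∈ nhds (p, (0 : ℝ)) :=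
        prod_mem_nhds (ball_mem_nhds p hr') (Ioo_mem_nhds (by linarith) hε)
      filter_upwards [this] with q hq
      have := (hL' q.2 (Ioo_subset_Icc_self hq.2)).norm_sub_le (ball_subset_closedBall hq.1)
        (ball_subset_closedBall hpr)
      calc ‖α q.1 q.2 - p‖ = ‖(α q.1 q.2 - α p q.2) + (α p q.2 - p)‖ := by congr 1; abel
        _ ≤ _ := (norm_add_le _ _).trans (by gcongr)
    have hc : ContinuousAt (α p) 0 := (hd p hpr 0 ⟨by linarith, hε⟩).continuousAt
    have h1 : Filter.Tendsto (fun q : E × ℝ => L' * ‖q.1 - p‖ + ‖α p q.2 - p‖) (nhds (p, 0))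
        (nhds 0) := by
      have e1 : ContinuousAt (fun q : E × ℝ => L' * ‖q.1 - p‖ + ‖α p q.2 - p‖) (p, 0) := by
        have : ContinuousAt (fun q : E × ℝ => α p q.2) (p, 0) :=
          ContinuousAt.comp (f := Prod.snd) hc continuousAt_snd
        fun_prop
      have := e1.tendsto
      simpa [h0 p hpr] using this
    rw [tendsto_iff_norm_sub_tendsto_zero]
    exact squeeze_zero' (Filter.Eventually.of_forall fun _ => norm_nonneg _) hb h1
  refine ⟨Function.uncurry α, ?_, r, hr', ε, hε, fun x hx => ⟨h0 x hx, hd x hx⟩⟩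
  obtain ⟨K, U, hU, hK⟩ := hf.exists_lipschitzOnWith
  refine HasStrictFDerivAt.of_isLittleO (Asymptotics.isLittleO_iff.2 fun c hc => ?_)
  have hB : U ∩ {x | ‖f x - f p‖ < c / 2} ∈ nhds p := by
    refine Filter.inter_mem hU ?_
    have : ContinuousAt (fun x => ‖f x - f p‖) p := (hf.continuousAt.sub continuousAt_const).norm
    exact this.eventually_lt_const (by simpa using half_pos hc)
  have hN := Filter.inter_mem (Filter.mem_map.1 (hcont hB)) (prod_mem_nhds (ball_mem_nhds p hr')
    (Ioo_mem_nhds (show -ε < 0 by linarith) hε))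
  obtain ⟨δ, hδ, hball⟩ := Metric.mem_nhds_iff.1 hN
  -- For the given tolerance `c`, a time range of length `η` makes the spatial error `K L' η` at
  -- most `c / 2`.
  obtain ⟨η, hη, hηδ, hηc⟩ : ∃ η > 0, η ≤ δ ∧ K * L' * η ≤ c / 2 := by
    refine ⟨min δ (c / 2 / (K * L' + 1)), by positivity, min_le_left _ _, ?_⟩
    calc (K * L' : ℝ) * min δ (c / 2 / (K * L' + 1))
        ≤ (K * L' + 1) * (c / 2 / (K * L' + 1)) := by
          gcongr
          · linarith
          · exact min_le_right _ _
      _ = c / 2 := by field_simp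
  have key : ∀ x ∈ ball p η, ∀ s ∈ ball (0 : ℝ) η, (α x s ∈ U ∧ ‖f (α x s) - f p‖ < c / 2) ∧
      x ∈ ball p r ∧ s ∈ Ioo (-ε) ε := by
    intro x hx s hs
    have : (x, s) ∈ ball (p, (0 : ℝ)) δ := by
      rw [← ball_prod_same]
      exact ⟨ball_subset_ball hηδ hx, ball_subset_ball hηδ hs⟩
    exact ⟨(hball this).1, (hball this).2⟩
  have hmem : ball (p, (0 : ℝ)) η ×ˢ ball (p, (0 : ℝ)) η ∈ nhds ((p, (0 : ℝ)), (p, (0 : ℝ))) :=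
    prod_mem_nhds (ball_mem_nhds _ hη) (ball_mem_nhds _ hη)
  filter_upwards [hmem] with q hq
  obtain ⟨⟨x, s⟩, ⟨x', s'⟩⟩ := q
  rw [← ball_prod_same] at hq
  obtain ⟨⟨hx, hs⟩, ⟨hx', hs'⟩⟩ := hq
  simp only at hx hs hx' hs'
  -- Variation in time: the velocity of the flow differs from `f p` by less than `c / 2`.
  have t1 : ‖(α x s - s • f p) - (α x s' - s' • f p)‖ ≤ c / 2 * ‖s - s'‖ := by
    refine (convex_ball (0 : ℝ) η).norm_image_sub_le_of_norm_hasDerivWithin_le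
      (f := fun s => α x s - s • f p) (f' := fun s => f (α x s) - f p) (fun y hy => ?_)
      (fun y hy => (key x hx y hy).1.2.le) hs' hs
    have := ((hd x (key x hx y hy).2.1 y (key x hx y hy).2.2).sub
      ((hasDerivAt_id y).smul_const (f p))).hasDerivWithinAt (s := ball 0 η)
    rw [one_smul] at this
    exact this
  -- Variation in space: the difference of two trajectories has velocity at most `K L' ‖x - x'‖`,
  -- acting for a time at most `η`.
  have t2 : ‖(α x s' - α x' s') - (α x 0 - α x' 0)‖ ≤ K * L' * ‖x - x'‖ * ‖s' - 0‖ := by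
    refine (convex_ball (0 : ℝ) η).norm_image_sub_le_of_norm_hasDerivWithin_le
      (f := fun s => α x s - α x' s) (f' := fun s => f (α x s) - f (α x' s)) (fun y hy => ?_)
      (fun y hy => ?_) (mem_ball_self hη) hs'
    · exact ((hd x (key x hx y hy).2.1 y (key x hx y hy).2.2).sub
        (hd x' (key x' hx' y hy).2.1 y (key x' hx' y hy).2.2)).hasDerivWithinAt
    · calc ‖f (α x y) - f (α x' y)‖ ≤ K * ‖α x y - α x' y‖ :=
            hK.norm_sub_le (key x hx y hy).1.1 (key x' hx' y hy).1.1
        _ ≤ K * (L' * ‖x - x'‖) := by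
            gcongr
            exact (hL' y (Ioo_subset_Icc_self (key x hx y hy).2.2)).norm_sub_le
              (ball_subset_closedBall (key x hx y hy).2.1)
              (ball_subset_closedBall (key x' hx' y hy).2.1)
        _ = K * L' * ‖x - x'‖ := by ring
  rw [h0 x (key x hx s hs).2.1, h0 x' (key x' hx' s hs).2.1] at t2
  have hs'' : ‖s' - 0‖ ≤ η := by simpa using (mem_ball.1 hs').le
  have t3 : K * L' * ‖x - x'‖ * ‖s' - 0‖ ≤ c / 2 * ‖x - x'‖ := by
    calc K * L' * ‖x - x'‖ * ‖s' - 0‖ ≤ K * L' * ‖x - x'‖ * η := by gcongr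
      _ = K * L' * η * ‖x - x'‖ := by ring
      _ ≤ _ := by gcongr
  have m1 : ‖x - x'‖ ≤ ‖((x, s) : E × ℝ) - (x', s')‖ := norm_fst_le (((x, s) : E × ℝ) - (x', s'))
  have m2 : ‖s - s'‖ ≤ ‖((x, s) : E × ℝ) - (x', s')‖ := norm_snd_le (((x, s) : E × ℝ) - (x', s'))
  calc _ = ‖((α x s - s • f p) - (α x s' - s' • f p)) + ((α x s' - α x' s') - (x - x'))‖ := by
        simp only [Function.uncurry, add_apply, ContinuousLinearMap.coe_fst',
          ContinuousLinearMap.smulRight_apply, ContinuousLinearMap.coe_snd', Prod.fst_sub,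
          Prod.snd_sub]
        congr 1
        module
    _ ≤ c / 2 * ‖s - s'‖ + c / 2 * ‖x - x'‖ :=
        (norm_add_le _ _).trans (add_le_add t1 (t2.trans t3))
    _ ≤ c / 2 * ‖((x, s) : E × ℝ) - (x', s')‖ + c / 2 * ‖((x, s) : E × ℝ) - (x', s')‖ := by gcongr
    _ = _ := by ring

end analysis

/-! ## Homotheties -/

/-- The action of multiplication of the metric by `e^b` on the initial conditions. -/
def scl (b : ℝ) (p : Fin 8 → ℝ) : Fin 8 → ℝ :=
  ![p 0, p 1, p 2, p 3, Real.exp b * p 4, Real.exp b * p 5, Real.exp (-b) * p 6,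
    Real.exp (-b) * p 7]

/-- The generator of the action by multiplication. -/
def sclGen (p : Fin 8 → ℝ) : Fin 8 → ℝ := ![0, 0, 0, 0, p 4, p 5, -p 6, -p 7]

lemma scl_zero (p : Fin 8 → ℝ) : scl 0 p = p := by
  ext i
  fin_cases i <;> simp [scl]

lemma contDiff_scl : ContDiff ℝ ∞ fun x : ℝ × (Fin 8 → ℝ) => scl x.1 x.2 := by
  have e : ∀ i : Fin 8, ContDiff ℝ ∞ fun x : ℝ × (Fin 8 → ℝ) => x.2 i := fun i => by fun_prop
  have e1 : ContDiff ℝ ∞ fun x : ℝ × (Fin 8 → ℝ) => Real.exp x.1 := by fun_prop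
  have e2 : ContDiff ℝ ∞ fun x : ℝ × (Fin 8 → ℝ) => Real.exp (-x.1) := by fun_prop
  refine contDiff_pi.2 fun i => ?_
  fin_cases i
  exacts [e 0, e 1, e 2, e 3, e1.mul (e 4), e1.mul (e 5), e2.mul (e 6), e2.mul (e 7)]

lemma hasDerivAt_scl (b : ℝ) (p : Fin 8 → ℝ) :
    HasDerivAt (fun b => scl b p) (sclGen (scl b p)) b := by
  have e1 := Real.hasDerivAt_exp b
  have e2 := (hasDerivAt_neg b).exp
  have c := fun i => hasDerivAt_const b (p i)
  refine hasDerivAt_pi.2 fun i => ?_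
  fin_cases i
  · exact c 0
  · exact c 1
  · exact c 2
  · exact c 3
  · exact e1.mul_const (p 4)
  · exact e1.mul_const (p 5)
  · exact (e2.mul_const (p 6)).congr_deriv (by simp [sclGen, scl])
  · exact (e2.mul_const (p 7)).congr_deriv (by simp [sclGen, scl])

lemma hasStrictFDerivAt_scl (p : Fin 8 → ℝ) :
    HasStrictFDerivAt (fun x : ℝ × (Fin 8 → ℝ) => scl x.1 x.2)
      ((ContinuousLinearMap.fst ℝ ℝ (Fin 8 → ℝ)).smulRight (sclGen p)
        + ContinuousLinearMap.snd ℝ ℝ (Fin 8 → ℝ)) (0, p) := by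
  have h := contDiff_scl.contDiffAt.hasStrictFDerivAt (x := ((0 : ℝ), p)) (by simp)
  convert! h using 1
  -- The derivative is compared on the two factors: in `b` it is the generator, and in `p` it is the
  -- identity because `scl 0` is.
  ext1
  · ext1
    have h1 := h.hasFDerivAt.comp_hasDerivAt (f := fun b : ℝ => (b, p)) (0 : ℝ)
      ((hasDerivAt_id (0 : ℝ)).prodMk (hasDerivAt_const (0 : ℝ) p))
    have h2 := hasDerivAt_scl 0 p
    rw [scl_zero] at h2
    simpa using h2.unique h1
  · have h1 : HasFDerivAt (fun q => scl 0 q) _ p := h.hasFDerivAt.comp p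
      ((hasFDerivAt_const (0 : ℝ) p).prodMk (hasFDerivAt_id p))
    have h2 : HasFDerivAt (fun q => scl 0 q) (ContinuousLinearMap.id ℝ (Fin 8 → ℝ)) p := by
      simp only [scl_zero]; exact hasFDerivAt_id p
    ext1 v
    simpa using congrArg (fun A => A v) (h2.unique h1)

lemma scl_mem_positiveData (b : ℝ) {p : Fin 8 → ℝ} (hp : p ∈ positiveData) :
    scl b p ∈ positiveData :=
  ⟨hp.1, mul_pos (Real.exp_pos b) hp.2⟩

/-- Give `C`, `C'` weight 1 and `s`, `s'` weight -1: every monomial of `T` has weight 0. -/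
lemma TV_scl (t b : ℝ) {p : Fin 8 → ℝ} (hp : p 4 ≠ 0) : TV t (scl b p) = TV t p := by
  have h : Real.exp b ≠ 0 := (Real.exp_pos b).ne'
  simp only [TV, scl, Real.exp_neg, Matrix.cons_val]
  generalize Real.exp b = e at h
  field_simp

lemma KV_scl (b : ℝ) (p : Fin 8 → ℝ) : KV (scl b p) = KV p := by
  have h : Real.exp b ≠ 0 := (Real.exp_pos b).ne'
  simp only [KV, scl, Real.exp_neg, Matrix.cons_val]
  generalize Real.exp b = e at h
  field_simp

lemma c2V_scl (b : ℝ) {p : Fin 8 → ℝ} (hp : p ∈ admissible) :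
    c2V (scl b p) = Real.exp b * c2V p := by
  obtain ⟨h0, h4⟩ := hp
  have h4 := h4.ne'
  have h : Real.exp b ≠ 0 := (Real.exp_pos b).ne'
  simp only [c2V, scl, Real.exp_neg, Matrix.cons_val]
  generalize Real.exp b = e at h
  field_simp

lemma s2V_scl (b : ℝ) {p : Fin 8 → ℝ} (hp : p ∈ admissible) :
    s2V (scl b p) = Real.exp (-b) * s2V p := by
  obtain ⟨h0, h4⟩ := hp
  have h4 := h4.ne'
  have h : Real.exp b ≠ 0 := (Real.exp_pos b).ne'
  simp only [s2V, scl, Real.exp_neg, Matrix.cons_val]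
  generalize Real.exp b = e at h
  field_simp

lemma f4V_scl (t b : ℝ) {p : Fin 8 → ℝ} (hp : p ∈ admissible) : f4V t (scl b p) = f4V t p := by
  have h4 := hp.2.ne'
  have h0 := hp.1
  have h : Real.exp b ≠ 0 := (Real.exp_pos b).ne'
  rw [f4V, c2V_scl b hp, f4V]
  simp only [scl, Real.exp_neg, Matrix.cons_val]
  generalize Real.exp b = e at h
  field_simp

/-- Multiplying a solution by a constant gives a solution: the scaling commutes with the flow. -/
lemma field_scl (t b : ℝ) {p : Fin 8 → ℝ} (hp : p ∈ admissible) :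
    field t (scl b p) = scl b (field t p) := by
  rw [field, f4V_scl t b hp, c2V_scl b hp, s2V_scl b hp]
  rfl

/-- The initial conditions of a metric transformed by a homothety. -/
lemma homothetyData_eq {F C : ℝ → ℝ} {I : Set ℝ} (hm : IsMetricOn F C I) {z₀ a : ℝ} (b : ℝ)
    (ha : z₀ + a ∈ I) : homothetyData F C z₀ a b = scl b (metricData F C (z₀ + a)) := by
  set J : Set ℝ := (fun z => z + a) ⁻¹' I with hJ
  have hJo : IsOpen J := hm.1.preimage (by fun_prop)
  have h0 : z₀ ∈ J := ha
  have dF : deriv (fun z => F (z + a)) = fun z => deriv F (z + a) := by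
    ext z; exact deriv_comp_add_const F a z
  have dF1 : deriv (fun z => deriv F (z + a)) = fun z => deriv (deriv F) (z + a) := by
    ext z; exact deriv_comp_add_const (deriv F) a z
  have dF2 : deriv (fun z => deriv (deriv F) (z + a)) = fun z => deriv (deriv (deriv F)) (z + a) := by
    ext z; exact deriv_comp_add_const (deriv (deriv F)) a z
  have dC : deriv (fun z => Real.exp b * C (z + a)) = fun z => Real.exp b * deriv C (z + a) := by
    ext z
    rw [deriv_const_mul_field, deriv_comp_add_const C a z]
  have hl : hlog (fun z => Real.exp b * C (z + a)) = fun z => hlog C (z + a) := by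
    ext z
    rw [hlog, hlog, dC]
    exact mul_div_mul_left _ _ (Real.exp_pos b).ne'
  have dl : deriv (fun z => hlog C (z + a)) = fun z => deriv (hlog C) (z + a) := by
    ext z; exact deriv_comp_add_const (hlog C) a z
  have hm' : IsMetricOn (fun z => F (z + a)) (fun z => Real.exp b * C (z + a)) J := by
    have e : ContDiffOn ℝ ∞ (fun z : ℝ => z + a) J := (contDiff_id.add contDiff_const).contDiffOn
    refine ⟨hJo, hm.2.1.comp e fun _ h => h, contDiffOn_const.mul (hm.2.2.1.comp e fun _ h => h),
      fun z hz => ⟨(hm.2.2.2 _ hz).1, mul_pos (Real.exp_pos b) (hm.2.2.2 _ hz).2⟩⟩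
  have hs : ∀ z ∈ J, scal (fun z => F (z + a)) (fun z => Real.exp b * C (z + a)) z
      = Real.exp (-b) * scal F C (z + a) := by
    intro z hz
    have h4 := (hm.2.2.2 _ hz).2.ne'
    have h : Real.exp b ≠ 0 := (Real.exp_pos b).ne'
    rw [scal_eq hm' hz, scal_eq hm hz, hl, dl, dF, dF1, Real.exp_neg]
    field_simp
  have ds : deriv (scal (fun z => F (z + a)) fun z => Real.exp b * C (z + a)) z₀
      = Real.exp (-b) * deriv (scal F C) (z₀ + a) := by
    rw [deriv_congr_of_eqOn hJo hs h0, deriv_const_mul_field,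
      deriv_comp_add_const (scal F C) a z₀]
  rw [homothetyData, metricData, cauchyData, dF, dF1, dF2, dC, hs z₀ h0, ds]
  rfl

/-! ## Self-homothetic metrics -/

/-- If `field` is a multiple of the scaling generator at one point, equivariance makes it so along
the whole scaling orbit, which is then an integral curve. The factor must be `C'/C`, as the
`C`-component shows. -/
lemma solution_selfHomothetic {t : ℝ} {p : Fin 8 → ℝ} (hp : p ∈ admissible)
    (h : field t p = (p 5 / p 4) • sclGen p) (z₀ z : ℝ) :
    scl (p 5 / p 4 * (z - z₀)) p ∈ admissible ∧
      HasDerivAt (fun z => scl (p 5 / p 4 * (z - z₀)) p)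
        (field t (scl (p 5 / p 4 * (z - z₀)) p)) z := by
  refine ⟨⟨hp.1, mul_pos (Real.exp_pos _) hp.2⟩, ?_⟩
  have e := (hasDerivAt_scl (p 5 / p 4 * (z - z₀)) p).scomp z
    (((hasDerivAt_id z).sub_const z₀).const_mul (p 5 / p 4))
  refine e.congr_deriv ?_
  rw [field_scl t _ hp, h]
  ext i
  fin_cases i <;> simp [scl, sclGen] <;> ring

lemma metricData_zero (F C : ℝ → ℝ) (z : ℝ) : metricData F C z 0 = F z := rfl

lemma metricData_four (F C : ℝ → ℝ) (z : ℝ) : metricData F C z 4 = C z := rfl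

/-- By uniqueness the metric is the scaling orbit of its initial conditions; along it `F` is fixed
and `C` is exponential. -/
lemma selfHomothetic_of_field {t : ℝ} (ht : t ≠ 0) {F C : ℝ → ℝ} {I : Set ℝ}
    (hc : IsPreconnected I) (h : IsBtFlat t F C I) {z₀ : ℝ} (hz : z₀ ∈ I) {p : Fin 8 → ℝ}
    (hp : metricData F C z₀ = p) (hf : field t p = (p 5 / p 4) • sclGen p) :
    SelfHomothetic F C I := by
  have hcv : ∀ z ∈ I, metricData F C z ∈ admissible ∧
      HasDerivAt (metricData F C) (field t (metricData F C z)) z := fun z hz =>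
    ⟨positiveData_subset (isBtFlat_curve ht h hz).1, (isBtFlat_curve ht h hz).2.2⟩
  have hpa : p ∈ admissible := hp ▸ (hcv z₀ hz).1
  have h0 : metricData F C z₀ = scl (p 5 / p 4 * (z₀ - z₀)) p := by
    rw [sub_self, mul_zero, scl_zero, hp]
  have e : EqOn (metricData F C) (fun z => scl (p 5 / p 4 * (z - z₀)) p) I :=
    integralCurve_unique h.1.1 hc hcv (fun z _ => solution_selfHomothetic hpa hf z₀ z) hz h0
  refine ⟨p 0, p 4 * Real.exp (-(p 5 / p 4 * z₀)), p 5 / p 4, fun z hz => ?_⟩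
  have hz' : metricData F C z = scl (p 5 / p 4 * (z - z₀)) p := e hz
  rw [← metricData_zero F C z, ← metricData_four F C z, hz']
  refine ⟨rfl, ?_⟩
  have e4 : scl (p 5 / p 4 * (z - z₀)) p 4 = Real.exp (p 5 / p 4 * (z - z₀)) * p 4 := rfl
  rw [e4, mul_assoc, ← Real.exp_add, mul_comm]
  congr 2
  ring

/-- At the initial conditions of a metric which is not self-homothetic the vector field and the
generator of the multiplications are independent. -/
lemma independent_of_not_selfHomothetic {t : ℝ} (ht : t ≠ 0) {F C : ℝ → ℝ} {I : Set ℝ}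
    (hc : IsPreconnected I) (h : IsBtFlat t F C I) {z₀ : ℝ} (hz : z₀ ∈ I)
    (hn : ¬ SelfHomothetic F C I) (a b : ℝ)
    (hab : a • field t (metricData F C z₀) + b • sclGen (metricData F C z₀) = 0) :
    a = 0 ∧ b = 0 := by
  have h4 : 0 < metricData F C z₀ 4 := (isBtFlat_curve ht h hz).1.2
  obtain ⟨p, hp⟩ : ∃ p, metricData F C z₀ = p := ⟨_, rfl⟩
  rw [hp] at hab h4
  have e4 : a * p 5 + b * p 4 = 0 := congrFun hab 4
  by_cases ha : a = 0
  · subst ha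
    rw [zero_mul, zero_add] at e4
    exact ⟨rfl, (mul_eq_zero.1 e4).resolve_right h4.ne'⟩
  -- If `a ≠ 0` then `field` is `-b/a` times the generator, and the `C`-component identifies `-b/a`
  -- with `C'/C`.
  · refine absurd (selfHomothetic_of_field ht hc h hz hp ?_) hn
    have hb : p 5 / p 4 = -(b / a) := by field_simp; linarith
    rw [hb, neg_smul, eq_neg_iff_add_eq_zero]
    have := congrArg (fun v => a⁻¹ • v) hab
    simpa [smul_add, smul_smul, ha, div_eq_inv_mul] using this

/-! ## Families up to homothety -/

section family

open Module

lemma fderiv_apply_eq_zero_of_const {m : ℕ} {Q : (Fin 8 → ℝ) → Fin m → ℝ} {p v : Fin 8 → ℝ}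
    (hQ : DifferentiableAt ℝ Q p) {c : ℝ → Fin 8 → ℝ} {x : ℝ} (hc0 : c x = p)
    (hc : HasDerivAt c v x) (hconst : ∀ᶠ z in nhds x, Q (c z) = Q p) : fderiv ℝ Q p v = 0 := by
  subst hc0
  have h1 := hQ.hasFDerivAt.comp_hasDerivAt x hc
  have h2 : HasDerivAt (Q ∘ c) 0 x := (hasDerivAt_const x (Q (c x))).congr_of_eventuallyEq hconst
  exact h1.unique h2

/-- A class of metrics given by integral curves on a common level set of constants of the motion
which are invariant under multiplication is, near initial conditions where these constants are
independent and the metric is not self-homothetic, a family up to homothety. -/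
theorem exists_family {t z₀ : ℝ} {P : (ℝ → ℝ) → (ℝ → ℝ) → Set ℝ → Prop} {m k : ℕ}
    (hk : k + 2 + m = 8) {Q : (Fin 8 → ℝ) → Fin m → ℝ} (hQs : ContDiffOn ℝ ∞ Q positiveData)
    (hQc : ∀ (I : Set ℝ) (y : ℝ → Fin 8 → ℝ), IsOpen I → IsPreconnected I →
      (∀ z ∈ I, y z ∈ positiveData ∧ HasDerivAt y (field t (y z)) z) →
      ∀ z ∈ I, ∀ w ∈ I, Q (y z) = Q (y w))
    (hQb : ∀ b, ∀ q ∈ positiveData, Q (scl b q) = Q q)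
    (hP : ∀ (I : Set ℝ) (y : ℝ → Fin 8 → ℝ), IsOpen I → IsPreconnected I →
      (∀ z ∈ I, y z ∈ positiveData ∧ HasDerivAt y (field t (y z)) z) → (∀ z ∈ I, Q (y z) = 0) →
      P (fun z => y z 0) (fun z => y z 4) I ∧
        ∀ z ∈ I, metricData (fun z => y z 0) (fun z => y z 4) z = y z)
    (hPm : ∀ F C I, P F C I → IsMetricOn F C I)
    (hd : dataSet P z₀ = {q ∈ positiveData | Q q = 0})
    {p : Fin 8 → ℝ} (hp : p ∈ positiveData) (hQp : Q p = 0)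
    (hsurj : Function.Surjective (fderiv ℝ Q p))
    (hind : ∀ a b : ℝ, a • field t p + b • sclGen p = 0 → a = 0 ∧ b = 0) :
    ∃ ε > 0, ∃ V : Set (Fin k → ℝ), IsOpen V ∧
    ∃ F C : (Fin k → ℝ) → ℝ → ℝ,
      (∀ u ∈ V, P (F u) (C u) (Ioo (z₀ - ε) (z₀ + ε))) ∧
      (∃ u ∈ V, metricData (F u) (C u) z₀ = p) ∧
      ContDiffOn ℝ ∞ (fun u => metricData (F u) (C u) z₀) V ∧
      (∀ u ∈ V, Function.Injective (fderiv ℝ (fun u => metricData (F u) (C u) z₀) u)) ∧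
      Topology.IsEmbedding ((V ×ˢ Ioo (-ε) ε ×ˢ Ioo (-ε) ε).domRestrict
        fun x : (Fin k → ℝ) × ℝ × ℝ => homothetyData (F x.1) (C x.1) z₀ x.2.1 x.2.2) ∧
      ∃ U : Set (Fin 8 → ℝ), IsOpen U ∧
        (fun x : (Fin k → ℝ) × ℝ × ℝ => homothetyData (F x.1) (C x.1) z₀ x.2.1 x.2.2) ''
          (V ×ˢ Ioo (-ε) ε ×ˢ Ioo (-ε) ε) = U ∩ dataSet P z₀ := by
  have hpa := positiveData_subset hp
  have hQd : DifferentiableAt ℝ Q p :=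
    (hQs.contDiffAt (isOpen_positiveData.mem_nhds hp)).differentiableAt (by simp)
  obtain ⟨φ, hpφ, hφU, hφ, hψ, hφ2⟩ := exists_chart (E := Fin 8 → ℝ) (d := k + 2) (e := m)
    (by simp [hk]) isOpen_positiveData hQs hp hsurj
  obtain ⟨α, hα, r, hr, ε, hε, hflow⟩ := exists_flow (f := field t)
    (((contDiffOn_field t).contDiffAt (isOpen_admissible.mem_nhds hpa)).of_le (by simp))
  -- the two infinitesimal symmetries are tangent to the level set
  have hQX : fderiv ℝ Q p (field t p) = 0 := by
    obtain ⟨δ, hδ, y, hy0, hy⟩ := exists_positive_curve t z₀ hp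
    have hz : z₀ ∈ Ioo (z₀ - δ) (z₀ + δ) := by constructor <;> linarith
    refine fderiv_apply_eq_zero_of_const hQd hy0 (hy0 ▸ (hy z₀ hz).2) ?_
    filter_upwards [isOpen_Ioo.mem_nhds hz] with z hz'
    rw [hQc _ y isOpen_Ioo isPreconnected_Ioo hy z hz' z₀ hz, hy0]
  have hQY : fderiv ℝ Q p (sclGen p) = 0 := by
    have h := hasDerivAt_scl 0 p
    rw [scl_zero] at h
    exact fderiv_apply_eq_zero_of_const hQd (scl_zero p) h
      (Filter.Eventually.of_forall fun b => hQb b p hp)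
  have hφp : HasFDerivAt φ (fderiv ℝ φ p) p :=
    ((hφ.contDiffAt (φ.open_source.mem_nhds hpφ)).differentiableAt (by simp)).hasFDerivAt
  set A := fderiv ℝ φ p with hA
  have hA2 : ∀ v, (A v).2 = fderiv ℝ Q p v := by
    intro v
    have h1 := ((ContinuousLinearMap.snd ℝ (Fin (k + 2) → ℝ) (Fin m → ℝ)).hasFDerivAt
      (x := φ p)).comp p hφp
    have h2 := hQd.hasFDerivAt.congr_of_eventuallyEq (f₁ := fun q => (φ q).2)
      (by filter_upwards [φ.open_source.mem_nhds hpφ] with q hq using hφ2 q hq)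
    exact congrArg (fun B => B v) (HasFDerivAt.unique h1 h2)
  set u₀ := (φ p).1 with hu₀
  have hφp0 : φ p = (u₀, 0) := Prod.ext rfl (by rw [hφ2 p hpφ, hQp])
  have hBt : (u₀, (0 : Fin m → ℝ)) ∈ φ.target := hφp0 ▸ φ.map_source hpφ
  have hψp : φ.symm (u₀, 0) = p := by rw [← hφp0, φ.left_inv hpφ]
  have hψs : HasStrictFDerivAt φ.symm (fderiv ℝ φ.symm (u₀, 0)) (u₀, 0) :=
    (hψ.contDiffAt (φ.open_target.mem_nhds hBt)).hasStrictFDerivAt (by simp)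
  set B := fderiv ℝ φ.symm (u₀, 0) with hB
  have hAB : ∀ v, A (B v) = v := by
    intro v
    have h1 : HasFDerivAt (φ ∘ φ.symm) (A.comp B) (u₀, 0) :=
      HasFDerivAt.comp (g := φ) (f := φ.symm) _ (hψp.symm ▸ hφp) hψs.hasFDerivAt
    have h2 : HasFDerivAt (φ ∘ φ.symm) (ContinuousLinearMap.id ℝ _) (u₀, (0 : Fin m → ℝ)) :=
      (hasFDerivAt_id _).congr_of_eventuallyEq
        (by filter_upwards [φ.open_target.mem_nhds hBt] with q hq using φ.right_inv hq)
    exact congrArg (fun T => T v) (h1.unique h2)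
  -- `B` is injective because `A B = 1`; by equality of dimensions it is bijective, so `A` is its
  -- inverse.
  have hAinj : ∀ v, A v = 0 → v = 0 := by
    have hBinj : Function.Injective B := fun v w h => by rw [← hAB v, h, hAB w]
    have hfin : finrank ℝ ((Fin (k + 2) → ℝ) × (Fin m → ℝ)) = finrank ℝ (Fin 8 → ℝ) := by
      simp [hk]
    obtain ⟨e, he⟩ := exists_continuousLinearEquiv_of_injective hfin B hBinj
    intro v hv
    have h1 : B (e.symm v) = v := by rw [← he]; exact e.apply_symm_apply v
    rw [← h1, hAB] at hv
    rw [← h1, hv, map_zero]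
  -- In the chart the level set is `ℝ^(k+2)`, and both symmetry directions are tangent to it; `ι`
  -- spans a complement of dimension `k`, the directions of the family.
  obtain ⟨ι, hι⟩ := exists_transversal (E := Fin (k + 2) → ℝ) (k := k) (by simp)
    (A (field t p)).1 (A (sclGen p)).1 (fun a b hab => by
      refine hind a b (hAinj _ ?_)
      rw [map_add, map_smul, map_smul]
      refine Prod.ext hab ?_
      simp [hA2, hQX, hQY])
  have hιinj : Function.Injective ι := by
    rw [injective_iff_map_eq_zero]
    intro u hu
    exact (hι u 0 0 (by simp [hu])).1
  -- the map to the space of initial conditions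
  let Xs := (Fin k → ℝ) × (Fin m → ℝ) × ℝ × ℝ
  let j : Xs → (Fin (k + 2) → ℝ) × (Fin m → ℝ) := fun x => (u₀ + ι x.1, x.2.1)
  let σ : Xs → Fin 8 → ℝ := fun x => φ.symm (j x)
  -- The extra parameter in `ℝᵐ` moves across the level sets of `Q`, so that `Ψ` maps between spaces
  -- of the same dimension 8 and the inverse function theorem applies. Strict differentiability at 0
  -- suffices, because only a local homeomorphism is needed.
  let Ψ : Xs → Fin 8 → ℝ := fun x => scl x.2.2.2 (α (σ x, x.2.2.1))
  have hj0 : j 0 = (u₀, 0) := by simp [j]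
  have hσ0 : σ 0 = p := by simp only [σ, hj0, hψp]
  let p1 := ContinuousLinearMap.fst ℝ (Fin k → ℝ) ((Fin m → ℝ) × ℝ × ℝ)
  let p2 := (ContinuousLinearMap.fst ℝ (Fin m → ℝ) (ℝ × ℝ)).comp
    (ContinuousLinearMap.snd ℝ (Fin k → ℝ) ((Fin m → ℝ) × ℝ × ℝ))
  let p34 := (ContinuousLinearMap.snd ℝ (Fin m → ℝ) (ℝ × ℝ)).comp
    (ContinuousLinearMap.snd ℝ (Fin k → ℝ) ((Fin m → ℝ) × ℝ × ℝ))
  let p3 := (ContinuousLinearMap.fst ℝ ℝ ℝ).comp p34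
  let p4 := (ContinuousLinearMap.snd ℝ ℝ ℝ).comp p34
  have hjs : HasStrictFDerivAt j ((ι.comp p1).prod p2) 0 :=
    ((ι.comp p1).hasStrictFDerivAt.const_add u₀).prodMk p2.hasStrictFDerivAt
  have hσs : HasStrictFDerivAt σ (B.comp ((ι.comp p1).prod p2)) 0 :=
    HasStrictFDerivAt.comp (0 : Xs) (hj0.symm ▸ hψs) hjs
  have hαs := HasStrictFDerivAt.comp (g := α) (f := fun x : Xs => (σ x, x.2.2.1)) (0 : Xs)
    (by rw [hσ0]; exact hα) (hσs.prodMk p3.hasStrictFDerivAt)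
  have hα0 : α (p, 0) = p := (hflow p (Metric.mem_ball_self hr)).1
  have hΨs := HasStrictFDerivAt.comp (g := fun x : ℝ × (Fin 8 → ℝ) => scl x.1 x.2)
    (f := fun x : Xs => (x.2.2.2, α (σ x, x.2.2.1))) (0 : Xs)
    (by simp only [hσ0]; exact hα0.symm ▸ hasStrictFDerivAt_scl p)
    (p4.hasStrictFDerivAt.prodMk hαs)
  have hfin : finrank ℝ Xs = finrank ℝ (Fin 8 → ℝ) := by
    simp only [Xs, finrank_prod, finrank_fintype_fun_eq_card, Fintype.card_fin, finrank_self]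
    omega
  obtain ⟨M, hM, hMv⟩ : ∃ M : Xs →L[ℝ] Fin 8 → ℝ, HasStrictFDerivAt Ψ M 0 ∧ ∀ v, M v =
      B (ι v.1, v.2.1) + v.2.2.1 • field t p + v.2.2.2 • sclGen p :=
    ⟨_, hΨs, fun v => by
      simp only [hα0, ContinuousLinearMap.comp_apply, ContinuousLinearMap.prod_apply,
        add_apply, ContinuousLinearMap.smulRight_apply,
        ContinuousLinearMap.coe_fst', ContinuousLinearMap.coe_snd', p1, p2, p3, p4, p34]
      exact add_comm _ _⟩
  obtain ⟨e, he⟩ := exists_continuousLinearEquiv_of_injective hfin M (fun x y hxy => by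
    rw [← sub_eq_zero, ← map_sub] at hxy
    rw [← sub_eq_zero]
    generalize x - y = v at hxy ⊢
    obtain ⟨v1, v2, v3, v4⟩ := v
    have h1 : B (ι v1, v2) + v3 • field t p + v4 • sclGen p = 0 := by
      rw [← hxy, hMv]
    have h2 := congrArg A h1
    rw [map_add, map_add, map_smul, map_smul, hAB, map_zero] at h2
    have h3 := congrArg Prod.snd h2
    have h4 := congrArg Prod.fst h2
    simp only [Prod.snd_add, Prod.smul_snd, hA2, hQX, hQY, smul_zero, add_zero,
      Prod.snd_zero] at h3
    simp only [Prod.fst_add, Prod.smul_fst, Prod.fst_zero] at h4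
    have h5 := hι v1 v3 v4 h4
    exact Prod.ext h5.1 (Prod.ext h3 (Prod.ext h5.2.1 h5.2.2)))
  rw [← he] at hM
  set R := hM.toOpenPartialHomeomorph with hR
  have hRΨ : ∀ x, R x = Ψ x := fun x => rfl
  have hR0 : (0 : Xs) ∈ R.source := hM.mem_toOpenPartialHomeomorph_source
  have hev : ∀ᶠ x in nhds (0 : Xs), x ∈ R.source ∧ j x ∈ φ.target ∧ σ x ∈ Metric.ball p r ∧
      α (σ x, x.2.2.1) ∈ positiveData := by
    have hσt : Filter.Tendsto σ (nhds 0) (nhds p) := by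
      have := hσs.hasFDerivAt.continuousAt.tendsto
      rwa [hσ0] at this
    have hαt : Filter.Tendsto (fun x : Xs => α (σ x, x.2.2.1)) (nhds 0) (nhds p) := by
      have := hαs.hasFDerivAt.continuousAt.tendsto
      rwa [show α (σ 0, (0 : Xs).2.2.1) = p by rw [hσ0]; exact hα0] at this
    have hjt : Filter.Tendsto j (nhds 0) (nhds (u₀, 0)) := by
      have := hjs.hasFDerivAt.continuousAt.tendsto
      rwa [hj0] at this
    filter_upwards [R.open_source.mem_nhds hR0, hjt (φ.open_target.mem_nhds hBt),
      hσt (Metric.ball_mem_nhds p hr), hαt (isOpen_positiveData.mem_nhds hp)] with x h1 h2 h3 h4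
    exact ⟨h1, h2, h3, h4⟩
  obtain ⟨δ₁, hδ₁, hball⟩ := Metric.eventually_nhds_iff_ball.1 hev
  obtain ⟨δ, hδ, hδε, hδδ⟩ : ∃ δ > 0, δ ≤ ε ∧ δ ≤ δ₁ :=
    ⟨min ε δ₁, lt_min hε hδ₁, min_le_left _ _, min_le_right _ _⟩
  have hgood : ∀ u w a b, ‖u‖ < δ → ‖w‖ < δ → |a| < δ → |b| < δ → ((u, w, a, b) : Xs) ∈
      Metric.ball (0 : Xs) δ := by
    intro u w a b hu hw ha hb
    simp [Xs, Prod.norm_def, hu, hw, ha, hb]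
  have hbad : ∀ u w a b, ((u, w, a, b) : Xs) ∈ Metric.ball (0 : Xs) δ →
      ‖u‖ < δ ∧ ‖w‖ < δ ∧ |a| < δ ∧ |b| < δ := by
    intro u w a b h
    simpa [Xs, Prod.norm_def] using h
  have hB := fun x hx => hball x (Metric.ball_subset_ball hδδ hx)
  let y : (Fin k → ℝ) → (Fin m → ℝ) → ℝ → Fin 8 → ℝ :=
    fun u w z => α (φ.symm (u₀ + ι u, w), z - z₀)
  have hIoo : ∀ z, z ∈ Ioo (z₀ - δ) (z₀ + δ) ↔ |z - z₀| < δ := by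
    intro z
    rw [abs_lt]
    constructor <;> rintro ⟨h1, h2⟩ <;> constructor <;> linarith
  have hz₀ : z₀ ∈ Ioo (z₀ - δ) (z₀ + δ) := by constructor <;> linarith
  have h00 : |(0 : ℝ)| < δ := by simpa using hδ
  have hcurve : ∀ u w, ‖u‖ < δ → ‖w‖ < δ → ∀ z ∈ Ioo (z₀ - δ) (z₀ + δ),
      y u w z ∈ positiveData ∧ HasDerivAt (y u w) (field t (y u w z)) z := by
    intro u w hu hw z hz
    obtain ⟨-, -, h3, h4⟩ := hB _ (hgood u w (z - z₀) 0 hu hw ((hIoo z).1 hz) h00)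
    refine ⟨h4, ?_⟩
    have h5 := (hflow _ h3).2 (z - z₀) (abs_lt.1 (((hIoo z).1 hz).trans_le hδε))
    exact HasDerivAt.comp_sub_const z z₀ h5
  have hy0 : ∀ u w, ‖u‖ < δ → ‖w‖ < δ → y u w z₀ = φ.symm (u₀ + ι u, w) := by
    intro u w hu hw
    obtain ⟨-, -, h3, -⟩ := hB _ (hgood u w 0 0 hu hw h00 h00)
    simp only [y, sub_self]
    exact (hflow _ h3).1
  -- Conservation of `Q` makes the parameter `w` the value of `Q` along the whole curve; `w = 0`
  -- therefore singles out the class.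
  have hQy : ∀ u w, ‖u‖ < δ → ‖w‖ < δ → ∀ z ∈ Ioo (z₀ - δ) (z₀ + δ), Q (y u w z) = w := by
    intro u w hu hw z hz
    rw [hQc _ _ isOpen_Ioo isPreconnected_Ioo (hcurve u w hu hw) z hz z₀ hz₀, hy0 u w hu hw]
    obtain ⟨-, h2, -, -⟩ := hB _ (hgood u w 0 0 hu hw h00 h00)
    rw [← hφ2 _ (φ.map_target h2)]
    exact congrArg Prod.snd (φ.right_inv h2)
  have h0δ : ‖(0 : Fin m → ℝ)‖ < δ := by simpa using hδ
  let V : Set (Fin k → ℝ) := Metric.ball 0 δ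
  have hV : ∀ u ∈ V, ‖u‖ < δ := fun u hu => mem_ball_zero_iff.1 hu
  have hPV : ∀ u ∈ V, P (fun z => y u 0 z 0) (fun z => y u 0 z 4) (Ioo (z₀ - δ) (z₀ + δ)) ∧
      ∀ z ∈ Ioo (z₀ - δ) (z₀ + δ),
        metricData (fun z => y u 0 z 0) (fun z => y u 0 z 4) z = y u 0 z := fun u hu =>
    hP _ _ isOpen_Ioo isPreconnected_Ioo (hcurve u 0 (hV u hu) h0δ) (hQy u 0 (hV u hu) h0δ)
  have hmd : ∀ u ∈ V, metricData (fun z => y u 0 z 0) (fun z => y u 0 z 4) z₀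
      = φ.symm (u₀ + ι u, 0) := fun u hu => by
    rw [(hPV u hu).2 z₀ hz₀, hy0 u 0 (hV u hu) h0δ]
  have htgt : ∀ u ∈ V, (u₀ + ι u, (0 : Fin m → ℝ)) ∈ φ.target := fun u hu =>
    (hB _ (hgood u 0 0 0 (hV u hu) h0δ h00 h00)).2.1
  have hhom : ∀ u ∈ V, ∀ a ∈ Ioo (-δ) δ, ∀ b, homothetyData (fun z => y u 0 z 0)
      (fun z => y u 0 z 4) z₀ a b = Ψ (u, 0, a, b) := by
    intro u hu a ha b
    have haz : z₀ + a ∈ Ioo (z₀ - δ) (z₀ + δ) := by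
      rw [hIoo, add_sub_cancel_left]
      exact abs_lt.2 ha
    rw [homothetyData_eq (hPm _ _ _ (hPV u hu).1) b haz, (hPV u hu).2 _ haz]
    simp only [y, Ψ, σ, j, add_sub_cancel_left]
  have hsm : ContDiffOn ℝ ∞ (fun u => φ.symm (u₀ + ι u, 0)) V :=
    hψ.comp (by fun_prop : ContDiff ℝ ∞ fun u => (u₀ + ι u, (0 : Fin m → ℝ))).contDiffOn htgt
  refine ⟨δ, hδ, V, Metric.isOpen_ball, fun u z => y u 0 z 0, fun u z => y u 0 z 4,
    fun u hu => (hPV u hu).1, ⟨0, Metric.mem_ball_self hδ, ?_⟩, hsm.congr hmd, ?_, ?_, ?_⟩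
  · rw [hmd 0 (Metric.mem_ball_self hδ)]
    simpa using hψp
  -- In the chart the family is the affine map `u ↦ (u₀ + ι u, 0)`, so its derivative is injective
  -- because `ι` is.
  · intro u hu
    have hVn := Metric.isOpen_ball.mem_nhds hu
    have h1 : HasFDerivAt (fun u => metricData (fun z => y u 0 z 0) (fun z => y u 0 z 4) z₀)
        (fderiv ℝ (fun u => metricData (fun z => y u 0 z 0) (fun z => y u 0 z 4) z₀) u) u :=
      (((hsm.congr hmd).contDiffAt hVn).differentiableAt (by simp)).hasFDerivAt
    have hs : metricData (fun z => y u 0 z 0) (fun z => y u 0 z 4) z₀ ∈ φ.source := by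
      rw [hmd u hu]
      exact φ.map_target (htgt u hu)
    have h2 := (((hφ.contDiffAt (φ.open_source.mem_nhds hs)).differentiableAt
      (by simp)).hasFDerivAt).comp u h1
    have h3 : HasFDerivAt (fun u => (u₀ + ι u, (0 : Fin m → ℝ))) (ι.prod 0) u :=
      (ι.hasFDerivAt.const_add u₀).prodMk (hasFDerivAt_const _ _)
    have h4 := h2.congr_of_eventuallyEq (f₁ := fun u => (u₀ + ι u, (0 : Fin m → ℝ))) (by
      filter_upwards [hVn] with v hv
      simp only [Function.comp_apply]
      rw [hmd v hv, φ.right_inv (htgt v hv)])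
    intro v w hvw
    have h5 : (ι.prod (0 : (Fin k → ℝ) →L[ℝ] Fin m → ℝ)) v = (ι.prod 0) w := by
      rw [h3.unique h4]
      exact congrArg (fderiv ℝ φ (metricData (fun z => y u 0 z 0) (fun z => y u 0 z 4) z₀)) hvw
    exact hιinj (congrArg Prod.fst h5)
  -- The family with its homotheties is the restriction of the local homeomorphism `R` to the slice
  -- `w = 0`.
  · let S : Set ((Fin k → ℝ) × ℝ × ℝ) := V ×ˢ Ioo (-δ) δ ×ˢ Ioo (-δ) δ
    let f : S → R.source := fun x => ⟨(x.1.1, 0, x.1.2.1, x.1.2.2),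
      (hB _ (hgood _ 0 _ _ (hV _ x.2.1) h0δ (abs_lt.2 x.2.2.1) (abs_lt.2 x.2.2.2))).1⟩
    have hf : Topology.IsEmbedding f := by
      have hg : Topology.IsEmbedding fun x : (Fin k → ℝ) × ℝ × ℝ =>
          ((x.1, 0, x.2.1, x.2.2) : Xs) :=
        Function.LeftInverse.isEmbedding (f := fun x : Xs => (x.1, x.2.2.1, x.2.2.2))
          (fun x => rfl) (by fun_prop) (by fun_prop)
      exact (hg.comp Topology.IsEmbedding.subtypeVal).codRestrict _ _
    have h := R.isEmbedding_restrict.comp hf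
    convert! h using 1
    funext x
    exact hhom _ x.2.1 _ x.2.2.1 _
  -- The neighbourhood `U` is the image of the full ball; its points in the class are those with `w
  -- = 0`, because `Q (Ψ (u, w, a, b)) = w`.
  · refine ⟨R '' Metric.ball 0 δ, R.isOpen_image_of_subset_source Metric.isOpen_ball
      fun x hx => (hB x hx).1, ?_⟩
    have hQΨ : ∀ u w a b, ((u, w, a, b) : Xs) ∈ Metric.ball (0 : Xs) δ →
        Ψ (u, w, a, b) ∈ positiveData ∧ Q (Ψ (u, w, a, b)) = w := by
      intro u w a b hx
      obtain ⟨hu, hw, ha, hb⟩ := hbad u w a b hx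
      have haz : z₀ + a ∈ Ioo (z₀ - δ) (z₀ + δ) := by
        rwa [hIoo, add_sub_cancel_left]
      have e : Ψ (u, w, a, b) = scl b (y u w (z₀ + a)) := by
        simp only [y, Ψ, σ, j, add_sub_cancel_left]
      have hc := (hcurve u w hu hw _ haz).1
      rw [e]
      exact ⟨scl_mem_positiveData b hc, by rw [hQb _ _ hc, hQy u w hu hw _ haz]⟩
    rw [hd]
    apply Subset.antisymm
    · rintro _ ⟨⟨u, a, b⟩, ⟨hu, ha, hb⟩, rfl⟩
      have hx := hgood u 0 a b (hV u hu) h0δ (abs_lt.2 ha) (abs_lt.2 hb)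
      simp only
      rw [hhom u hu a ha b]
      exact ⟨⟨_, hx, rfl⟩, hQΨ u 0 a b hx⟩
    · rintro _ ⟨⟨⟨u, w, a, b⟩, hx, rfl⟩, -, hq⟩
      obtain ⟨hu, -, ha, hb⟩ := hbad u w a b hx
      rw [hRΨ, (hQΨ u w a b hx).2] at hq
      subst hq
      refine ⟨(u, a, b), ⟨mem_ball_zero_iff.2 hu, abs_lt.1 ha, abs_lt.1 hb⟩, ?_⟩
      exact hhom u (mem_ball_zero_iff.2 hu) a (abs_lt.1 ha) b

end family

/-! ## Regularity of the constants of the motion -/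

lemma dTV_single_two (t : ℝ) {p : Fin 8 → ℝ} (h1 : p 1 = 0) :
    dTV t p (Pi.single 2 1) = -8 * p 2 := by
  simp [dTV, h1]
  ring

lemma dTV_single_three (t : ℝ) (p : Fin 8 → ℝ) : dTV t p (Pi.single 3 1) = 8 * p 1 := by
  simp [dTV]
  ring

/-- The differential of the conserved quantity on the metrics of constant scalar curvature with
`F' = F'' = C' = 0`. -/
lemma false_of_dTV_eq_zero {t : ℝ} (ht : t ≠ 0) {p : Fin 8 → ℝ} (hp : p ∈ admissible)
    (hT : TV t p = 0) (h1 : p 1 = 0) (h2 : p 2 = 0) (h5 : p 5 = 0)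
    (e0 : dTV t p (Pi.single 0 1) = 0) (e6 : dTV t p (Pi.single 6 1) = 0) : False := by
  have h4 := hp.2.ne'
  have e0' : dTV t p (Pi.single 0 1) = 32 * (p 0 - 1) - 3 * t * (p 4 * p 6) := by
    simp [dTV, h1, h2, h5]
    field_simp
    ring
  have e6' : dTV t p (Pi.single 6 1) = -(3 / 2) * t * p 4 * (p 4 * p 6 - (8 - 2 * p 0)) := by
    simp [dTV, h1, h2, h5]
    field_simp
    ring
  have hT' : TV t p = 16 * (p 0 - 1) ^ 2
      - 3 / 4 * t * (p 4 * p 6) * (-16 + 4 * p 0 + p 4 * p 6) := by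
    simp [TV, h1, h2, h5]
    field_simp
  rw [e0'] at e0
  rw [e6', mul_eq_zero] at e6
  rw [hT'] at hT
  -- The vanishing partial derivative in `s` determines `C s`. Eliminating it from the partial
  -- derivative in `F` and from `T = 0` leaves two equations that force `F = 4`, where the first
  -- reads `48 = 0`.
  have h6 : p 4 * p 6 = 8 - 2 * p 0 :=
    sub_eq_zero.1 (e6.resolve_left (mul_ne_zero (mul_ne_zero (by norm_num) ht) h4))
  have f0 : 16 * (p 0 - 1) = 3 * t * (4 - p 0) := by
    linear_combination e0 / 2 + 3 / 2 * t * h6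
  have f1 : 16 * (p 0 - 1) ^ 2 + 3 * t * (4 - p 0) ^ 2 = 0 := by
    linear_combination hT + 3 / 4 * t * (p 4 * p 6 + 2 * p 0 - 8) * h6
  have f2 : t * (4 - p 0) = 0 := by
    linear_combination f1 / 9 - (p 0 - 1) / 9 * f0
  have f3 : p 0 = 4 := by linarith [(mul_eq_zero.1 f2).resolve_left ht]
  rw [f3] at f0
  linarith

/-- At a critical point the partial derivatives in `F'''`, `F''` and `s'` give, in this order, `F' =
0`, `F'' = 0` and `C' = 0`; then `false_of_dTV_eq_zero` applies. -/
lemma exists_dTV_ne_zero {t : ℝ} (ht : t ≠ 0) {p : Fin 8 → ℝ} (hp : p ∈ admissible)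
    (hT : TV t p = 0) : ∃ v, dTV t p v ≠ 0 := by
  by_contra! h
  have h1 : p 1 = 0 := by linarith [dTV_single_three t p, h (Pi.single 3 1)]
  have h2 : p 2 = 0 := by linarith [dTV_single_two t h1, h (Pi.single 2 1)]
  have h5 : p 5 = 0 := by
    have := h (Pi.single 7 1)
    simp [dTV, h1, ht, hp.1] at this
    exact this
  exact false_of_dTV_eq_zero ht hp hT h1 h2 h5 (h _) (h _)

/-- On the metrics of constant scalar curvature, the conserved quantity is critical only at flat
metrics. -/
lemma exists_dTV_ne_zero_of_csc {t : ℝ} (ht : t ≠ 0) {p : Fin 8 → ℝ} (hp : p ∈ admissible)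
    (hT : TV t p = 0) (h7 : p 7 = 0) (hf : field t p ≠ (p 5 / p 4) • sclGen p) :
    ∃ v, v 7 = 0 ∧ dTV t p v ≠ 0 := by
  by_contra! h
  have h1 : p 1 = 0 := by linarith [dTV_single_three t p, h (Pi.single 3 1) (by simp)]
  have h2 : p 2 = 0 := by linarith [dTV_single_two t h1, h (Pi.single 2 1) (by simp)]
  have h4 := hp.2.ne'
  -- Variations of `s'` are no longer allowed, so the partial derivative in `C'` is used instead,
  -- and it gives only `s C' = 0`.
  have h56 : p 6 = 0 ∨ p 5 = 0 := by
    have := h (Pi.single 5 1) (by simp)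
    simp [dTV, h1, h7, ht, hp.1, h4] at this
    exact this
  by_cases h5 : p 5 = 0
  · exact false_of_dTV_eq_zero ht hp hT h1 h2 h5 (h _ (by simp)) (h _ (by simp))
  have h6 := h56.resolve_right h5
  -- In the remaining case `s = 0`, `C' ≠ 0`, criticality and `T = 0` force `F = 1`, `F''' = 0` and
  -- `C'² = C²`, where `field` is the excluded multiple of the generator.
  have h0 : p 0 = 1 := by
    simp [TV, h1, h2, h6, h7] at hT
    linarith
  have h3 : p 3 = 0 := by
    have := h (Pi.single 1 1) (by simp)
    simpa [dTV, h0, h1, h2, h6, h7] using this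
  have h54 : p 5 ^ 2 = p 4 ^ 2 := by
    have e6 : dTV t p (Pi.single 6 1) = -(9 * t) / p 4 * (p 5 ^ 2 - p 4 ^ 2) := by
      simp [dTV, h0, h1, h2, h6, h7]
      field_simp
      ring
    rw [h _ (by simp), eq_comm, mul_eq_zero] at e6
    exact sub_eq_zero.1 (e6.resolve_left (by simp [ht, h4]))
  refine hf ?_
  have hc : c2V p = p 5 / p 4 * p 5 := by
    simp only [c2V, h0, h1, h2, h6]
    field_simp
    linarith
  ext i
  fin_cases i <;> simp [field, sclGen, hc, f4V, s2V, h0, h1, h2, h3, h6, h7, h4]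

/-- The conserved quantity as a map to `ℝ¹`. -/
def TQ (t : ℝ) (p : Fin 8 → ℝ) : Fin 1 → ℝ := ![TV t p]

/-- The constants of the motion `T` and `C F s'` as a map to `ℝ²`. -/
def TKQ (t : ℝ) (p : Fin 8 → ℝ) : Fin 2 → ℝ := ![TV t p, KV p]

lemma contDiff_KV : ContDiff ℝ ∞ KV := by
  unfold KV
  fun_prop

lemma contDiffOn_TQ (t : ℝ) : ContDiffOn ℝ ∞ (TQ t) admissible := by
  refine contDiffOn_pi.2 fun i => ?_
  fin_cases i
  exact fun p hp => (contDiffAt_TV t hp.2.ne').contDiffWithinAt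

lemma contDiffOn_TKQ (t : ℝ) : ContDiffOn ℝ ∞ (TKQ t) admissible := by
  refine contDiffOn_pi.2 fun i => ?_
  fin_cases i
  · exact fun p hp => (contDiffAt_TV t hp.2.ne').contDiffWithinAt
  · exact contDiff_KV.contDiffOn

lemma fderiv_TQ (t : ℝ) {p : Fin 8 → ℝ} (hp : p ∈ admissible) (v : Fin 8 → ℝ) :
    fderiv ℝ (TQ t) p v = ![dTV t p v] := by
  rw [← fderiv_TV t hp.2.ne', fderiv_pi fun i => ?_]
  · ext i
    fin_cases i
    rfl
  · fin_cases i
    exact (contDiffAt_TV t hp.2.ne').differentiableAt (by simp)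

lemma fderiv_KV (p v : Fin 8 → ℝ) :
    fderiv ℝ KV p v = (v 4 * p 0 + p 4 * v 0) * p 7 + p 4 * p 0 * v 7 := by
  have h1 : HasDerivAt (fun x : ℝ => p + x • v) v 0 := by
    simpa using ((hasDerivAt_id (0 : ℝ)).smul_const v).const_add p
  have d := hasDerivAt_pi.1 h1
  have h2 := ((d 4).mul (d 0)).mul (d 7)
  have h3 : HasFDerivAt KV (fderiv ℝ KV p) (p + (0 : ℝ) • v) := by
    simpa using (contDiff_KV.contDiffAt.differentiableAt (by simp)).hasFDerivAt
  have h4 := (h3.comp_hasDerivAt (0 : ℝ) h1).unique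
    (f := KV ∘ fun x : ℝ => p + x • v) h2
  simpa using h4

lemma fderiv_TKQ (t : ℝ) {p : Fin 8 → ℝ} (hp : p ∈ admissible) (v : Fin 8 → ℝ) :
    fderiv ℝ (TKQ t) p v =
      ![dTV t p v, (v 4 * p 0 + p 4 * v 0) * p 7 + p 4 * p 0 * v 7] := by
  rw [← fderiv_TV t hp.2.ne', ← fderiv_KV, fderiv_pi fun i => ?_]
  · ext i
    fin_cases i <;> rfl
  · fin_cases i
    · exact (contDiffAt_TV t hp.2.ne').differentiableAt (by simp)
    · exact contDiff_KV.contDiffAt.differentiableAt (by simp)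

lemma surjective_fderiv_TQ {t : ℝ} (ht : t ≠ 0) {p : Fin 8 → ℝ} (hp : p ∈ admissible)
    (hT : TV t p = 0) : Function.Surjective (fderiv ℝ (TQ t) p) := by
  obtain ⟨v, hv⟩ := exists_dTV_ne_zero ht hp hT
  refine fun x => ⟨(x 0 / dTV t p v) • v, ?_⟩
  rw [map_smul, fderiv_TQ t hp]
  ext i
  fin_cases i
  simp [hv]

/-- The differential is triangular: at `s' = 0` a variation fixing `s'` does not change `K`, while
varying `s'` changes `K` at the nonzero rate `C F`. -/
lemma surjective_fderiv_TKQ {t : ℝ} (ht : t ≠ 0) {p : Fin 8 → ℝ} (hp : p ∈ admissible)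
    (hT : TV t p = 0) (h7 : p 7 = 0) (hf : field t p ≠ (p 5 / p 4) • sclGen p) :
    Function.Surjective (fderiv ℝ (TKQ t) p) := by
  obtain ⟨v, hv7, hv⟩ := exists_dTV_ne_zero_of_csc ht hp hT h7 hf
  have h0 := hp.1
  have h4 := hp.2.ne'
  refine fun x => ⟨((x 0 - x 1 / (p 4 * p 0) * dTV t p (Pi.single 7 1)) / dTV t p v) • v
    + (x 1 / (p 4 * p 0)) • Pi.single 7 1, ?_⟩
  rw [map_add, map_smul, map_smul, fderiv_TKQ t hp, fderiv_TKQ t hp]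
  ext i
  fin_cases i
  · simp [hv]
  · simp [h7, hv7, h0, h4]

/-! ## Submanifolds of initial conditions -/

lemma isSubmanifold_of_level {d e : ℕ} (hde : 8 = d + e) {U S : Set (Fin 8 → ℝ)} (hU : IsOpen U)
    {Q : (Fin 8 → ℝ) → Fin e → ℝ} (hQ : ContDiffOn ℝ ∞ Q U) (hS : S = {p ∈ U | Q p = 0})
    (hs : ∀ p ∈ S, Function.Surjective (fderiv ℝ Q p)) : IsSubmanifold d e S := by
  intro p hp
  obtain ⟨φ, h1, h2, h3, h4, h5⟩ := exists_chart (by simpa using hde) hU hQ (hS ▸ hp).1 (hs p hp)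
  refine ⟨φ, h1, h3, h4, fun q hq => ?_⟩
  rw [hS, h5 q hq]
  exact ⟨fun h => h.2, fun h => ⟨h2 hq, h⟩⟩

lemma TQ_eq_zero_iff {t : ℝ} {p : Fin 8 → ℝ} : TQ t p = 0 ↔ TV t p = 0 := by
  simp [TQ, funext_iff]

lemma TKQ_eq_zero_iff {t : ℝ} {p : Fin 8 → ℝ} : TKQ t p = 0 ↔ TV t p = 0 ∧ KV p = 0 := by
  simp [TKQ, funext_iff, Fin.forall_fin_two]

lemma isSubmanifold_reducedDataSet {t : ℝ} (ht : t ≠ 0) (z₀ : ℝ) :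
    IsSubmanifold 7 1 (reducedDataSet t z₀) := by
  refine isSubmanifold_of_level (by norm_num) isOpen_admissible (contDiffOn_TQ t)
    (by simp only [reducedDataSet_eq, TQ_eq_zero_iff]) fun p hp => ?_
  rw [reducedDataSet_eq] at hp
  exact surjective_fderiv_TQ ht hp.1 hp.2

lemma isSubmanifold_dataSet_isBtFlat {t : ℝ} (ht : t ≠ 0) (z₀ : ℝ) :
    IsSubmanifold 7 1 (dataSet (IsBtFlat t) z₀) := by
  refine isSubmanifold_of_level (by norm_num) isOpen_positiveData
    ((contDiffOn_TQ t).mono positiveData_subset)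
    (by simp only [dataSet_isBtFlat ht, TQ_eq_zero_iff]) fun p hp => ?_
  rw [dataSet_isBtFlat ht] at hp
  exact surjective_fderiv_TQ ht (positiveData_subset hp.1) hp.2

lemma exists_csc_data (t : ℝ) : ∃ p ∈ positiveData, TV t p = 0 ∧ KV p = 0 :=
  -- With `F = 1` and `F' = F'' = s = s' = 0`, every term of `T` and of `K` vanishes.
  ⟨![1, 0, 0, 0, 1, 0, 0, 0], by simp [positiveData], by simp [TV], by simp [KV]⟩

/-! ## Density of the metrics that are not self-homothetic -/

lemma metricData_of_selfHomothetic {F C : ℝ → ℝ} {I : Set ℝ} (hI : IsOpen I)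
    (h : SelfHomothetic F C I) {z : ℝ} (hz : z ∈ I) :
    metricData F C z 1 = 0 ∧ metricData F C z 2 = 0 ∧ metricData F C z 3 = 0 := by
  obtain ⟨c, C₀, μ, h⟩ := h
  have d1 : ∀ x ∈ I, deriv F x = 0 := fun x hx =>
    (deriv_congr_of_eqOn (f' := fun _ => c) hI (fun y hy => (h y hy).1) hx).trans (deriv_const x c)
  have d2 : ∀ x ∈ I, deriv (deriv F) x = 0 := fun x hx =>
    (deriv_congr_of_eqOn (f' := fun _ => 0) hI d1 hx).trans (deriv_const x 0)
  exact ⟨d1 z hz, d2 z hz,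
    (deriv_congr_of_eqOn (f' := fun _ => 0) hI d2 hz).trans (deriv_const z 0)⟩

/-- The metrics which are not self-homothetic are dense, for classes that do not restrict `F'''` at
the metrics with `F' = 0`. -/
lemma dataSet_subset_closure {P : (ℝ → ℝ) → (ℝ → ℝ) → Set ℝ → Prop} {z₀ : ℝ}
    (h : ∀ p ∈ dataSet P z₀, p 1 = 0 → ∀ x, Function.update p 3 x ∈ dataSet P z₀) :
    dataSet P z₀ ⊆ closure (regularDataSet P z₀) := by
  intro p hp
  by_cases hr : p ∈ regularDataSet P z₀
  · exact subset_closure hr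
  obtain ⟨ε, hε, F, C, hP, hFC⟩ := id hp
  have hn : SelfHomothetic F C (Ioo (z₀ - ε) (z₀ + ε)) := by
    by_contra hn
    exact hr ⟨ε, hε, F, C, hP, hFC, hn⟩
  obtain ⟨h1, -, h3⟩ := metricData_of_selfHomothetic isOpen_Ioo hn
    (show z₀ ∈ _ by constructor <;> linarith)
  rw [hFC] at h1 h3
  -- A self-homothetic metric has constant `F`, so any nonzero value of `F'''` rules it out; letting
  -- this value tend to 0 recovers `p`.
  have hreg : ∀ x ≠ 0, Function.update p 3 x ∈ regularDataSet P z₀ := by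
    intro x hx
    obtain ⟨ε, hε, F, C, hP, hFC⟩ := h p hp h1 x
    refine ⟨ε, hε, F, C, hP, hFC, fun hn => hx ?_⟩
    obtain ⟨-, -, h3⟩ := metricData_of_selfHomothetic isOpen_Ioo hn
      (show z₀ ∈ _ by constructor <;> linarith)
    simpa [hFC] using h3
  have hc : Continuous fun x : ℝ => Function.update p 3 x := by fun_prop
  have h0 : (0 : ℝ) ∈ closure ({0}ᶜ : Set ℝ) := by
    rw [(dense_compl_singleton (0 : ℝ)).closure_eq]; trivial
  have := map_mem_closure (t := regularDataSet P z₀) hc h0 fun x hx => hreg x hx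
  rwa [show Function.update p 3 0 = p by rw [← h3, Function.update_eq_self]] at this

/-- `F'''` enters `T` only through the product `F' F'''`. -/
lemma TV_update {t : ℝ} {p : Fin 8 → ℝ} (h1 : p 1 = 0) (x : ℝ) :
    TV t (Function.update p 3 x) = TV t p := by
  simp [TV, h1]

lemma KV_update (p : Fin 8 → ℝ) (x : ℝ) : KV (Function.update p 3 x) = KV p := by
  simp [KV]

lemma update_mem_positiveData {p : Fin 8 → ℝ} (hp : p ∈ positiveData) (x : ℝ) :
    Function.update p 3 x ∈ positiveData := by
  simpa [positiveData] using hp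

/-! ## The families of metrics -/

lemma isFamilyUpToHomothety_isBtFlat {t : ℝ} (ht : t ≠ 0) (z₀ : ℝ) :
    IsFamilyUpToHomothety 5 (IsBtFlat t) z₀ := by
  refine ⟨?_, dataSet_subset_closure ?_, ?_⟩
  · obtain ⟨p, h1, h2, -⟩ := exists_csc_data t
    rw [dataSet_isBtFlat ht]
    exact ⟨p, h1, h2⟩
  · rw [dataSet_isBtFlat ht]
    rintro p ⟨h1, h2⟩ h x
    exact ⟨update_mem_positiveData h1 x, by rw [TV_update h, h2]⟩
  · rintro _ ⟨ε, hε, F, C, hP, rfl, hn⟩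
    have hz : z₀ ∈ Ioo (z₀ - ε) (z₀ + ε) := by constructor <;> linarith
    obtain ⟨hp, hT, -⟩ := isBtFlat_curve ht hP hz
    refine exists_family (t := t) (Q := TQ t) (by norm_num)
      ((contDiffOn_TQ t).mono positiveData_subset) ?_ ?_ ?_ (fun F C I h => h.1) ?_ hp
      (TQ_eq_zero_iff.2 hT) (surjective_fderiv_TQ ht (positiveData_subset hp) hT)
      (independent_of_not_selfHomothetic ht isPreconnected_Ioo hP hz hn)
    · intro I y hI hc hy z hz w hw
      rw [TQ, TQ, TV_const hI hc (fun x hx => ⟨positiveData_subset (hy x hx).1, (hy x hx).2⟩) hz hw]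
    · intro b q hq
      rw [TQ, TQ, TV_scl t b hq.2.ne']
    · intro I y hI _ hy hQ
      exact isBtFlat_of_integralCurve hI hy fun z hz => TQ_eq_zero_iff.1 (hQ z hz)
    · simp only [dataSet_isBtFlat ht, TQ_eq_zero_iff]

lemma isFamilyUpToHomothety_isCSCBtFlat {t : ℝ} (ht : t ≠ 0) (z₀ : ℝ) :
    IsFamilyUpToHomothety 4 (IsCSCBtFlat t) z₀ := by
  refine ⟨?_, dataSet_subset_closure ?_, ?_⟩
  · obtain ⟨p, h1, h2⟩ := exists_csc_data t
    rw [dataSet_isCSCBtFlat ht]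
    exact ⟨p, h1, h2⟩
  · rw [dataSet_isCSCBtFlat ht]
    rintro p ⟨h1, h2, h3⟩ h x
    exact ⟨update_mem_positiveData h1 x, by rw [TV_update h, h2], by rw [KV_update, h3]⟩
  · rintro _ ⟨ε, hε, F, C, hP, rfl, hn⟩
    have hz : z₀ ∈ Ioo (z₀ - ε) (z₀ + ε) := by constructor <;> linarith
    obtain ⟨hp, hT, -⟩ := isBtFlat_curve ht hP.1 hz
    have h7 := isCSCBtFlat_curve hP hz
    refine exists_family (t := t) (Q := TKQ t) (by norm_num)
      ((contDiffOn_TKQ t).mono positiveData_subset) ?_ ?_ ?_ (fun F C I h => h.1.1) ?_ hp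
      (TKQ_eq_zero_iff.2 ⟨hT, by rw [KV, h7, mul_zero]⟩)
      (surjective_fderiv_TKQ ht (positiveData_subset hp) hT h7 fun h => hn
        (selfHomothetic_of_field ht isPreconnected_Ioo hP.1 hz rfl h))
      (independent_of_not_selfHomothetic ht isPreconnected_Ioo hP.1 hz hn)
    · intro I y hI hc hy z hz w hw
      have hy' := fun x hx => And.intro (positiveData_subset (hy x hx).1) (hy x hx).2
      rw [TKQ, TKQ, TV_const hI hc hy' hz hw, KV_const hI hc hy' hz hw]
    · intro b q hq
      rw [TKQ, TKQ, TV_scl t b hq.2.ne', KV_scl]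
    · intro I y hI hc hy hQ
      exact isCSCBtFlat_of_integralCurve hI hc hy (fun z hz => (TKQ_eq_zero_iff.1 (hQ z hz)).1)
        fun z hz => (TKQ_eq_zero_iff.1 (hQ z hz)).2
    · simp only [dataSet_isCSCBtFlat ht, TKQ_eq_zero_iff]

/-! ## Conformally extremal metrics -/

section extremal

variable {ε : ℝ} {F K : ℝ → ℝ} {I : Set ℝ}

/-- The component `(∇_{E₂} ω)(E₀, E₃)` equals `-K (h + ε) / 2` with `h = K'/K`. So the Kähler
condition fixes `K` up to a constant on each interval. -/
lemma hlog_eq_of_isExtremalKahler (h : IsExtremalKahler ε F K I) {z : ℝ} (hz : z ∈ I) :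
    hlog K z = -ε := by
  obtain ⟨hF, hK⟩ := h.1.2.2.2 z hz
  have e := h.2.1 z hz 2 0 3
  have hF := hF.ne'
  simp [covDeriv2, D, conn_eq h.1 hz, Fin.sum_univ_four, px, connV, kForm, cxStr, g, gDiag] at e
  field_simp at e
  have : K z * (hlog K z + ε) = 0 := by linarith
  linarith [(mul_eq_zero.1 this).resolve_left hK.ne']

lemma hasDerivAt_of_isExtremalKahler (h : IsExtremalKahler ε F K I) {z : ℝ} (hz : z ∈ I) :
    HasDerivAt K (-ε * K z) z := by
  refine (hasDerivAt_of_contDiffOn h.1.1 h.1.2.2.1 hz).congr_deriv ?_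
  rw [← hlog_eq_of_isExtremalKahler h hz, hlog, div_mul_cancel₀ _ (h.1.2.2.2 z hz).2.ne']

lemma hasDerivAt_div_of_isExtremalKahler (h : IsExtremalKahler ε F K I) {z : ℝ} (hz : z ∈ I)
    {w : ℝ → ℝ} {w' : ℝ} (hw : HasDerivAt w w' z) :
    HasDerivAt (fun x => w x / K x) ((w' + ε * w z) / K z) z := by
  have hK := (h.1.2.2.2 z hz).2.ne'
  refine (hw.div (hasDerivAt_of_isExtremalKahler h hz) hK).congr_deriv ?_
  field_simp
  ring

lemma scal_of_isExtremalKahler (hε : ε ^ 2 = 1) (h : IsExtremalKahler ε F K I) {z : ℝ}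
    (hz : z ∈ I) :
    scal F K z = (8 - 8 * F z - 4 * deriv (deriv F) z + 12 * ε * deriv F z) / K z := by
  rw [scal_eq h.1 hz, hlog_eq_of_isExtremalKahler h hz, deriv_congr_of_eqOn (f' := fun _ => -ε)
    h.1.1 (fun x hx => hlog_eq_of_isExtremalKahler h hx) hz, deriv_const, scalV]
  congr 1
  linear_combination -6 * F z * hε

lemma jGradScal_one (h : IsExtremalKahler ε F K I) {z : ℝ} (hz : z ∈ I) :
    jGradScal ε F K 1 z = 2 * ε * F z * deriv (scal F K) z := by
  obtain ⟨hF, hK⟩ := h.1.2.2.2 z hz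
  have hF := hF.ne'
  have hK := hK.ne'
  simp [jGradScal, D, kForm, cxStr, g, gInv, gDiag]
  field_simp
  ring

/-- A metric in the conformal class of an extremal Kähler metric satisfies `L⁺ L⁻ F = 1`. -/
lemma Lplus_Lminus_of_isExtremalKahler (hε : ε ^ 2 = 1) (h : IsExtremalKahler ε F K I) {z : ℝ}
    (hz : z ∈ I) : Lplus (Lminus F) z = 1 := by
  obtain ⟨hF, hK⟩ := h.1.2.2.2 z hz
  have d1 : ∀ x ∈ I, deriv (scal F K) x = ((-8 * deriv F x - 4 * deriv (deriv (deriv F)) x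
      + 12 * ε * deriv (deriv F) x) + ε * (8 - 8 * F x - 4 * deriv (deriv F) x
      + 12 * ε * deriv F x)) / K x := by
    intro x hx
    obtain ⟨h0, h1, h2, -, -⟩ := hasDerivAt_jets h.1 hx
    rw [deriv_congr_of_eqOn h.1.1 (fun y hy => scal_of_isExtremalKahler hε h hy) hx]
    refine HasDerivAt.deriv ((hasDerivAt_div_of_isExtremalKahler h hx ((((h0.const_mul 8).const_sub
      8).sub (h2.const_mul 4)).add (h1.const_mul (12 * ε)))).congr_deriv ?_)
    simp only [Pi.add_apply, Pi.sub_apply]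
    ring
  obtain ⟨h0, h1, h2, h3, -⟩ := hasDerivAt_jets h.1 hz
  have d2 := (((((h1.const_mul (-8)).sub (h3.const_mul 4)).add (h2.const_mul (12 * ε))).add
    ((((h0.const_mul 8).const_sub 8).sub (h2.const_mul 4)).add
      (h1.const_mul (12 * ε)) |>.const_mul ε)))
  have d2 := (hasDerivAt_div_of_isExtremalKahler h hz d2).congr_of_eventuallyEq
    (Filter.eventuallyEq_of_mem (h.1.1.mem_nhds hz) d1)
  have d3 := deriv_congr_of_eqOn h.1.1 (fun x hx => jGradScal_one h hx) hz
  have d4 : deriv (fun x => 2 * ε * F x * deriv (scal F K) x) z = _ :=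
    ((h0.const_mul (2 * ε)).mul d2).deriv
  rw [d4] at d3
  -- This component of the Killing equation says that `s'/K` has zero derivative, which is a
  -- fourth-order linear equation for `F`.
  have e := h.2.2 z hz 0 1
  simp only [covDeriv1, conn_eq h.1 hz, Fin.sum_univ_four, px, connV, D, if_true, d3] at e
  simp [jGradScal_one h hz, d1 z hz, hlog_eq_of_isExtremalKahler h hz] at e
  rw [Lplus_Lminus (h.1.2.1.contDiffAt (h.1.1.mem_nhds hz))]
  have hF := hF.ne'
  have hK := hK.ne'
  field_simp at e
  have key : F z * (1 / 4 * deriv (deriv (deriv (deriv F))) z - 5 / 4 * deriv (deriv F) z + F z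
      - 1) = 0 := by
    obtain rfl | rfl := sq_eq_one_iff.1 hε
    · linear_combination -1 / 32 * e
    · linear_combination 1 / 32 * e
  exact sub_eq_zero.1 ((mul_eq_zero.1 key).resolve_left hF)

lemma Lplus_Lminus_of_isConformallyExtremal (h : IsConformallyExtremal F I) {z : ℝ}
    (hz : z ∈ I) : Lplus (Lminus F) z = 1 := by
  obtain ⟨K, h | h⟩ := h
  · exact Lplus_Lminus_of_isExtremalKahler (by norm_num) h hz
  · exact Lplus_Lminus_of_isExtremalKahler (by norm_num) h hz

end extremal

theorem exists_not_isConformallyExtremal {t : ℝ} (ht : t ≠ 0) :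
    ∃ (a b : ℝ) (F C : ℝ → ℝ), a < b ∧ IsCSCBtFlat t F C (Ioo a b) ∧
      ¬ IsConformallyExtremal F (Ioo a b) := by
  -- `F'''` is chosen so that `T = 0`, which is possible because `F' = 1 ≠ 0`; and `s' = 0` gives
  -- constant scalar curvature.
  let p : Fin 8 → ℝ := ![1, 1, 0, 5 / 2 - 33 / 32 * t, 1, 0, 1, 0]
  have hp : p ∈ dataSet (IsCSCBtFlat t) 0 := by
    rw [dataSet_isCSCBtFlat ht]
    refine ⟨by simp [p, positiveData], ?_, by simp [p, KV]⟩
    simp [p, TV]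
    ring
  obtain ⟨ε, hε, F, C, h, hFC⟩ := hp
  refine ⟨0 - ε, 0 + ε, F, C, by linarith, h, fun he => ?_⟩
  have hz : (0 : ℝ) ∈ Ioo (0 - ε) (0 + ε) := by constructor <;> linarith
  have h1 := Lplus_Lminus_of_isConformallyExtremal he hz
  rw [Lplus_Lminus (h.1.1.2.1.contDiffAt (h.1.1.1.mem_nhds hz))] at h1
  have hs := (solves_of_isBtFlat ht h.1 (eqOn_refl (scal F C) _)).1
  have h3 : deriv (deriv (deriv (deriv F))) 0 = f4V t p := by
    rw [← hFC]
    exact ((reduced_iff t (hs.2.1.contDiffAt (hs.1.mem_nhds hz))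
      (hs.2.2.1.contDiffAt (hs.1.mem_nhds hz)) (hs.2.2.2.1.contDiffAt (hs.1.mem_nhds hz))
      (hs.2.2.2.2.1 0 hz).1 (hs.2.2.2.2.1 0 hz).2).1 (hs.2.2.2.2.2 0 hz)).1
  have h4 : deriv (deriv F) 0 = 0 := congrFun hFC 2
  have h5 : F 0 = 1 := congrFun hFC 0
  rw [h3, h4, h5] at h1
  -- Here `C'' = 5/12` and `F'''' = 11 t / 16`, so `L⁺ L⁻ F - 1 = F''''/4` is nonzero for `t ≠ 0`.
  simp [f4V, c2V, p] at h1
  exact h1.elim ht (by norm_num)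

/-! ## The reduced system is critically determined -/

theorem exists_highest_derivatives (t : ℝ) :
    ∃ Φ : (Fin 8 → ℝ) → (Fin 3 → ℝ), ContDiffOn ℝ ∞ Φ admissible ∧
      ∀ (F C s : ℝ → ℝ) (z : ℝ), ContDiffAt ℝ ∞ F z → ContDiffAt ℝ ∞ C z → ContDiffAt ℝ ∞ s z →
        F z ≠ 0 → 0 < C z →
        ((opE F C s z = 0 ∧ opF1 F C s z = 0 ∧ opF2 t F C s z = 0) ↔
          ![iteratedDeriv 4 F z, iteratedDeriv 2 C z, iteratedDeriv 2 s z]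
            = Φ (cauchyData F C s z)) := by
  refine ⟨fun p => ![f4V t p, c2V p, s2V p], contDiffOn_pi.2 fun i => ?_,
    fun F C s z hF hC hs hF0 hC0 => ?_⟩
  · fin_cases i
    exacts [contDiffOn_f4V t, contDiffOn_c2V, contDiffOn_s2V]
  · rw [reduced_iff t hF hC hs hF0 hC0]
    simp [iteratedDeriv_succ, iteratedDeriv_zero, funext_iff, Fin.forall_fin_succ]

theorem exists_solvesReduced (t z₀ : ℝ) {p : Fin 8 → ℝ} (hp : p ∈ admissible) :
    ∃ ε > 0, ∃ F C s : ℝ → ℝ, SolvesReduced t F C s (Ioo (z₀ - ε) (z₀ + ε)) ∧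
      cauchyData F C s z₀ = p := by
  obtain ⟨ε, hε, y, hy0, hy⟩ := exists_integralCurve t z₀ isOpen_admissible subset_rfl hp
  obtain ⟨h1, h2⟩ := solves_of_integralCurve isOpen_Ioo hy
  exact ⟨ε, hε, _, _, _, h1, (h2 z₀ (by constructor <;> linarith)).trans hy0⟩

theorem opT_const {t : ℝ} {I : Set ℝ} {F C s : ℝ → ℝ} (hc : IsPreconnected I)
    (h : SolvesReduced t F C s I) {z w : ℝ} (hz : z ∈ I) (hw : w ∈ I) :
    opT t F C s z = opT t F C s w := by
  rw [opT_eq t (h.2.1.contDiffAt (h.1.mem_nhds hz)), opT_eq t (h.2.1.contDiffAt (h.1.mem_nhds hw))]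
  exact TV_const h.1 hc (fun x hx => ⟨cauchyData_mem h hx, hasDerivAt_cauchyData h hx⟩) hz hw

end U2

end

theorem mainTheorem2 (t : ℝ) :
    -- the reduced system is critically determined where `F ≠ 0`, `C > 0`:
    -- it can be solved for the highest derivatives of the three unknowns
    (∃ Φ : (Fin 8 → ℝ) → (Fin 3 → ℝ), ContDiffOn ℝ ∞ Φ U2.admissible ∧
      ∀ (F C s : ℝ → ℝ) (z : ℝ), ContDiffAt ℝ ∞ F z → ContDiffAt ℝ ∞ C z → ContDiffAt ℝ ∞ s z →
        F z ≠ 0 → 0 < C z →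
        ((U2.opE F C s z = 0 ∧ U2.opF1 F C s z = 0 ∧ U2.opF2 t F C s z = 0) ↔
          ![iteratedDeriv 4 F z, iteratedDeriv 2 C z, iteratedDeriv 2 s z]
            = Φ (U2.cauchyData F C s z))) ∧
    -- and eight initial conditions determine a unique solution
    (∀ z₀ : ℝ, ∀ p ∈ U2.admissible, ∃ ε > 0, ∃ F C s : ℝ → ℝ,
      U2.SolvesReduced t F C s (Ioo (z₀ - ε) (z₀ + ε)) ∧ U2.cauchyData F C s z₀ = p) ∧
    (∀ (I : Set ℝ) (z₀ : ℝ) (F C s F' C' s' : ℝ → ℝ), IsPreconnected I → z₀ ∈ I →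
      U2.SolvesReduced t F C s I → U2.SolvesReduced t F' C' s' I →
      U2.cauchyData F C s z₀ = U2.cauchyData F' C' s' z₀ →
      EqOn F F' I ∧ EqOn C C' I ∧ EqOn s s' I) ∧
    -- `T` is a constant of the motion
    (∀ (I : Set ℝ) (F C s : ℝ → ℝ), IsPreconnected I → U2.SolvesReduced t F C s I →
      ∀ z ∈ I, ∀ w ∈ I, U2.opT t F C s z = U2.opT t F C s w) ∧
    (t ≠ 0 →
      -- the reduced system with `T = 0` is the system of the `B^t`-flat metrics
      (∀ (I : Set ℝ) (F C s : ℝ → ℝ), (∀ z ∈ I, 0 < F z) →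
        ((U2.SolvesReduced t F C s I ∧ ∀ z ∈ I, U2.opT t F C s z = 0) ↔
          (U2.IsBtFlat t F C I ∧ EqOn s (U2.scal F C) I))) ∧
      -- the solutions with `T = 0`, and the `B^t`-flat metrics, form 7-parameter families
      (∀ z₀ : ℝ,
        (U2.reducedDataSet t z₀).Nonempty ∧ U2.IsSubmanifold 7 1 (U2.reducedDataSet t z₀) ∧
        (U2.dataSet (U2.IsBtFlat t) z₀).Nonempty ∧
        U2.IsSubmanifold 7 1 (U2.dataSet (U2.IsBtFlat t) z₀)) ∧
      -- up to homothety, 5 parameters remain, and 4 for constant scalar curvature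
      (∀ z₀ : ℝ, U2.IsFamilyUpToHomothety 5 (U2.IsBtFlat t) z₀ ∧
        U2.IsFamilyUpToHomothety 4 (U2.IsCSCBtFlat t) z₀) ∧
      -- some metrics of constant scalar curvature are not conformal to an extremal metric
      (∃ (a b : ℝ) (F C : ℝ → ℝ), a < b ∧ U2.IsCSCBtFlat t F C (Ioo a b) ∧
        ¬ U2.IsConformallyExtremal F (Ioo a b))) := by
  refine ⟨U2.exists_highest_derivatives t, fun z₀ p hp => U2.exists_solvesReduced t z₀ hp,
    fun I z₀ F C s F' C' s' hc hz h h' he => ?_,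
    fun I F C s hc h z hz w hw => U2.opT_const hc h hz hw, fun ht =>
    ⟨fun I F C s hF => U2.solvesReduced_iff_isBtFlat ht hF, fun z₀ => ⟨?_,
      U2.isSubmanifold_reducedDataSet ht z₀, (U2.isFamilyUpToHomothety_isBtFlat ht z₀).1,
      U2.isSubmanifold_dataSet_isBtFlat ht z₀⟩, fun z₀ =>
      ⟨U2.isFamilyUpToHomothety_isBtFlat ht z₀, U2.isFamilyUpToHomothety_isCSCBtFlat ht z₀⟩,
      U2.exists_not_isConformallyExtremal ht⟩⟩
  · have e := U2.solves_unique hc hz h h' he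
    exact ⟨fun z hz => congrFun (e hz) 0, fun z hz => congrFun (e hz) 4,
      fun z hz => congrFun (e hz) 6⟩
  · obtain ⟨p, h1, h2, -⟩ := U2.exists_csc_data t
    rw [U2.reducedDataSet_eq]
    exact ⟨p, U2.positiveData_subset h1, h2⟩
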